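/- **Setting.** Let $S$ be a string of length $n$ over a totally ordered alphabet whose last character is strictly smaller than all its other characters, let $\mathsf{L}$ be its Burrows–Wheeler transform and $\mathsf{LF}$ its LF-mapping, $\mathsf{LF}[i]=|\{k : \mathsf{L}[k]<\mathsf{L}[i]\}|+|\{k\le i : \mathsf{L}[k]=\mathsf{L}[i]\}|$. A block $B=d-[i,j]$ is an integer $d\ge 0$ with an interval $[i,j]\subseteq[1,n]$, $i\le j$, such that $\mathsf{L}[\mathsf{LF}^x[i]]=\mathsf{L}[\mathsf{LF}^x[i+1]]=\dots=\mathsf{L}[\mathsf{LF}^x[j]]$ for all $0\le x\le d$; its height is $h_B=j-i+1$, its width is $w_B=d+1$, and its positions are those in the columns $[\mathsf{LF}^x[i],\mathsf{LF}^x[j]]$, $0\le x\le d$. Two different blocks collide at each position which they share. $B$ is a run-block if $[i,j]$ and $[\mathsf{LF}^d[i],\mathsf{LF}^d[j]]$ are full (maximal) runs of $\mathsf{L}$; a run-block is width-maximal if no run-block of the same height that collides with it is wider. Let $\mathcal{RB}$ be a finite set of width-maximal run-blocks of $\mathsf{L}$. **Greedy block choice.** Every block carries a record, initialised by a given function of the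 block, from which its real-valued score is read off. Put $tc=0$, $t_{\mathrm{best}}=0$, $b_{\mathrm{best}}=0$. For $t=1,\dots,m$, where $m$ is the initial size of $\mathcal{RB}$: choose a block $B\in\mathcal{RB}$ of maximal score (ties are broken arbitrarily); for every block $\tilde B$ which currently collides with $B$ at some position, update the record of $\tilde B$ by a given function of $B$, $\tilde B$ and their records, which may depend on whether $\tilde B$ is an inner ($h_{\tilde B}>h_B$) or an outer ($h_{\tilde B}<h_B$) colliding block of $B$; remove the collision of $I$ with $O$ at position $p$ whenever $I$ is an inner and $O$ an outer block currently colliding with $B$ at $p$; remove $B$, with all its collisions, from $\mathcal{RB}$; put $BS[t]=B$ and add the score of $B$ to $tc$; finally, if the given estimates satisfy $\text{gross-benefit}(tc)-\text{tax}(t)>b_{\mathrm{best}}$, put $t_{\mathrm{best}}=t$ and $b_{\mathrm{best}}=\text{gross-benefit}(tc)-\text{tax}(t)$. The result is $(BS,t_{\mathrm{best}})$. **Theorem.** Assume that each initialisation, reading and update of a score and each evaluation of the gross-benefit and tax estimators takes $O(1)$ time, and let the LF-mapping and a list of the blocks of $\mathcal{RB}$ be given. Then the greedy block choice can be performed in $O(n\log|\mathcal{RB}|)$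 time: there are one word-RAM program (word length at least $\log_2 n+O(1)$, addition, subtraction and halving of words, addition, subtraction and comparison of reals, each in one step) and one constant $C$ such that for every such $S$, every $\mathcal{RB}$, all score functions and update rules and all estimators, the program outputs a result of the greedy block choice within $C\cdot n\cdot\max(1,\log_2|\mathcal{RB}|)$ steps. -/

import Mathlib

/-!
# Burrows-Wheeler transform, run-blocks, greedy block choice, and a word RAM

Positions of strings of length `n` are elements of `Fin n`, that is, they are numbered from `0`.
-/

namespace BWTTunnel

universe u v

/-! ## Strings, suffix arrays, the Burrows-Wheeler transform and the LF-mapping -/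

/-- `S` is nullterminated: its last character is smaller than all its other characters
(in particular `S` is nonempty, and the last character occurs only at the end). -/
def NullTerminated {α : Type u} [LinearOrder α] {n : ℕ} (S : Fin n → α) : Prop :=
  ∃ e : Fin n, (e : ℕ) + 1 = n ∧ ∀ k : Fin n, k ≠ e → S e < S k

/-- The suffix of `S` starting at `a` is lexicographically smaller than the one starting at `b`. -/
def SuffixLT {α : Type u} [LinearOrder α] {n : ℕ} (S : Fin n → α) (a b : Fin n) : Prop :=
  ∃ (k : ℕ) (ha : (a : ℕ) + k < n) (hb : (b : ℕ) + k < n),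
    (∀ (l : ℕ) (hl : l < k), S ⟨a + l, by omega⟩ = S ⟨b + l, by omega⟩) ∧
      S ⟨a + k, ha⟩ < S ⟨b + k, hb⟩

/-- `SA` is the suffix array of `S`. -/
def IsSuffixArray {α : Type u} [LinearOrder α] {n : ℕ} (S : Fin n → α)
    (SA : Equiv.Perm (Fin n)) : Prop :=
  ∀ a b : Fin n, a < b → SuffixLT S (SA a) (SA b)

/-- The Burrows-Wheeler transform: the character which cyclically precedes the `r`-th suffix. -/
def bwt {α : Type u} {n : ℕ} (S : Fin n → α) (SA : Equiv.Perm (Fin n)) (r : Fin n) : α :=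
  if (SA r : ℕ) = 0 then S ⟨n - 1, by have := r.isLt; omega⟩
  else S ⟨(SA r : ℕ) - 1, by have := (SA r).isLt; omega⟩

/-- The value of the LF-mapping is a position: the two sets counted are disjoint and miss `r`. -/
theorem lf_lt {α : Type u} [LinearOrder α] {n : ℕ} (L : Fin n → α) (r : Fin n) :
    (Finset.univ.filter fun k => L k < L r).card
      + (Finset.univ.filter fun k => k < r ∧ L k = L r).card < n := by
  have hd : Disjoint (Finset.univ.filter fun k => L k < L r)
      (Finset.univ.filter fun k => k < r ∧ L k = L r) := by
    rw [Finset.disjoint_filter]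
    intro k _ h1 h2
    exact absurd h2.2 h1.ne
  rw [← Finset.card_union_of_disjoint hd]
  have hs : (Finset.univ.filter fun k => L k < L r) ∪
      (Finset.univ.filter fun k => k < r ∧ L k = L r) ⊂ (Finset.univ : Finset (Fin n)) := by
    rw [Finset.ssubset_univ_iff]
    intro h
    have hr := Finset.mem_univ r
    rw [← h] at hr
    simp at hr
  simpa using Finset.card_lt_card hs

/-- The LF-mapping of `L`: the number of characters of `L` smaller than `L r`, plus the number of
occurrences of `L r` in front of position `r` (positions are numbered from `0`). -/
def lf {α : Type u} [LinearOrder α] {n : ℕ} (L : Fin n → α) (r : Fin n) : Fin n :=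
  ⟨(Finset.univ.filter fun k => L k < L r).card
      + (Finset.univ.filter fun k => k < r ∧ L k = L r).card, lf_lt L r⟩

/-! ## Blocks, collisions and width-maximal run-blocks -/

/-- The data `d-[i,j]` of a block. -/
@[ext]
structure Block (n : ℕ) where
  d : ℕ
  i : Fin n
  j : Fin n

/-- The width `d + 1`. -/
def Block.width {n : ℕ} (B : Block n) : ℕ := B.d + 1

/-- The height `j - i + 1`. -/
def Block.height {n : ℕ} (B : Block n) : ℕ := (B.j : ℕ) + 1 - (B.i : ℕ)

/-- `B` is a block of `L`. -/
def IsBlock {α : Type u} [LinearOrder α] {n : ℕ} (L : Fin n → α) (B : Block n) : Prop :=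
  B.i ≤ B.j ∧ ∀ x ≤ B.d, ∀ r : Fin n, B.i ≤ r → r ≤ B.j →
    L ((lf L)^[x] r) = L ((lf L)^[x] B.i)

/-- The column `[LF^x[i], LF^x[j]]` of a block. -/
def column {α : Type u} [LinearOrder α] {n : ℕ} (L : Fin n → α) (B : Block n) (x : ℕ) :
    Set (Fin n) :=
  Set.Icc ((lf L)^[x] B.i) ((lf L)^[x] B.j)

/-- `p` is a position shared by the blocks `B` and `B'`. -/
def SharedPos {α : Type u} [LinearOrder α] {n : ℕ} (L : Fin n → α) (B B' : Block n)
    (p : Fin n) : Prop :=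
  ∃ x ≤ B.d, ∃ x' ≤ B'.d, p ∈ column L B x ∩ column L B' x'

/-- Two different blocks collide if they share a position. -/
def Collide {α : Type u} [LinearOrder α] {n : ℕ} (L : Fin n → α) (B B' : Block n) : Prop :=
  B ≠ B' ∧ ∃ p, SharedPos L B B' p

/-- A run of `L` starts at `r` (the first position always starts a run). -/
def RunStart {α : Type u} {n : ℕ} (L : Fin n → α) (r : Fin n) : Prop :=
  ∀ q : Fin n, (q : ℕ) + 1 = r → L r ≠ L q

/-- A run of `L` ends at `r` (the last position always ends a run). -/
def RunEnd {α : Type u} {n : ℕ} (L : Fin n → α) (r : Fin n) : Prop :=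
  ∀ q : Fin n, (r : ℕ) + 1 = q → L r ≠ L q

/-- `B` is a run-block: a block whose start and end intervals are full runs. -/
def IsRunBlock {α : Type u} [LinearOrder α] {n : ℕ} (L : Fin n → α) (B : Block n) : Prop :=
  IsBlock L B ∧ RunStart L B.i ∧ RunEnd L B.j ∧
    RunStart L ((lf L)^[B.d] B.i) ∧ RunEnd L ((lf L)^[B.d] B.j)

/-- `B` is a width-maximal run-block: no colliding run-block of the same height is wider. -/
def IsWidthMaximal {α : Type u} [LinearOrder α] {n : ℕ} (L : Fin n → α) (B : Block n) : Prop :=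
  IsRunBlock L B ∧ ∀ B' : Block n, IsRunBlock L B' → Collide L B B' → B.height = B'.height →
    B'.width ≤ B.width

/-! ## The greedy block choice -/

/-- An arbitrary scoring. Every block carries a record of type `σ`, from which its score is read
off; `init` is the initial record. If the block `B` with record `s` is chosen, a block `B'` with
record `s'` which is an inner (outer) colliding block of `B` gets the new record
`updInner B s B' s'` (`updOuter B s B' s'`). `grossBenefit` estimates the gross-benefit from the
number `tc` of removed run-characters, `tax` the tax from the number `t` of tunnels. -/
structure Scoring (n : ℕ) (σ : Type v) where
  init : Block n → σ
  score : σ → ℝ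
  updInner : Block n → σ → Block n → σ → σ
  updOuter : Block n → σ → Block n → σ → σ
  grossBenefit : ℝ → ℝ
  tax : ℕ → ℝ

/-- The state of the greedy block choice. `coll B B' p` says that the blocks `B` and `B'` currently
collide at their shared position `p`. -/
structure GState (n : ℕ) (σ : Type v) where
  remaining : Set (Block n)
  coll : Block n → Block n → Fin n → Prop
  record : Block n → σ
  BS : List (Block n)
  tBest : ℕ
  bBest : ℝ
  tc : ℝ

/-- `I` is an inner (that is, higher) colliding block of `B`, colliding at `p`. -/
def GState.InnerAt {n : ℕ} {σ : Type v} (s : GState n σ) (B I : Block n) (p : Fin n) : Prop :=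
  s.coll B I p ∧ B.height < I.height

/-- `O` is an outer (that is, less high) colliding block of `B`, colliding at `p`. -/
def GState.OuterAt {n : ℕ} {σ : Type v} (s : GState n σ) (B O : Block n) (p : Fin n) : Prop :=
  s.coll B O p ∧ O.height < B.height

/-- The initial state. -/
def GState.start {α : Type u} [LinearOrder α] {n : ℕ} {σ : Type v} (L : Fin n → α)
    (Sc : Scoring n σ) (RB : List (Block n)) : GState n σ where
  remaining := {B | B ∈ RB}
  coll := fun B B' p => B ∈ RB ∧ B' ∈ RB ∧ B ≠ B' ∧ SharedPos L B B' p
  record := Sc.init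
  BS := []
  tBest := 0
  bBest := 0
  tc := 0

open Classical in
/-- The state after choosing the block `B`: the scores of the blocks colliding with `B` are updated;
the collisions between inner and outer colliding blocks of `B` on the area of `B` are removed, and
so are all collisions of `B`; then `B` is moved to the result, and the best choice is updated. -/
noncomputable def GState.choose {n : ℕ} {σ : Type v} (Sc : Scoring n σ) (s : GState n σ)
    (B : Block n) : GState n σ where
  remaining := s.remaining \ {B}
  coll := fun X Y p => s.coll X Y p ∧ X ≠ B ∧ Y ≠ B ∧
    ¬ (s.InnerAt B X p ∧ s.OuterAt B Y p) ∧ ¬ (s.OuterAt B X p ∧ s.InnerAt B Y p)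
  record := fun B' =>
    if ∃ p, s.InnerAt B B' p then Sc.updInner B (s.record B) B' (s.record B')
    else if ∃ p, s.OuterAt B B' p then Sc.updOuter B (s.record B) B' (s.record B')
    else s.record B'
  BS := s.BS ++ [B]
  tBest :=
    if s.bBest < Sc.grossBenefit (s.tc + Sc.score (s.record B)) - Sc.tax (s.BS.length + 1)
    then s.BS.length + 1 else s.tBest
  bBest :=
    if s.bBest < Sc.grossBenefit (s.tc + Sc.score (s.record B)) - Sc.tax (s.BS.length + 1)
    then Sc.grossBenefit (s.tc + Sc.score (s.record B)) - Sc.tax (s.BS.length + 1) else s.bBest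
  tc := s.tc + Sc.score (s.record B)

/-- One pass of the loop: some remaining block of maximal score is chosen. -/
def GState.Step {n : ℕ} {σ : Type v} (Sc : Scoring n σ) (s s' : GState n σ) : Prop :=
  ∃ B ∈ s.remaining,
    (∀ B' ∈ s.remaining, Sc.score (s.record B') ≤ Sc.score (s.record B)) ∧ s' = s.choose Sc B

/-- `(BS, tBest)` is a result of the greedy block choice on the blocks `RB` (ties between blocks of
maximal score may be broken in any way). -/
def IsGreedyChoice {α : Type u} [LinearOrder α] {n : ℕ} {σ : Type v} (L : Fin n → α)
    (Sc : Scoring n σ) (RB : List (Block n)) (BS : List (Block n)) (tBest : ℕ) : Prop :=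
  ∃ s : GState n σ, Relation.ReflTransGen (GState.Step Sc) (GState.start L Sc RB) s ∧
    s.remaining = ∅ ∧ s.BS = BS ∧ s.tBest = tBest

/-! ## A word RAM with a step count

The machine has word registers and word arrays (indexed by words), real registers, and for each
block of the input, addressed by its number, a cell for the record of that block. The arithmetic of
words is `+`, truncated `-` and halving, modulo `2 ^ w`. The scoring is accessed through elementary
commands. Each evaluated node of an expression or of a test, and each command, takes one step. -/

/-- Word-valued expressions. -/
inductive Expr where
  | const (c : ℕ)
  | reg (x : ℕ)
  | load (a : ℕ) (e : Expr)
  | add (e₁ e₂ : Expr)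
  | sub (e₁ e₂ : Expr)
  | half (e : Expr)

/-- Tests. `rlt x y` compares the real registers `x` and `y`. -/
inductive Test where
  | lt (e₁ e₂ : Expr)
  | eq (e₁ e₂ : Expr)
  | rlt (x y : ℕ)
  | not (t : Test)
  | and (t₁ t₂ : Test)

/-- Elementary commands: assignment of a word register, of an array cell, constants and arithmetic
of real registers, the score of a block, the two estimators, and the three operations on records. -/
inductive Cmd where
  | skip
  | set (x : ℕ) (e : Expr)
  | store (a : ℕ) (e₁ e₂ : Expr)
  | rzero (x : ℕ)
  | radd (x y z : ℕ)
  | rsub (x y z : ℕ)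
  | rscore (x : ℕ) (e : Expr)
  | rgross (x y : ℕ)
  | rtax (x : ℕ) (e : Expr)
  | initRecord (e : Expr)
  | updInner (e₁ e₂ : Expr)
  | updOuter (e₁ e₂ : Expr)

/-- Programs. -/
inductive Prog where
  | cmd (c : Cmd)
  | seq (p q : Prog)
  | ite (t : Test) (p q : Prog)
  | loop (t : Test) (p : Prog)

/-- The memory. A record cell is empty as long as it is not initialized. -/
structure Mem (σ : Type v) where
  reg : ℕ → ℕ
  arr : ℕ → ℕ → ℕ
  real : ℕ → ℝ
  record : ℕ → Option σ

/-- What is fixed during a run: the word length, the blocks by number, and the scoring. -/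
structure Env (n : ℕ) (σ : Type v) where
  w : ℕ
  blocks : List (Block n)
  scoring : Scoring n σ

/-- The value of an expression for word length `w`. -/
def Expr.eval {σ : Type v} (w : ℕ) (s : Mem σ) : Expr → ℕ
  | .const c => c % 2 ^ w
  | .reg x => s.reg x
  | .load a e => s.arr a (e.eval w s)
  | .add e₁ e₂ => (e₁.eval w s + e₂.eval w s) % 2 ^ w
  | .sub e₁ e₂ => e₁.eval w s - e₂.eval w s
  | .half e => e.eval w s / 2

/-- The number of steps for evaluating an expression. -/
def Expr.cost : Expr → ℕ
  | .const _ => 1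
  | .reg _ => 1
  | .load _ e => e.cost + 1
  | .add e₁ e₂ => e₁.cost + e₂.cost + 1
  | .sub e₁ e₂ => e₁.cost + e₂.cost + 1
  | .half e => e.cost + 1

/-- The outcome of a test. -/
def Test.holds {σ : Type v} (w : ℕ) (s : Mem σ) : Test → Prop
  | .lt e₁ e₂ => e₁.eval w s < e₂.eval w s
  | .eq e₁ e₂ => e₁.eval w s = e₂.eval w s
  | .rlt x y => s.real x < s.real y
  | .not t => ¬ t.holds w s
  | .and t₁ t₂ => t₁.holds w s ∧ t₂.holds w s

/-- The number of steps for evaluating a test. -/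
def Test.cost : Test → ℕ
  | .lt e₁ e₂ => e₁.cost + e₂.cost + 1
  | .eq e₁ e₂ => e₁.cost + e₂.cost + 1
  | .rlt _ _ => 1
  | .not t => t.cost + 1
  | .and t₁ t₂ => t₁.cost + t₂.cost + 1

/-- Assign a word register. -/
def Mem.setReg {σ : Type v} (s : Mem σ) (x v : ℕ) : Mem σ :=
  { s with reg := Function.update s.reg x v }

/-- Assign the cell `k` of the array `a`. -/
def Mem.setArr {σ : Type v} (s : Mem σ) (a k v : ℕ) : Mem σ :=
  { s with arr := Function.update s.arr a (Function.update (s.arr a) k v) }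

/-- Assign a real register. -/
noncomputable def Mem.setReal {σ : Type v} (s : Mem σ) (x : ℕ) (r : ℝ) : Mem σ :=
  { s with real := Function.update s.real x r }

/-- Assign the record cell of block number `k`. -/
def Mem.setRecord {σ : Type v} (s : Mem σ) (k : ℕ) (r : Option σ) : Mem σ :=
  { s with record := Function.update s.record k r }

/-- Replace the record of block number `k'` by `f B r B' r'`, where `B`, `B'` are the blocks with
numbers `k`, `k'` and `r`, `r'` are their records (no effect if one of these is missing). -/
def Mem.updRecord {n : ℕ} {σ : Type v} (blocks : List (Block n))
    (f : Block n → σ → Block n → σ → σ) (s : Mem σ) (k k' : ℕ) : Mem σ :=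
  match blocks[k]?, s.record k, blocks[k']?, s.record k' with
  | some B, some r, some B', some r' => s.setRecord k' (some (f B r B' r'))
  | _, _, _, _ => s

/-- The effect of a command. The score of an empty record cell is read as `0`. -/
noncomputable def Cmd.run {n : ℕ} {σ : Type v} (E : Env n σ) (s : Mem σ) : Cmd → Mem σ
  | .skip => s
  | .set x e => s.setReg x (e.eval E.w s)
  | .store a e₁ e₂ => s.setArr a (e₁.eval E.w s) (e₂.eval E.w s)
  | .rzero x => s.setReal x 0
  | .radd x y z => s.setReal x (s.real y + s.real z)
  | .rsub x y z => s.setReal x (s.real y - s.real z)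
  | .rscore x e => s.setReal x ((s.record (e.eval E.w s)).elim 0 E.scoring.score)
  | .rgross x y => s.setReal x (E.scoring.grossBenefit (s.real y))
  | .rtax x e => s.setReal x (E.scoring.tax (e.eval E.w s))
  | .initRecord e =>
      s.setRecord (e.eval E.w s) ((E.blocks[e.eval E.w s]?).map E.scoring.init)
  | .updInner e₁ e₂ =>
      s.updRecord E.blocks E.scoring.updInner (e₁.eval E.w s) (e₂.eval E.w s)
  | .updOuter e₁ e₂ =>
      s.updRecord E.blocks E.scoring.updOuter (e₁.eval E.w s) (e₂.eval E.w s)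

/-- The number of steps of a command. -/
def Cmd.cost : Cmd → ℕ
  | .skip => 1
  | .set _ e => e.cost + 1
  | .store _ e₁ e₂ => e₁.cost + e₂.cost + 1
  | .rzero _ => 1
  | .radd _ _ _ => 1
  | .rsub _ _ _ => 1
  | .rscore _ e => e.cost + 1
  | .rgross _ _ => 1
  | .rtax _ e => e.cost + 1
  | .initRecord e => e.cost + 1
  | .updInner e₁ e₂ => e₁.cost + e₂.cost + 1
  | .updOuter e₁ e₂ => e₁.cost + e₂.cost + 1

/-- `Exec E p s c s'`: started in memory `s`, the program `p` halts after exactly `c` steps, leaving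
the memory `s'`. -/
inductive Exec {n : ℕ} {σ : Type v} (E : Env n σ) : Prog → Mem σ → ℕ → Mem σ → Prop where
  | cmd (c : Cmd) (s : Mem σ) : Exec E (.cmd c) s c.cost (c.run E s)
  | seq (p q : Prog) (s s₁ s₂ : Mem σ) (c₁ c₂ : ℕ) :
      Exec E p s c₁ s₁ → Exec E q s₁ c₂ s₂ → Exec E (.seq p q) s (c₁ + c₂) s₂
  | ite_true (t : Test) (p q : Prog) (s s₁ : Mem σ) (c₁ : ℕ) :
      t.holds E.w s → Exec E p s c₁ s₁ → Exec E (.ite t p q) s (t.cost + c₁) s₁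
  | ite_false (t : Test) (p q : Prog) (s s₁ : Mem σ) (c₁ : ℕ) :
      ¬ t.holds E.w s → Exec E q s c₁ s₁ → Exec E (.ite t p q) s (t.cost + c₁) s₁
  | loop_true (t : Test) (p : Prog) (s s₁ s₂ : Mem σ) (c₁ c₂ : ℕ) :
      t.holds E.w s → Exec E p s c₁ s₁ → Exec E (.loop t p) s₁ c₂ s₂ →
        Exec E (.loop t p) s (t.cost + c₁ + c₂) s₂
  | loop_false (t : Test) (p : Prog) (s : Mem σ) :
      ¬ t.holds E.w s → Exec E (.loop t p) s t.cost s

/-- The initial memory: register `0` holds `n`, register `1` the number of blocks, array `0` the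
LF-mapping, and the arrays `1`, `2`, `3` hold `d`, `i`, `j` of the blocks `d-[i,j]`; all else is
zero or empty. -/
def inputMem {α : Type u} [LinearOrder α] {n : ℕ} (L : Fin n → α) (RB : List (Block n))
    (σ : Type v) : Mem σ where
  reg := fun x => if x = 0 then n else if x = 1 then RB.length else 0
  arr := fun a k =>
    if a = 0 then (if h : k < n then (lf L ⟨k, h⟩ : ℕ) else 0)
    else if a = 1 then (RB[k]?).elim 0 (fun B => B.d)
    else if a = 2 then (RB[k]?).elim 0 (fun B => (B.i : ℕ))
    else if a = 3 then (RB[k]?).elim 0 (fun B => (B.j : ℕ))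
    else 0
  real := fun _ => 0
  record := fun _ => none

/-- The memory `s` holds the result `(BS, tBest)`: array `4` holds the numbers of the blocks of `BS`
in their order, and register `2` holds `tBest`. -/
def IsOutput {n : ℕ} {σ : Type v} (RB : List (Block n)) (s : Mem σ) (BS : List (Block n))
    (tBest : ℕ) : Prop :=
  BS.length = RB.length ∧ (∀ k < RB.length, RB[s.arr 4 k]? = BS[k]?) ∧ s.reg 2 = tBest

end BWTTunnel

open BWTTunnel

namespace BWTTunnel

/-! ## Geometry of blocks -/

section Geometry

variable {α : Type*} [LinearOrder α] {n : ℕ} {L : Fin n → α}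

/-! The geometry of width-maximal run-blocks makes the set of collisions small. LF carries each
column of a block onto the next one as an interval of the same length. Let a run-block `Y` meet a
lower run-block `X`. The first and the last column of `X` are full runs, so `Y` cannot reach beyond
`X` on either side: a column of `Y` would be contained in such a run, although `Y` is higher. The
first column of `Y` is a full run too, so it contains the column of `X` that it meets. Thus `Y`
starts at some column `x` of `X`, and the overlap consists of the columns of `X` from `x` up to `x`
plus the last column index of `Y` (`IsRunBlock.nested`, `StartsAt.fit`). Two width-maximal
run-blocks of equal height that share a position coincide, for otherwise they could be glued to a
wider run-block (`IsWidthMaximal.eq_of_height_eq`).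

Hence the columns of all blocks are a laminar family of intervals in `n` positions, and there are at
most `2 * n` of them (`Family.card_slots_le`). At most one block starts at a given column of another
one (`Family.start_unique`). So a table with one slot per column of each block records every
collision: slot `x` of the outer block `o` names the inner block that starts there.

This table is easy to maintain. The choice of `b` removes a collision between `o` and `i` if `b`
lies between them: `b` starts at column `x` of `o`, and `i` at column `y` of `b`, hence at column `x
+ y` of `o`. The whole overlap of `o` and `i` then lies inside `b`, so the collision disappears at
all its positions at once and a single slot is cleared. A slot is therefore present iff both of its
blocks remain and no chosen block lies between them (`Alive`). The order of the choices is
irrelevant, because a present collision with a remaining block `b` in between forces the two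
collisions with `b` to be present, and conversely (`Alive.split`, `Alive.trans`). `Tracks.choose`
identifies this description with the collisions of the abstract greedy choice.

For the time, the choice of `b` goes through the slots where `b` starts, kept in a linked list, and
through the columns of `b`. Over all choices this visits each slot at most twice, so there are
`O(n)` changes of records, each repaired in a tournament tree in logarithmic time. In addition, one
slot is cleared for each pair of a present outer collision and a present inner collision of `b`.
Different pairs clear different slots, which were present before and never are again
(`card_aliveSlots_erase`); all these products together are thus bounded by the number of slots. The
step counts are derived from potentials in `WP.loop`, and `passes_spec` uses exactly these two
budgets. -/

theorem lf_succ {p q : Fin n} (h : (p : ℕ) + 1 = q) (hL : L p = L q) :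
    (lf L q : ℕ) = lf L p + 1 := by
  have e : (Finset.univ.filter fun k => k < q ∧ L k = L q)
      = insert p (Finset.univ.filter fun k => k < p ∧ L k = L p) := by
    ext k
    simp only [Finset.mem_filter, Finset.mem_univ, true_and, Finset.mem_insert, Fin.lt_def,
      Fin.ext_iff, hL]
    constructor
    · rintro ⟨h1, h2⟩
      by_cases hk : (k : ℕ) = p
      · exact Or.inl hk
      · exact Or.inr ⟨by omega, h2⟩
    · rintro (h1 | ⟨h1, h2⟩)
      · exact ⟨by omega, by rw [Fin.ext h1, hL]⟩
      · exact ⟨by omega, h2⟩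
  simp only [lf, e, hL]
  rw [Finset.card_insert_of_notMem (by simp)]
  omega

theorem lf_strict {p q : Fin n} (h : L p < L q ∨ L p = L q ∧ p < q) : lf L p < lf L q := by
  have hd : ∀ r : Fin n, Disjoint (Finset.univ.filter fun k => L k < L r)
      (Finset.univ.filter fun k => k < r ∧ L k = L r) := by
    intro r
    rw [Finset.disjoint_filter]
    intro k _ h1 h2
    exact absurd h2.2 h1.ne
  rw [Fin.lt_def]
  simp only [lf]
  rw [← Finset.card_union_of_disjoint (hd p), ← Finset.card_union_of_disjoint (hd q)]
  apply Finset.card_lt_card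
  rw [Finset.ssubset_iff]
  refine ⟨p, by simp, ?_⟩
  intro k hk
  simp only [Finset.mem_insert, Finset.mem_union, Finset.mem_filter, Finset.mem_univ,
    true_and] at hk ⊢
  rcases hk with rfl | hk | hk
  · rcases h with h | h
    · exact Or.inl h
    · exact Or.inr ⟨h.2, h.1⟩
  · rcases h with h | h
    · exact Or.inl (hk.trans h)
    · exact Or.inl (h.1 ▸ hk)
  · rcases h with h | h
    · exact Or.inl (hk.2 ▸ h)
    · exact Or.inr ⟨hk.1.trans h.2, hk.2.trans h.1⟩

theorem lf_injective : Function.Injective (lf L) := by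
  intro p q h
  rcases lt_trichotomy (L p) (L q) with h1 | h1 | h1
  · exact absurd h (lf_strict (Or.inl h1)).ne
  · rcases lt_trichotomy p q with h2 | h2 | h2
    · exact absurd h (lf_strict (Or.inr ⟨h1, h2⟩)).ne
    · exact h2
    · exact absurd h (lf_strict (Or.inr ⟨h1.symm, h2⟩)).ne'
  · exact absurd h (lf_strict (Or.inl h1)).ne'

theorem IsBlock.iterate_add {B : Block n} (hB : IsBlock L B) {x : ℕ} (hx : x ≤ B.d) (t : ℕ)
    (r : Fin n) (hr : (r : ℕ) = B.i + t) (hrj : r ≤ B.j) :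
    ((lf L)^[x] r : ℕ) = (lf L)^[x] B.i + t := by
  induction t generalizing r with
  | zero => rw [Fin.ext (a := r) (b := B.i) (by omega)]; rfl
  | succ t ih =>
    have hr0 : (r : ℕ) - 1 < n := by omega
    have h1 := ih ⟨(r : ℕ) - 1, hr0⟩ (by simp; omega) (by rw [Fin.le_def] at *; simp; omega)
    -- Neighbouring rows stay neighbours under LF as long as their characters agree, which the block
    -- guarantees in the columns before `x`.
    have key : ∀ y ≤ x, ((lf L)^[y] ⟨(r : ℕ) - 1, hr0⟩ : ℕ) + 1 = (lf L)^[y] r := by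
      intro y
      induction y with
      | zero => intro _; simp; omega
      | succ y ihy =>
        intro hy
        rw [Function.iterate_succ_apply', Function.iterate_succ_apply']
        refine (lf_succ (ihy (by omega)) ?_).symm
        rw [hB.2 y (by omega) r (by rw [Fin.le_def]; omega) hrj,
          hB.2 y (by omega) ⟨(r : ℕ) - 1, hr0⟩ (by rw [Fin.le_def]; simp; omega)
            (by rw [Fin.le_def] at *; simp; omega)]
    have h2 := key x le_rfl
    omega

theorem IsBlock.iterate_j {B : Block n} (hB : IsBlock L B) {x : ℕ} (hx : x ≤ B.d) :
    ((lf L)^[x] B.j : ℕ) + 1 = (lf L)^[x] B.i + B.height := by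
  have h := hB.1
  rw [Fin.le_def] at h
  rw [hB.iterate_add hx (B.j - B.i) B.j (by omega) le_rfl, Block.height]
  omega

theorem IsBlock.height_pos {B : Block n} (hB : IsBlock L B) : 0 < B.height := by
  have h := hB.1
  rw [Fin.le_def] at h
  rw [Block.height]
  omega

theorem IsBlock.mem_column_iff {B : Block n} (hB : IsBlock L B) {x : ℕ} (hx : x ≤ B.d)
    {p : Fin n} : p ∈ column L B x ↔
      ((lf L)^[x] B.i : ℕ) ≤ p ∧ (p : ℕ) < (lf L)^[x] B.i + B.height := by
  have := hB.iterate_j hx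
  simp only [column, Set.mem_Icc, Fin.le_def]
  omega

theorem IsBlock.mem_column {B : Block n} (hB : IsBlock L B) {x : ℕ} (hx : x ≤ B.d)
    {p : Fin n} : p ∈ column L B x ↔ ∃ r ∈ Set.Icc B.i B.j, (lf L)^[x] r = p := by
  have h := hB.1
  rw [Fin.le_def] at h
  rw [hB.mem_column_iff hx]
  constructor
  · rintro ⟨h1, h2⟩
    rw [Block.height] at h2
    have hlt : (B.i : ℕ) + (p - (lf L)^[x] B.i) < n := by omega
    have hj : (⟨(B.i : ℕ) + (p - (lf L)^[x] B.i), hlt⟩ : Fin n) ≤ B.j := by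
      rw [Fin.le_def]; simp; omega
    refine ⟨⟨(B.i : ℕ) + (p - (lf L)^[x] B.i), hlt⟩, ⟨?_, hj⟩, ?_⟩
    · rw [Fin.le_def]; simp
    · apply Fin.ext
      rw [hB.iterate_add hx _ _ rfl hj]
      omega
  · rintro ⟨r, ⟨h1, h2⟩, rfl⟩
    have h1' := h1
    have h2' := h2
    rw [Fin.le_def] at h1' h2'
    rw [hB.iterate_add hx (r - B.i) r (by omega) h2, Block.height]
    omega

theorem IsBlock.const {B : Block n} (hB : IsBlock L B) {x : ℕ} (hx : x ≤ B.d)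
    {p : Fin n} (hp : p ∈ column L B x) : L p = L ((lf L)^[x] B.i) := by
  obtain ⟨r, hr, rfl⟩ := (hB.mem_column hx).1 hp
  exact hB.2 x hx r hr.1 hr.2

theorem IsBlock.start_mem {B : Block n} (hB : IsBlock L B) {x : ℕ} (hx : x ≤ B.d) :
    (lf L)^[x] B.i ∈ column L B x :=
  (hB.mem_column hx).2 ⟨B.i, ⟨le_rfl, hB.1⟩, rfl⟩

/-- LF is injective, so a position in column `a` has only one predecessor `e` steps earlier, the one
in the same row of the block. -/
theorem IsBlock.back {X : Block n} (hX : IsBlock L X) {a e : ℕ} (ha : a ≤ X.d) (he : e ≤ a)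
    {q : Fin n} (hp : (lf L)^[e] q ∈ column L X a) : q ∈ column L X (a - e) := by
  obtain ⟨r, hr, h⟩ := (hX.mem_column ha).1 hp
  refine (hX.mem_column (by omega)).2 ⟨r, hr, ?_⟩
  apply (lf_injective (L := L)).iterate e
  rw [← Function.iterate_add_apply, ← h, Nat.add_sub_cancel' he]

theorem IsBlock.exists_back {X : Block n} (hX : IsBlock L X) {a e : ℕ} (ha : a ≤ X.d)
    (he : e ≤ a) {p : Fin n} (hp : p ∈ column L X a) : ∃ q, (lf L)^[e] q = p := by
  obtain ⟨r, hr, rfl⟩ := (hX.mem_column ha).1 hp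
  exact ⟨(lf L)^[a - e] r, by rw [← Function.iterate_add_apply, Nat.add_sub_cancel' he]⟩

theorem IsBlock.fwd {X : Block n} (hX : IsBlock L X) {a e : ℕ} (h : a + e ≤ X.d)
    {p : Fin n} (hp : p ∈ column L X a) : (lf L)^[e] p ∈ column L X (a + e) := by
  obtain ⟨r, hr, rfl⟩ := (hX.mem_column (by omega)).1 hp
  exact (hX.mem_column h).2 ⟨r, hr, by rw [← Function.iterate_add_apply, add_comm]⟩

theorem column_subset_fwd {X Y : Block n} (hX : IsBlock L X) (hY : IsBlock L Y) {a c e : ℕ}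
    (ha : a + e ≤ X.d) (hc : c + e ≤ Y.d) (h : column L X a ⊆ column L Y c) :
    column L X (a + e) ⊆ column L Y (c + e) := by
  intro p hp
  obtain ⟨q, rfl⟩ := hX.exists_back ha (e := e) (by omega) hp
  have := hX.back ha (by omega) hp
  rw [Nat.add_sub_cancel] at this
  exact hY.fwd hc (h this)

theorem height_le_of_subset {X Y : Block n} (hX : IsBlock L X) (hY : IsBlock L Y) {a c : ℕ}
    (ha : a ≤ X.d) (hc : c ≤ Y.d) (h : column L X a ⊆ column L Y c) : X.height ≤ Y.height := by
  have h1 := (hY.mem_column_iff hc).1 (h (hX.start_mem ha))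
  have h2 := hX.iterate_j ha
  have h0 := hX.height_pos
  have h3 : (lf L)^[a] X.j ∈ column L X a := by
    rw [hX.mem_column_iff ha]
    omega
  have h4 := (hY.mem_column_iff hc).1 (h h3)
  omega

/-! ### Full runs and the nesting of run-blocks of different heights -/

theorem run_subset {α : Type*} {n : ℕ} {L : Fin n → α} {i j u v q : Fin n} (hi : RunStart L i) (hj : RunEnd L j)
    (hc : ∀ p ∈ Set.Icc u v, L p = L q) (hq : q ∈ Set.Icc u v) (hq' : q ∈ Set.Icc i j) :
    Set.Icc u v ⊆ Set.Icc i j := by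
  simp only [Set.mem_Icc, Fin.le_def] at hq hq' hc
  have h1 : i ≤ u := by
    by_contra h
    rw [Fin.le_def] at h
    have hlt : (i : ℕ) - 1 < n := by omega
    refine hi ⟨(i : ℕ) - 1, hlt⟩ (by simp; omega) ?_
    rw [hc i (by omega), hc ⟨(i : ℕ) - 1, hlt⟩ (by simp; omega)]
  have h2 : v ≤ j := by
    by_contra h
    rw [Fin.le_def] at h
    have hlt : (j : ℕ) + 1 < n := by omega
    refine hj ⟨(j : ℕ) + 1, hlt⟩ (by simp) ?_
    rw [hc j (by omega), hc ⟨(j : ℕ) + 1, hlt⟩ (by simp; omega)]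
  exact Set.Icc_subset_Icc h1 h2

theorem IsRunBlock.subset_start {X Y : Block n} (hX : IsRunBlock L X) (hY : IsBlock L Y) {c : ℕ}
    (hc : c ≤ Y.d) {q : Fin n} (hqX : q ∈ column L X 0) (hqY : q ∈ column L Y c) :
    column L Y c ⊆ column L X 0 := by
  refine run_subset hX.2.1 hX.2.2.1 ?_ hqY hqX
  intro p hp
  rw [hY.const hc hp, hY.const hc hqY]

theorem IsRunBlock.subset_end {X Y : Block n} (hX : IsRunBlock L X) (hY : IsBlock L Y) {c : ℕ}
    (hc : c ≤ Y.d) {q : Fin n} (hqX : q ∈ column L X X.d) (hqY : q ∈ column L Y c) :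
    column L Y c ⊆ column L X X.d := by
  refine run_subset hX.2.2.2.1 hX.2.2.2.2 ?_ hqY hqX
  intro p hp
  rw [hY.const hc hp, hY.const hc hqY]

/-- A block `Y` which is higher than a block `X` that it meets starts inside of the width
of `X`, ends inside of it, and contains the columns of `X` there. -/
theorem IsRunBlock.nested {X Y : Block n} (hX : IsRunBlock L X) (hY : IsRunBlock L Y)
    (hh : X.height < Y.height) {a c : ℕ} (ha : a ≤ X.d) (hc : c ≤ Y.d) {p : Fin n}
    (hpX : p ∈ column L X a) (hpY : p ∈ column L Y c) :
    c ≤ a ∧ Y.d - c ≤ X.d - a ∧ column L X (a - c) ⊆ column L Y 0 := by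
  -- Otherwise, `a` steps backwards, a column of `Y` meets column `0` of `X`. This is a full run, so
  -- it contains that column of `Y`, against the heights. The bound at the other end is symmetric.
  have h1 : c ≤ a := by
    by_contra h
    obtain ⟨q, rfl⟩ := hX.1.exists_back ha le_rfl hpX
    have q1 := hX.1.back ha le_rfl hpX
    have q2 := hY.1.back hc (by omega) hpY
    rw [Nat.sub_self] at q1
    have := height_le_of_subset hY.1 hX.1 (by omega) (by omega)
      (hX.subset_start hY.1 (by omega) q1 q2)
    omega
  have h2 : Y.d - c ≤ X.d - a := by
    by_contra h
    have q1 := hX.1.fwd (a := a) (e := X.d - a) (by omega) hpX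
    have q2 := hY.1.fwd (a := c) (e := X.d - a) (by omega) hpY
    rw [show a + (X.d - a) = X.d by omega] at q1
    have := height_le_of_subset hY.1 hX.1 (by omega) (by omega)
      (hX.subset_end hY.1 (by omega) q1 q2)
    omega
  refine ⟨h1, h2, ?_⟩
  obtain ⟨q, rfl⟩ := hY.1.exists_back hc le_rfl hpY
  have q1 := hX.1.back ha h1 hpX
  have q2 := hY.1.back hc le_rfl hpY
  rw [Nat.sub_self] at q2
  exact hY.subset_start hX.1 (by omega) q2 q1

/-! ### Run-blocks of equal height: the use of width-maximality -/

theorem start_eq_of_subset {X Y : Block n} (hX : IsBlock L X) (hY : IsBlock L Y)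
    (hh : X.height = Y.height) {a c : ℕ} (ha : a ≤ X.d) (hc : c ≤ Y.d)
    (h : column L X a ⊆ column L Y c) : (lf L)^[a] X.i = (lf L)^[c] Y.i := by
  have h1 := (hY.mem_column_iff hc).1 (h (hX.start_mem ha))
  have h2 := hX.iterate_j ha
  have h0 := hX.height_pos
  have h3 : (lf L)^[a] X.j ∈ column L X a := by
    rw [hX.mem_column_iff ha]
    omega
  have h4 := (hY.mem_column_iff hc).1 (h h3)
  exact Fin.ext (by omega)

/-- Column `c - a` of `Y` is the whole column `0` of `X`, as it lies in this full run and the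
heights agree. Were `X` to end later than `Y`, then `Y` continued along `X` would be a wider
run-block colliding with `Y`. So `Y` is at least as wide as `X`, and maximality of `X` leaves only
equality. The case `X = Y` is included and yields that the columns of one block are disjoint. -/
theorem IsWidthMaximal.eq_of_height_eq_aux {X Y : Block n} (hX : IsWidthMaximal L X)
    (hY : IsWidthMaximal L Y)
    (hh : X.height = Y.height) {a c : ℕ} (ha : a ≤ X.d) (hc : c ≤ Y.d) (hac : a ≤ c) {p : Fin n}
    (hpX : p ∈ column L X a) (hpY : p ∈ column L Y c) : X = Y ∧ a = c := by
  have hXb := hX.1.1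
  have hYb := hY.1.1
  obtain ⟨q, rfl⟩ := hXb.exists_back ha le_rfl hpX
  have q1 := hXb.back ha le_rfl hpX
  have q2 := hYb.back hc (by omega) hpY
  rw [Nat.sub_self] at q1
  have hsub := hX.1.subset_start hYb (by omega) q1 q2
  have hst := start_eq_of_subset hYb hXb hh.symm (by omega) (by omega) hsub
  have hen : (lf L)^[c - a] Y.j = X.j := by
    have e1 := hYb.iterate_j (x := c - a) (by omega)
    have e2 := hXb.iterate_j (x := 0) (by omega)
    rw [hst] at e1
    simp only [Function.iterate_zero, id] at e1 e2
    exact Fin.ext (by omega)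
  have hmax : c - a + X.d ≤ Y.d := by
    by_contra hlt
    -- The glued block starts where `Y` starts and ends where `X` ends.
    have hU : IsRunBlock L (⟨c - a + X.d, Y.i, Y.j⟩ : Block n) := by
      refine ⟨⟨hYb.1, ?_⟩, hY.1.2.1, hY.1.2.2.1, ?_, ?_⟩
      · intro x hx r h1 h2
        by_cases hxY : x ≤ Y.d
        · exact hYb.2 x hxY r h1 h2
        · simp only at hx
          obtain ⟨x', rfl⟩ : ∃ x', x = x' + (c - a) := ⟨x - (c - a), by omega⟩
          rw [Function.iterate_add_apply, Function.iterate_add_apply]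
          have m1 := hsub ((hYb.mem_column (x := c - a) (by omega)).2 ⟨r, ⟨h1, h2⟩, rfl⟩)
          have m2 := hsub (hYb.start_mem (x := c - a) (by omega))
          have m1' := hXb.fwd (a := 0) (e := x') (by omega) m1
          have m2' := hXb.fwd (a := 0) (e := x') (by omega) m2
          rw [hXb.const (by omega) m1', hXb.const (by omega) m2']
      · have := hX.1.2.2.2.1
        simp only [add_comm (c - a), Function.iterate_add_apply]
        rw [hst]
        exact this
      · have := hX.1.2.2.2.2
        simp only [add_comm (c - a), Function.iterate_add_apply]
        rw [hen]
        exact this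
    have := hY.2 _ hU ⟨?_, Y.i, 0, by omega, 0, by omega, ?_⟩ rfl
    · simp only [Block.width] at this
      omega
    · intro h
      have := congrArg Block.d h
      simp only at this
      omega
    · simp only [column, Function.iterate_zero, id]
      exact ⟨⟨le_rfl, hYb.1⟩, ⟨le_rfl, hYb.1⟩⟩
  have hXY : X = Y := by
    -- Maximality of `X` bounds the width of `Y`; together with `hmax` this forces `c = a` and equal
    -- widths.
    by_contra hne
    have := hX.2 Y hY.1 ⟨hne, _, a, ha, c, hc, hpX, hpY⟩ hh
    simp only [Block.width] at this
    have h0 : c - a = 0 := by omega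
    rw [h0] at hst hen
    exact hne (Block.ext (by omega) hst.symm hen.symm)
  subst hXY
  exact ⟨rfl, by omega⟩

/-- Different width-maximal run-blocks of the same height do not collide, and the columns of a
width-maximal run-block are disjoint. -/
theorem IsWidthMaximal.eq_of_height_eq {X Y : Block n} (hX : IsWidthMaximal L X)
    (hY : IsWidthMaximal L Y)
    (hh : X.height = Y.height) {a c : ℕ} (ha : a ≤ X.d) (hc : c ≤ Y.d) {p : Fin n}
    (hpX : p ∈ column L X a) (hpY : p ∈ column L Y c) : X = Y ∧ a = c := by
  rcases le_total a c with h | h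
  · exact hX.eq_of_height_eq_aux hY hh ha hc h hpX hpY
  · obtain ⟨h1, h2⟩ := hY.eq_of_height_eq_aux hX hh.symm hc ha h hpY hpX
    exact ⟨h1.symm, h2.symm⟩

end Geometry

/-! ## Collisions by block numbers -/

/-- Numerical properties of the collisions of `m` blocks: block `k` has the columns `0, …, D k` and
the height `H k`, and `inn o x = i + 1` says that column `x` of block `o` lies in column `0` of
block `i`. -/
structure CollisionTable (m : ℕ) (D H : ℕ → ℕ) (inn : ℕ → ℕ → ℕ) : Prop where
  lt : ∀ {o x i}, inn o x = i + 1 → o < m ∧ x ≤ D o ∧ i < m ∧ H o < H i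
  comp : ∀ {o x b y i}, inn o x = b + 1 → inn b y = i + 1 → inn o (x + y) = i + 1
  tri : ∀ {o x₁ y₁ z x₂ y₂ b}, inn o x₁ = z + 1 → inn o x₂ = b + 1 → y₁ ≤ D z → y₂ ≤ D b →
    x₁ + y₁ = x₂ + y₂ → (z = b ∧ x₁ = x₂) ∨ (∃ y, x₁ = x₂ + y ∧ inn b y = z + 1) ∨
      ∃ y, x₂ = x₁ + y ∧ inn z y = b + 1

/-- The collision of block `o` at its column `x` with the block starting there is still present
when `rem` is the set of the remaining blocks. -/
def Alive (m : ℕ) (inn : ℕ → ℕ → ℕ) (rem : Finset ℕ) (o x : ℕ) : Prop :=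
  o ∈ rem ∧ (∃ i ∈ rem, inn o x = i + 1) ∧
    ∀ z < m, z ∉ rem → ∀ x' y', x' + y' = x → inn o x' = z + 1 → inn z y' = inn o x → False

section Alive

variable {m : ℕ} {D H : ℕ → ℕ} {inn : ℕ → ℕ → ℕ} {rem : Finset ℕ} {b o x y : ℕ}

theorem Alive.of_erase (h : Alive m inn (rem.erase b) o x) : Alive m inn rem o x := by
  obtain ⟨h1, ⟨i, hi, hx⟩, h3⟩ := h
  exact ⟨Finset.mem_of_mem_erase h1, ⟨i, Finset.mem_of_mem_erase hi, hx⟩,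
    fun z hz hzr => h3 z hz fun h => hzr (Finset.mem_of_mem_erase h)⟩

/-- A chosen block lying between `o` and `b`, or between `b` and the inner block, would by `comp`
also lie between `o` and the inner block and would have removed their collision. -/
theorem Alive.split (G : CollisionTable m D H inn) (h : Alive m inn rem o (x + y))
    (hx : inn o x = b + 1) (hy : inn b y = inn o (x + y)) (hb : b ∈ rem) :
    Alive m inn rem o x ∧ Alive m inn rem b y := by
  obtain ⟨h1, ⟨i, hi, hxy⟩, h3⟩ := h
  refine ⟨⟨h1, ⟨b, hb, hx⟩, ?_⟩, ⟨hb, ⟨i, hi, hy.trans hxy⟩, ?_⟩⟩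
  · intro z hz hzr x' y' hs hx' hy'
    refine h3 z hz hzr x' (y' + y) (by omega) hx' ?_
    rw [hxy]
    exact G.comp (hy'.trans hx) (hy.trans hxy)
  · intro z hz hzr x' y' hs hx' hy'
    refine h3 z hz hzr (x + x') y' (by omega) (G.comp hx hx') (hy'.trans hy)

/-- A chosen block `z` between `o` and the inner block overlaps `b` in a common column of `o`. By
`tri` it is `b` itself, or it lies between `b` and the inner block, or between `o` and `b`; each
contradicts an assumption. -/
theorem Alive.trans (G : CollisionTable m D H inn) (h : Alive m inn rem o x)
    (hx : inn o x = b + 1) (h' : Alive m inn rem b y) :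
    Alive m inn rem o (x + y) ∧ inn o (x + y) = inn b y := by
  obtain ⟨h1, -, h3⟩ := h
  obtain ⟨hb, ⟨i, hi, hy⟩, h3'⟩ := h'
  have hxy := G.comp hx hy
  refine ⟨⟨h1, ⟨i, hi, hxy⟩, ?_⟩, hxy.trans hy.symm⟩
  intro z hz hzr x' y' hs hx' hy'
  rw [hxy] at hy'
  rcases G.tri hx' hx (G.lt hy').2.1 (G.lt hy).2.1 hs with ⟨rfl, -⟩ | ⟨u, hu, hbu⟩ | ⟨u, hu, hzu⟩
  · exact hzr hb
  · exact h3' z hz hzr u y' (by omega) hbu (hy'.trans hy.symm)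
  · exact h3 z hz hzr x' u hu.symm hx' (hzu.trans hx.symm)

/-- The choice of `b` ends a collision in one of three ways: `b` is its outer block, its inner
block, or a block in between. -/
theorem alive_erase_iff (hb : b ∈ rem) (hbm : b < m) :
    Alive m inn (rem.erase b) o x ↔ Alive m inn rem o x ∧ o ≠ b ∧ inn o x ≠ b + 1 ∧
      ∀ x' y', x' + y' = x → inn o x' = b + 1 → inn b y' = inn o x → False := by
  constructor
  · intro h
    refine ⟨h.of_erase, Finset.ne_of_mem_erase h.1, ?_, ?_⟩
    · obtain ⟨-, ⟨i, hi, hx⟩, -⟩ := h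
      have := Finset.ne_of_mem_erase hi
      omega
    · exact h.2.2 b hbm (by simp)
  · rintro ⟨⟨h1, ⟨i, hi, hx⟩, h3⟩, h4, h5, h6⟩
    refine ⟨Finset.mem_erase.2 ⟨h4, h1⟩, ⟨i, Finset.mem_erase.2 ⟨by omega, hi⟩, hx⟩, ?_⟩
    intro z hz hzr
    by_cases hzb : z = b
    · subst hzb
      exact h6
    · exact h3 z hz fun h => hzr (Finset.mem_erase.2 ⟨hzb, h⟩)

/-- The columns of the blocks `0, …, m - 1`. -/
def slots (m : ℕ) (D : ℕ → ℕ) : Finset (Σ _ : ℕ, ℕ) :=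
  (Finset.range m).sigma fun k => Finset.range (D k + 1)

theorem mem_slots {p : Σ _ : ℕ, ℕ} : p ∈ slots m D ↔ p.1 < m ∧ p.2 ≤ D p.1 := by
  simp [slots]

open Classical in
/-- The columns with a present collision. -/
noncomputable def aliveSlots (m : ℕ) (D : ℕ → ℕ) (inn : ℕ → ℕ → ℕ) (rem : Finset ℕ) :
    Finset (Σ _ : ℕ, ℕ) :=
  (slots m D).filter fun p => Alive m inn rem p.1 p.2

open Classical in
/-- The present collisions of block `b` with outer blocks. -/
noncomputable def outerSlots (m : ℕ) (D : ℕ → ℕ) (inn : ℕ → ℕ → ℕ) (rem : Finset ℕ) (b : ℕ) :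
    Finset (Σ _ : ℕ, ℕ) :=
  (aliveSlots m D inn rem).filter fun p => inn p.1 p.2 = b + 1

open Classical in
/-- The columns of block `b` with a present collision with an inner block. -/
noncomputable def innerCols (m : ℕ) (D : ℕ → ℕ) (inn : ℕ → ℕ → ℕ) (rem : Finset ℕ) (b : ℕ) :
    Finset ℕ :=
  (Finset.range (D b + 1)).filter fun y => Alive m inn rem b y

/-- This is the amortisation. An outer collision at column `x` of `o` and an inner one at column `y`
of `b` compose to a present slot `x + y` of `o`, which the choice of `b` makes absent for good. -/
theorem card_aliveSlots_erase (G : CollisionTable m D H inn) (hb : b ∈ rem) (hbm : b < m) :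
    (outerSlots m D inn rem b).card * (innerCols m D inn rem b).card
      + (aliveSlots m D inn (rem.erase b)).card ≤ (aliveSlots m D inn rem).card := by
  classical
  rw [← Finset.card_product]
  set T := (outerSlots m D inn rem b ×ˢ innerCols m D inn rem b).image
    fun q => (⟨q.1.1, q.1.2 + q.2⟩ : Σ _ : ℕ, ℕ) with hT
  have hc : T.card = (outerSlots m D inn rem b ×ˢ innerCols m D inn rem b).card := by
    apply Finset.card_image_of_injOn
    rintro ⟨⟨o, x⟩, y⟩ h1 ⟨⟨o', x'⟩, y'⟩ h2 h
    simp only [Finset.coe_product, Set.mem_prod, Finset.mem_coe, outerSlots, Finset.mem_filter,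
      innerCols] at h1 h2
    simp only [Sigma.mk.injEq, heq_eq_eq] at h
    obtain ⟨rfl, h⟩ := h
    -- The map from pairs to slots is injective: two different columns of `o` at which `b` starts,
    -- with a common later column, would by `tri` make `b` start inside itself.
    have hself : ∀ u, inn b u ≠ b + 1 := fun u hu => lt_irrefl _ (G.lt hu).2.2.2
    obtain ⟨i, -, hi⟩ := h1.2.2.2.1
    obtain ⟨i', -, hi'⟩ := h2.2.2.2.1
    rcases G.tri h1.1.2 h2.1.2 (G.lt hi).2.1 (G.lt hi').2.1 h with ⟨-, e⟩ | ⟨u, -, hu⟩ | ⟨u, -, hu⟩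
    · subst e
      simp only [Prod.mk.injEq, true_and]
      omega
    · exact absurd hu (hself u)
    · exact absurd hu (hself u)
  rw [← hc, ← Finset.card_union_of_disjoint]
  · apply Finset.card_le_card
    intro p hp
    rcases Finset.mem_union.1 hp with hp | hp
    · obtain ⟨⟨⟨o, x⟩, y⟩, hq, rfl⟩ := Finset.mem_image.1 hp
      simp only [Finset.mem_product, outerSlots, aliveSlots, Finset.mem_filter, innerCols,
        mem_slots] at hq ⊢
      obtain ⟨h1, h2⟩ := hq.1.1.2.trans G hq.1.2 hq.2.2
      obtain ⟨i, -, hi⟩ := h1.2.1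
      exact ⟨⟨hq.1.1.1.1, (G.lt hi).2.1⟩, h1⟩
    · simp only [aliveSlots, Finset.mem_filter] at hp ⊢
      exact ⟨hp.1, hp.2.of_erase⟩
  · rw [Finset.disjoint_left]
    intro p hp hp'
    obtain ⟨⟨⟨o, x⟩, y⟩, hq, rfl⟩ := Finset.mem_image.1 hp
    simp only [Finset.mem_product, outerSlots, aliveSlots, Finset.mem_filter, innerCols,
      mem_slots] at hq hp'
    obtain ⟨h1, h2⟩ := hq.1.1.2.trans G hq.1.2 hq.2.2
    exact ((alive_erase_iff hb hbm).1 hp'.2).2.2.2 x y rfl hq.1.2 h2.symm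

end Alive

/-! ## Families of width-maximal run-blocks -/

/-- `blk 0, …, blk (m - 1)` are different width-maximal run-blocks. -/
structure Family {α : Type*} [LinearOrder α] {n : ℕ} (L : Fin n → α) (m : ℕ)
    (blk : ℕ → Block n) : Prop where
  wm : ∀ k < m, IsWidthMaximal L (blk k)
  inj : ∀ k < m, ∀ k' < m, blk k = blk k' → k = k'

/-- Block `i` starts at column `x` of the other block `o`. -/
def StartsAt {α : Type*} [LinearOrder α] {n : ℕ} (L : Fin n → α) (m : ℕ)
    (blk : ℕ → Block n) (o x i : ℕ) : Prop :=
  o < m ∧ x ≤ (blk o).d ∧ i < m ∧ i ≠ o ∧ (lf L)^[x] (blk o).i ∈ column L (blk i) 0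

open Classical in
/-- One plus the number of the block which starts at column `x` of block `o`, or `0`. -/
noncomputable def starter {α : Type*} [LinearOrder α] {n : ℕ} (L : Fin n → α) (m : ℕ)
    (blk : ℕ → Block n) (o x : ℕ) : ℕ :=
  if h : ∃ i, StartsAt L m blk o x i then h.choose + 1 else 0

section Family

variable {α : Type*} [LinearOrder α] {n : ℕ} {L : Fin n → α} {m : ℕ} {blk : ℕ → Block n}
  {o i x y a c : ℕ} {p : Fin n}

theorem Family.rb (F : Family L m blk) (h : o < m) : IsRunBlock L (blk o) := (F.wm o h).1

theorem Family.bl (F : Family L m blk) (h : o < m) : IsBlock L (blk o) := (F.wm o h).1.1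

theorem Family.eq_of_height (F : Family L m blk) (ho : o < m) (hi : i < m) (ha : a ≤ (blk o).d)
    (hc : c ≤ (blk i).d) (hh : (blk o).height = (blk i).height)
    (hpo : p ∈ column L (blk o) a) (hpi : p ∈ column L (blk i) c) : o = i ∧ a = c := by
  obtain ⟨h1, h2⟩ := (F.wm o ho).eq_of_height_eq (F.wm i hi) hh ha hc hpo hpi
  exact ⟨F.inj o ho i hi h1, h2⟩

/-- Two full runs with a common position are the same interval, so the heights agree and the result
on equal heights applies. -/
theorem Family.start_unique (F : Family L m blk) (ho : o < m) (hi : i < m)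
    (hpo : p ∈ column L (blk o) 0) (hpi : p ∈ column L (blk i) 0) : o = i := by
  have h1 := height_le_of_subset (F.bl ho) (F.bl hi) (by omega) (by omega)
    ((F.rb hi).subset_start (F.bl ho) (by omega) hpi hpo)
  have h2 := height_le_of_subset (F.bl hi) (F.bl ho) (by omega) (by omega)
    ((F.rb ho).subset_start (F.bl hi) (by omega) hpo hpi)
  exact (F.eq_of_height ho hi (by omega) (by omega) (le_antisymm h1 h2) hpo hpi).1

theorem Family.starter_eq_iff (F : Family L m blk) :
    starter L m blk o x = i + 1 ↔ StartsAt L m blk o x i := by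
  unfold starter
  split_ifs with h
  · have hs := h.choose_spec
    constructor
    · intro e
      exact Nat.add_right_cancel e ▸ hs
    · intro hi
      rw [F.start_unique hs.2.2.1 hi.2.2.1 hs.2.2.2.2 hi.2.2.2.2]
  · constructor
    · intro e
      exact e.elim
    · intro hi
      exact absurd ⟨i, hi⟩ h

theorem StartsAt.subset (F : Family L m blk) (h : StartsAt L m blk o x i) :
    column L (blk o) x ⊆ column L (blk i) 0 :=
  (F.rb h.2.2.1).subset_start (F.bl h.1) h.2.1 h.2.2.2.2 ((F.bl h.1).start_mem h.2.1)

theorem StartsAt.height_lt (F : Family L m blk) (h : StartsAt L m blk o x i) :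
    (blk o).height < (blk i).height := by
  refine lt_of_le_of_ne (height_le_of_subset (F.bl h.1) (F.bl h.2.2.1) h.2.1 (by omega)
    (h.subset F)) ?_
  intro e
  exact h.2.2.2.1 (F.eq_of_height h.1 h.2.2.1 h.2.1 (by omega) e
    ((F.bl h.1).start_mem h.2.1) h.2.2.2.2).1.symm

theorem StartsAt.fit (F : Family L m blk) (h : StartsAt L m blk o x i) :
    x + (blk i).d ≤ (blk o).d := by
  have := (F.rb h.1).nested (F.rb h.2.2.1) (h.height_lt F) h.2.1 (by omega)
    ((F.bl h.1).start_mem h.2.1) h.2.2.2.2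
  have := h.2.1
  omega

theorem StartsAt.subset_add (F : Family L m blk) (h : StartsAt L m blk o x i)
    (hy : y ≤ (blk i).d) : column L (blk o) (x + y) ⊆ column L (blk i) y := by
  have := column_subset_fwd (F.bl h.1) (F.bl h.2.2.1) (a := x) (c := 0) (e := y)
    (by have := h.fit F; omega) (by omega) (h.subset F)
  rwa [Nat.zero_add] at this

theorem Family.startsAt_of_lt (F : Family L m blk) (ho : o < m) (hi : i < m)
    (hh : (blk o).height < (blk i).height) (ha : a ≤ (blk o).d) (hc : c ≤ (blk i).d)
    (hpo : p ∈ column L (blk o) a) (hpi : p ∈ column L (blk i) c) :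
    ∃ x, a = x + c ∧ StartsAt L m blk o x i := by
  obtain ⟨h1, h2, h3⟩ := (F.rb ho).nested (F.rb hi) hh ha hc hpo hpi
  refine ⟨a - c, by omega, ho, by omega, hi, ?_, h3 ((F.bl ho).start_mem (by omega))⟩
  rintro rfl
  exact lt_irrefl _ hh

theorem Family.startsAt_of_shared (F : Family L m blk) (ho : o < m) (hi : i < m)
    (ha : a ≤ (blk o).d) (hc : c ≤ (blk i).d)
    (hpo : p ∈ column L (blk o) a) (hpi : p ∈ column L (blk i) c) :
    (o = i ∧ a = c) ∨ (∃ x, a = x + c ∧ StartsAt L m blk o x i) ∨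
      ∃ x, c = x + a ∧ StartsAt L m blk i x o := by
  rcases lt_trichotomy (blk o).height (blk i).height with h | h | h
  · exact Or.inr (Or.inl (F.startsAt_of_lt ho hi h ha hc hpo hpi))
  · exact Or.inl (F.eq_of_height ho hi ha hc h hpo hpi)
  · exact Or.inr (Or.inr (F.startsAt_of_lt hi ho h hc ha hpi hpo))

/-- This passes from intervals to numbers. For `tri`, the two inner blocks share a position of a
common column of `o`, so they coincide or one starts inside the other. -/
theorem Family.collisionTable (F : Family L m blk) :
    CollisionTable m (fun k => (blk k).d) (fun k => (blk k).height) (starter L m blk) where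
  lt h := by
    have h := F.starter_eq_iff.1 h
    exact ⟨h.1, h.2.1, h.2.2.1, h.height_lt F⟩
  comp := by
    intro o x b y i h1 h2
    have h1 := F.starter_eq_iff.1 h1
    have h2 := F.starter_eq_iff.1 h2
    have hf := h1.fit F
    have hy := h2.2.1
    refine F.starter_eq_iff.2 ⟨h1.1, by omega, h2.2.2.1, ?_, ?_⟩
    · rintro rfl
      have := h1.height_lt F
      have := h2.height_lt F
      omega
    · exact h2.subset F (h1.subset_add F hy ((F.bl h1.1).start_mem (by omega)))
  tri := by
    intro o x₁ y₁ z x₂ y₂ b h1 h2 hy1 hy2 e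
    have h1 := F.starter_eq_iff.1 h1
    have h2 := F.starter_eq_iff.1 h2
    have hf := h1.fit F
    have hm := (F.bl h1.1).start_mem (x := x₁ + y₁) (by omega)
    have m1 := h1.subset_add F hy1 hm
    rw [e] at hm m1
    have m2 := h2.subset_add F hy2 hm
    rcases F.startsAt_of_shared h1.2.2.1 h2.2.2.1 hy1 hy2 m1 m2 with h | ⟨u, hu, h⟩ | ⟨u, hu, h⟩
    · exact Or.inl ⟨h.1, by omega⟩
    · exact Or.inr (Or.inr ⟨u, by omega, F.starter_eq_iff.2 h⟩)
    · exact Or.inr (Or.inl ⟨u, by omega, F.starter_eq_iff.2 h⟩)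

/-- The columns of the blocks form a laminar family of intervals. -/
theorem Family.card_slots_le (F : Family L m blk) :
    (slots m fun k => (blk k).d).card ≤ 2 * n := by
  classical
  set T := slots m fun k => (blk k).d with hT
  have key : ∀ s ∈ T, ∀ t ∈ T, ∀ q, q ∈ column L (blk s.1) s.2 → q ∈ column L (blk t.1) t.2 →
      (blk s.1).height = (blk t.1).height → s = t := by
    rintro ⟨o, a⟩ hs ⟨i, c⟩ ht q hq hq' hh
    rw [hT, mem_slots] at hs ht
    obtain ⟨rfl, rfl⟩ := F.eq_of_height hs.1 ht.1 hs.2 ht.2 hh hq hq'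
    rfl
  have key' : ∀ s ∈ T, ∀ t ∈ T, ∀ q, q ∈ column L (blk s.1) s.2 → q ∈ column L (blk t.1) t.2 →
      (blk s.1).height < (blk t.1).height →
      column L (blk s.1) s.2 ⊆ column L (blk t.1) t.2 := by
    rintro ⟨o, a⟩ hs ⟨i, c⟩ ht q hq hq' hh
    rw [hT, mem_slots] at hs ht
    obtain ⟨x, hx, h⟩ := F.startsAt_of_lt hs.1 ht.1 hh hs.2 ht.2 hq hq'
    simp only at hx
    rw [hx]
    exact h.subset_add F ht.2
  set fs : (Σ _ : ℕ, ℕ) → Fin n := fun s => (lf L)^[s.2] (blk s.1).i with hfs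
  set fe : (Σ _ : ℕ, ℕ) → Fin n := fun s => (lf L)^[s.2] (blk s.1).j with hfe
  have hbl : ∀ s ∈ T, IsBlock L (blk s.1) ∧ s.2 ≤ (blk s.1).d := by
    intro s hs
    rw [hT, mem_slots] at hs
    exact ⟨F.bl hs.1, hs.2⟩
  have hfsm : ∀ s ∈ T, fs s ∈ column L (blk s.1) s.2 :=
    fun s hs => (hbl s hs).1.start_mem (hbl s hs).2
  have hfem : ∀ s ∈ T, fe s ∈ column L (blk s.1) s.2 := by
    intro s hs
    have h1 := (hbl s hs).1.iterate_j (hbl s hs).2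
    have h2 := (hbl s hs).1.height_pos
    rw [(hbl s hs).1.mem_column_iff (hbl s hs).2]
    simp only [hfe]
    omega
  -- `P` selects the highest column with a given left end. The selected columns are determined by
  -- their left ends, the remaining ones by their right ends, and each kind has at most `n` members.
  set P : (Σ _ : ℕ, ℕ) → Prop :=
    fun s => ∀ t ∈ T, fs t = fs s → (blk t.1).height ≤ (blk s.1).height with hP
  have h1 : (T.filter P).card ≤ n := by
    calc _ ≤ (Finset.univ : Finset (Fin n)).card := by
          refine Finset.card_le_card_of_injOn fs (fun _ _ => Finset.mem_univ _) ?_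
          intro s hs t ht e
          simp only [Finset.coe_filter, Set.mem_ofPred_eq] at hs ht
          refine key s hs.1 t ht.1 (fs s) (hfsm s hs.1) (e ▸ hfsm t ht.1)
            (le_antisymm (ht.2 s hs.1 e) (hs.2 t ht.1 e.symm))
      _ = n := by simp
  have h2 : (T.filter fun s => ¬ P s).card ≤ n := by
    calc _ ≤ (Finset.univ : Finset (Fin n)).card := by
          refine Finset.card_le_card_of_injOn fe (fun _ _ => Finset.mem_univ _) ?_
          -- Suppose that `s` is properly contained in `u` with the same left end and in `t` with
          -- the same right end. By laminarity `u` and `t` are comparable, but `u` exceeds `t` on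
          -- the right and `t` exceeds `u` on the left.
          have aux : ∀ s ∈ T, ¬ P s → ∀ t ∈ T, fe s = fe t →
              ¬ (blk s.1).height < (blk t.1).height := by
            intro s hs hsP t ht e hlt
            simp only [hP, not_forall, not_le] at hsP
            obtain ⟨u, hu, hus, hlu⟩ := hsP
            have su := key' s hs u hu _ (hfsm s hs) (hus ▸ hfsm u hu) hlu
            have st := key' s hs t ht _ (hfem s hs) (e ▸ hfem t ht) hlt
            have eu := (hbl u hu).1.iterate_j (hbl u hu).2
            have et := (hbl t ht).1.iterate_j (hbl t ht).2
            have es := (hbl s hs).1.iterate_j (hbl s hs).2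
            have hus' : (fs u : ℕ) = fs s := by rw [hus]
            have hfe' : (fe s : ℕ) = fe t := by rw [e]
            simp only [hfs, hfe] at hus' hfe'
            rcases lt_trichotomy (blk u.1).height (blk t.1).height with h | h | h
            · have ut := key' u hu t ht _ (hfsm u hu) (st (hus ▸ hfsm s hs)) h
              have := ((hbl t ht).1.mem_column_iff (hbl t ht).2).1 (ut (hfem u hu))
              simp only [hfe] at this
              omega
            · have := key u hu t ht _ (hfsm u hu) (st (hus ▸ hfsm s hs)) h
              subst this
              omega
            · have tu := key' t ht u hu _ (hfem t ht) (su (e ▸ hfem s hs)) h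
              have := ((hbl u hu).1.mem_column_iff (hbl u hu).2).1 (tu (hfsm t ht))
              simp only [hfs] at this
              omega
          intro s hs t ht e
          simp only [Finset.coe_filter, Set.mem_ofPred_eq] at hs ht
          have a1 := aux s hs.1 hs.2 t ht.1 e
          have a2 := aux t ht.1 ht.2 s hs.1 e.symm
          exact key s hs.1 t ht.1 (fe s) (hfem s hs.1) (e ▸ hfem t ht.1) (by omega)
      _ = n := by simp
  have := Finset.card_filter_add_card_filter_not (s := T) P
  omega

/-- The first columns of different blocks are disjoint. This bounds the time for marking all start
intervals. -/
theorem Family.sum_height_le (F : Family L m blk) :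
    ∑ k ∈ Finset.range m, (blk k).height ≤ n := by
  classical
  have : ∀ k ∈ Finset.range m, (blk k).height
      = (Finset.univ.filter fun p => p ∈ column L (blk k) 0).card := by
    intro k hk
    have := (F.bl (Finset.mem_range.1 hk)).1
    rw [Fin.le_def] at this
    rw [show (Finset.univ.filter fun p => p ∈ column L (blk k) 0)
      = Finset.Icc (blk k).i (blk k).j by ext; simp [column], Fin.card_Icc, Block.height]
  rw [Finset.sum_congr rfl this, ← Finset.card_biUnion]
  · exact (Finset.card_le_univ _).trans (by simp)
  · intro k hk k' hk' hne
    rw [Function.onFun, Finset.disjoint_left]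
    intro p hp hp'
    simp only [Finset.mem_filter, Finset.mem_univ, true_and] at hp hp'
    exact hne (F.start_unique (Finset.mem_range.1 hk) (Finset.mem_range.1 hk') hp hp')

/-! ## Collisions during the greedy block choice -/

/-- `i` is an inner colliding block of `o` at `p` when `rem` is the set of the remaining blocks. -/
def Link (L : Fin n → α) (m : ℕ) (blk : ℕ → Block n) (rem : Finset ℕ) (o i : ℕ) (p : Fin n) :
    Prop :=
  ∃ x y, Alive m (starter L m blk) rem o x ∧ starter L m blk o x = i + 1 ∧ y ≤ (blk i).d ∧
    p ∈ column L (blk o) (x + y)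

theorem Link.height_lt {rem : Finset ℕ} (F : Family L m blk) (h : Link L m blk rem o i p) :
    (blk o).height < (blk i).height := by
  obtain ⟨x, y, -, h, -⟩ := h
  exact (F.starter_eq_iff.1 h).height_lt F

/-- The abstract rule removes collisions position by position, the table slot by slot. They agree
because a position lies in only one column of each block: if `b` links `o` to `i` at one position,
the column numbers add up and `b` lies between them along the whole overlap. -/
theorem link_erase_iff {rem : Finset ℕ} {b : ℕ} (F : Family L m blk) (hb : b ∈ rem) (hbm : b < m) :
    Link L m blk (rem.erase b) o i p ↔ Link L m blk rem o i p ∧ o ≠ b ∧ i ≠ b ∧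
      ¬ (Link L m blk rem o b p ∧ Link L m blk rem b i p) := by
  have G := F.collisionTable
  constructor
  · rintro ⟨x, y, hA, hx, hy, hp⟩
    have hA' := (alive_erase_iff hb hbm).1 hA
    refine ⟨⟨x, y, hA'.1, hx, hy, hp⟩, hA'.2.1, ?_, ?_⟩
    · rintro rfl
      exact hA'.2.2.1 hx
    · rintro ⟨⟨x1, y1, -, hx1, hy1, hp1⟩, ⟨x2, y2, -, hx2, hy2, hp2⟩⟩
      have s := F.starter_eq_iff.1 hx
      have s1 := F.starter_eq_iff.1 hx1
      have s2 := F.starter_eq_iff.1 hx2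
      have f := s.fit F
      have f1 := s1.fit F
      have f2 := s2.fit F
      have e1 := (F.eq_of_height s.1 s.1 (a := x + y) (c := x1 + y1) (by omega) (by omega) rfl
        hp hp1).2
      have e2 := (F.eq_of_height s.2.2.1 s.2.2.1 hy hy2 rfl (s.subset_add F hy hp)
        (s2.subset_add F hy2 hp2)).2
      have e3 := (F.eq_of_height hbm hbm hy1 (c := x2 + y2) (by omega) rfl
        (s1.subset_add F hy1 hp1) hp2).2
      exact hA'.2.2.2 x1 x2 (by omega) hx1 (hx2.trans hx.symm)
  · rintro ⟨⟨x, y, hA, hx, hy, hp⟩, ho, hi, hn⟩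
    refine ⟨x, y, (alive_erase_iff hb hbm).2 ⟨hA, ho, ?_, ?_⟩, hx, hy, hp⟩
    · rw [hx]
      omega
    · rintro x' y' rfl hx' hy'
      -- The rule asks for collisions with `b` that are still present; `split` supplies this for a
      -- mere geometric position in between.
      obtain ⟨A1, A2⟩ := hA.split G hx' hy' hb
      have s := F.starter_eq_iff.1 hx'
      have s' := F.starter_eq_iff.1 (hy'.trans hx)
      have f' := s'.fit F
      rw [add_assoc] at hp
      exact hn ⟨⟨x', y' + y, A1, hx', by omega, hp⟩,
        ⟨y', y, A2, hy'.trans hx, hy, s.subset_add F (by omega) hp⟩⟩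

/-- The collisions of the state `g` are those which remain when only the blocks with numbers in
`rem` are left. -/
structure Tracks {σ : Type*} (L : Fin n → α) (m : ℕ) (blk : ℕ → Block n) (g : GState n σ)
    (rem : Finset ℕ) : Prop where
  remaining : ∀ B, B ∈ g.remaining ↔ ∃ k ∈ rem, B = blk k
  coll : ∀ X Y p, g.coll X Y p ↔ ∃ o < m, ∃ i < m, X = blk o ∧ Y = blk i ∧
    (Link L m blk rem o i p ∨ Link L m blk rem i o p)

section Tracks

variable {σ : Type*} {g : GState n σ} {rem : Finset ℕ} {b k : ℕ}

theorem Tracks.coll_iff (T : Tracks L m blk g rem) (F : Family L m blk) (ho : o < m) (hi : i < m) :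
    g.coll (blk o) (blk i) p ↔ Link L m blk rem o i p ∨ Link L m blk rem i o p := by
  rw [T.coll]
  constructor
  · rintro ⟨o', ho', i', hi', e1, e2, h⟩
    rwa [F.inj o ho o' ho' e1, F.inj i hi i' hi' e2]
  · intro h
    exact ⟨o, ho, i, hi, rfl, rfl, h⟩

theorem Tracks.innerAt_iff (T : Tracks L m blk g rem) (F : Family L m blk) (hb : b < m)
    (hk : k < m) : g.InnerAt (blk b) (blk k) p ↔ Link L m blk rem b k p := by
  rw [GState.InnerAt, T.coll_iff F hb hk]
  constructor
  · rintro ⟨h | h, hlt⟩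
    · exact h
    · have := h.height_lt F
      omega
  · intro h
    exact ⟨Or.inl h, h.height_lt F⟩

theorem Tracks.outerAt_iff (T : Tracks L m blk g rem) (F : Family L m blk) (hb : b < m)
    (hk : k < m) : g.OuterAt (blk b) (blk k) p ↔ Link L m blk rem k b p := by
  rw [GState.OuterAt, T.coll_iff F hb hk]
  constructor
  · rintro ⟨h | h, hlt⟩
    · have := h.height_lt F
      omega
    · exact h
  · intro h
    exact ⟨Or.inr h, h.height_lt F⟩

theorem exists_link_iff (F : Family L m blk) : (∃ p, Link L m blk rem o i p) ↔
    ∃ x, Alive m (starter L m blk) rem o x ∧ starter L m blk o x = i + 1 := by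
  constructor
  · rintro ⟨p, x, y, h1, h2, -⟩
    exact ⟨x, h1, h2⟩
  · rintro ⟨x, h1, h2⟩
    have h := F.starter_eq_iff.1 h2
    exact ⟨_, x, 0, h1, h2, by omega, (F.bl h.1).start_mem h.2.1⟩

theorem tracks_start (F : Family L m blk) (Sc : Scoring n σ) (RB : List (Block n))
    (hRB : ∀ B, B ∈ RB ↔ ∃ k ∈ Finset.range m, B = blk k) :
    Tracks L m blk (GState.start L Sc RB) (Finset.range m) where
  remaining := hRB
  coll := by
    -- As long as no block has been chosen, every nonempty slot is present.
    have hal : ∀ {o x i}, starter L m blk o x = i + 1 →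
        Alive m (starter L m blk) (Finset.range m) o x := by
      intro o x i h
      have s := F.starter_eq_iff.1 h
      exact ⟨by simpa using s.1, ⟨i, by simpa using s.2.2.1, h⟩,
        fun z hz hz' => absurd (Finset.mem_range.2 hz) hz'⟩
    have hsh : ∀ {o i p}, Link L m blk (Finset.range m) o i p →
        o ≠ i ∧ SharedPos L (blk o) (blk i) p := by
      rintro o i p ⟨x, y, h1, h2, hy, hp⟩
      have s := F.starter_eq_iff.1 h2
      have f := s.fit F
      exact ⟨s.2.2.2.1.symm, x + y, by omega, y, hy, hp, s.subset_add F hy hp⟩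
    intro X Y p
    simp only [GState.start, hRB, Finset.mem_range]
    constructor
    · rintro ⟨⟨o, ho, rfl⟩, ⟨i, hi, rfl⟩, hne, a, ha, c, hc, hp, hp'⟩
      refine ⟨o, ho, i, hi, rfl, rfl, ?_⟩
      rcases F.startsAt_of_shared ho hi ha hc hp hp' with h | ⟨x, rfl, h⟩ | ⟨x, rfl, h⟩
      · exact absurd (congrArg blk h.1) hne
      · have h := F.starter_eq_iff.2 h
        exact Or.inl ⟨x, c, hal h, h, hc, hp⟩
      · have h := F.starter_eq_iff.2 h
        exact Or.inr ⟨x, a, hal h, h, ha, hp'⟩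
    · rintro ⟨o, ho, i, hi, rfl, rfl, h | h⟩
      · obtain ⟨hne, hs⟩ := hsh h
        exact ⟨⟨o, ho, rfl⟩, ⟨i, hi, rfl⟩, fun e => hne (F.inj o ho i hi e), hs⟩
      · obtain ⟨hne, a, ha, c, hc, hp⟩ := hsh h
        exact ⟨⟨o, ho, rfl⟩, ⟨i, hi, rfl⟩, fun e => hne (F.inj o ho i hi e).symm,
          c, hc, a, ha, hp.2, hp.1⟩

theorem Tracks.choose (T : Tracks L m blk g rem) (F : Family L m blk) (Sc : Scoring n σ)
    (hrem : rem ⊆ Finset.range m) (hb : b ∈ rem) :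
    Tracks L m blk (g.choose Sc (blk b)) (rem.erase b) where
  remaining := by
    have hbm := Finset.mem_range.1 (hrem hb)
    intro B
    simp only [GState.choose, Set.mem_sdiff, T.remaining, Set.mem_singleton_iff, Finset.mem_erase]
    constructor
    · rintro ⟨⟨k, hk, rfl⟩, hne⟩
      exact ⟨k, ⟨fun e => hne (e ▸ rfl), hk⟩, rfl⟩
    · rintro ⟨k, ⟨hne, hk⟩, rfl⟩
      exact ⟨⟨k, hk, rfl⟩, fun e => hne (F.inj k (Finset.mem_range.1 (hrem hk)) b hbm e)⟩
  coll := by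
    have hbm := Finset.mem_range.1 (hrem hb)
    -- The abstract rule is symmetric in the two blocks; heights exclude the orientation in which
    -- the inner block would be the lower one.
    have hh : ∀ {o i p}, Link L m blk rem o i p → ¬ (Link L m blk rem i b p ∧
        Link L m blk rem b o p) := by
      rintro o i p h ⟨h1, h2⟩
      have := h.height_lt F
      have := h1.height_lt F
      have := h2.height_lt F
      omega
    have hne : ∀ {o}, o < m → (blk o ≠ blk b ↔ o ≠ b) := fun ho =>
      ⟨fun h e => h (e ▸ rfl), fun h e => h (F.inj _ ho b hbm e)⟩
    intro X Y p
    simp only [GState.choose]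
    constructor
    · rintro ⟨hc, hX, hY, h1, h2⟩
      obtain ⟨o, ho, i, hi, rfl, rfl, hl⟩ := (T.coll X Y p).1 hc
      refine ⟨o, ho, i, hi, rfl, rfl, ?_⟩
      rw [T.innerAt_iff F hbm ho, T.outerAt_iff F hbm hi] at h1
      rw [T.innerAt_iff F hbm hi, T.outerAt_iff F hbm ho] at h2
      rw [hne ho] at hX
      rw [hne hi] at hY
      rw [link_erase_iff F hb hbm, link_erase_iff F hb hbm]
      rcases hl with hl | hl
      · exact Or.inl ⟨hl, hX, hY, h2⟩
      · exact Or.inr ⟨hl, hY, hX, fun h => h1 ⟨h.2, h.1⟩⟩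
    · rintro ⟨o, ho, i, hi, rfl, rfl, hl⟩
      rw [T.innerAt_iff F hbm ho, T.outerAt_iff F hbm hi, T.innerAt_iff F hbm hi,
        T.outerAt_iff F hbm ho, hne ho, hne hi, T.coll_iff F ho hi]
      rw [link_erase_iff F hb hbm, link_erase_iff F hb hbm] at hl
      rcases hl with ⟨hl, h1, h2, h3⟩ | ⟨hl, h1, h2, h3⟩
      · exact ⟨Or.inl hl, h1, h2, fun h => hh hl ⟨h.2, h.1⟩, h3⟩
      · exact ⟨Or.inr hl, h2, h1, fun h => h3 ⟨h.2, h.1⟩, fun h => hh hl ⟨h.1, h.2⟩⟩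

end Tracks

end Family

/-! ## Total correctness with step counts -/

section WP

variable {n : ℕ} {σ : Type*} {E : Env n σ}

/-- Started in `s`, the program `p` halts after some number `c` of steps in a memory `s'` such
that `Q c s'`. -/
def WP (E : Env n σ) (p : Prog) (s : Mem σ) (Q : ℕ → Mem σ → Prop) : Prop :=
  ∃ c s', Exec E p s c s' ∧ Q c s'

theorem WP.mono {p : Prog} {s : Mem σ} {Q Q' : ℕ → Mem σ → Prop} (h : WP E p s Q)
    (hQ : ∀ c s', Q c s' → Q' c s') : WP E p s Q' := by
  obtain ⟨c, s', h1, h2⟩ := h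
  exact ⟨c, s', h1, hQ c s' h2⟩

theorem WP.cmd {c : Cmd} {s : Mem σ} {Q : ℕ → Mem σ → Prop} (h : Q c.cost (c.run E s)) :
    WP E (.cmd c) s Q :=
  ⟨_, _, .cmd c s, h⟩

theorem WP.seq {p q : Prog} {s : Mem σ} {Q : ℕ → Mem σ → Prop}
    (h : WP E p s fun c s' => WP E q s' fun c' s'' => Q (c + c') s'') : WP E (.seq p q) s Q := by
  obtain ⟨c, s', h1, c', s'', h2, h3⟩ := h
  exact ⟨_, _, .seq p q s s' s'' c c' h1 h2, h3⟩

theorem WP.ite {t : Test} {p q : Prog} {s : Mem σ} {Q : ℕ → Mem σ → Prop}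
    (h1 : t.holds E.w s → WP E p s fun c s' => Q (t.cost + c) s')
    (h2 : ¬ t.holds E.w s → WP E q s fun c s' => Q (t.cost + c) s') : WP E (.ite t p q) s Q := by
  by_cases ht : t.holds E.w s
  · obtain ⟨c, s', h, hQ⟩ := h1 ht
    exact ⟨_, _, .ite_true t p q s s' c ht h, hQ⟩
  · obtain ⟨c, s', h, hQ⟩ := h2 ht
    exact ⟨_, _, .ite_false t p q s s' c ht h, hQ⟩

/-- Loops: `I` is an invariant with a ghost variable, and `φ` a potential paying for the steps. -/
theorem WP.loop {γ : Type*} (I : γ → Mem σ → Prop) (φ : γ → ℕ) {t : Test} {p : Prog}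
    (hb : ∀ g s, I g s → t.holds E.w s →
      WP E p s fun c s' => ∃ g', I g' s' ∧ t.cost + c + φ g' ≤ φ g)
    {g : γ} {s : Mem σ} (hs : I g s) :
    WP E (.loop t p) s fun c s' => ∃ g', I g' s' ∧ ¬ t.holds E.w s' ∧ c + φ g' ≤ φ g + t.cost := by
  -- Every test takes a step, so each round strictly lowers the potential; this is why the loop
  -- halts.
  have htc : 0 < t.cost := by cases t <;> simp [Test.cost]
  induction hk : φ g using Nat.strong_induction_on generalizing g s with
  | _ k ih =>
    by_cases ht : t.holds E.w s
    · obtain ⟨c, s', h1, g', h2, h3⟩ := hb g s hs ht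
      obtain ⟨c', s'', h4, g'', h5, h6, h7⟩ := ih (φ g') (by omega) h2 rfl
      exact ⟨_, _, .loop_true t p s s' s'' c c' ht h1 h4, g'', h5, h6, by omega⟩
    · exact ⟨_, _, .loop_false t p s ht, g, hs, ht, by omega⟩

/-- A sequence of commands. -/
def block : List Cmd → Prog
  | [] => .cmd .skip
  | c :: cs => .seq (.cmd c) (block cs)

/-- The number of steps of `block cs`. -/
def blockCost (cs : List Cmd) : ℕ := (cs.map Cmd.cost).sum + 1

theorem WP.block {cs : List Cmd} {s : Mem σ} {Q : ℕ → Mem σ → Prop}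
    (h : Q (blockCost cs) (cs.foldl (fun s c => c.run E s) s)) : WP E (block cs) s Q := by
  induction cs generalizing s Q with
  | nil => exact WP.cmd h
  | cons c cs ih =>
    refine WP.seq (WP.cmd (ih ?_))
    simpa [blockCost, add_assoc] using h

end WP

/-! ## Tournament trees -/

/-- The better one of two entries `k + 1` for `k` with weights `f k`; the entry `0` is empty. -/
noncomputable def comb (f : ℕ → ℝ) (a b : ℕ) : ℕ :=
  open Classical in if a = 0 ∨ (b ≠ 0 ∧ f (a - 1) < f (b - 1)) then b else a

/-- Node `v` of the tournament tree `T` holds the better one of the entries of its children. -/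
def NodeOK (T : ℕ → ℕ) (f : ℕ → ℝ) (v : ℕ) : Prop := T v = comb f (T (2 * v)) (T (2 * v + 1))

/-- `T` is a tournament tree with root `1` whose leaves `m, …, 2 * m - 1` hold the elements of
`rem`. -/
structure TreeOK (m : ℕ) (T : ℕ → ℕ) (f : ℕ → ℝ) (rem : Finset ℕ) : Prop where
  leaf : ∀ k < m, T (m + k) = if k ∈ rem then k + 1 else 0
  node : ∀ v, 1 ≤ v → v < m → NodeOK T f v

theorem comb_cases (f : ℕ → ℝ) (a b : ℕ) : comb f a b = a ∨ comb f a b = b := by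
  unfold comb
  split_ifs <;> simp

section Tree

variable {m : ℕ} {T : ℕ → ℕ} {f : ℕ → ℝ} {rem : Finset ℕ} {k v : ℕ}

/-- Entries are only copied from a child to its parent, so an entry can be traced down to its own
leaf. The children of a node `v < m` are below `2 * m`, hence `m` need not be a power of two. -/
theorem TreeOK.descend (h : TreeOK m T f rem) (hv : 1 ≤ v) (hvm : v < 2 * m) (hT : T v = k + 1) :
    k < m ∧ k ∈ rem ∧ ∃ j, v = (m + k) / 2 ^ j := by
  induction hd : 2 * m - v using Nat.strong_induction_on generalizing v with
  | _ d ih =>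
    by_cases hm : m ≤ v
    · obtain ⟨k', rfl⟩ := Nat.exists_eq_add_of_le hm
      rw [h.leaf k' (by omega)] at hT
      split_ifs at hT with hk
      obtain rfl : k' = k := by omega
      exact ⟨by omega, hk, 0, by simp⟩
    · have hn := h.node v hv (by omega)
      rw [NodeOK, hT] at hn
      rcases comb_cases f (T (2 * v)) (T (2 * v + 1)) with e | e
      · obtain ⟨h0, h1, j, hj⟩ := ih (2 * m - 2 * v) (by omega) (v := 2 * v) (by omega) (by omega)
          (e ▸ hn.symm) rfl
        exact ⟨h0, h1, j + 1, by rw [pow_succ, ← Nat.div_div_eq_div_mul, ← hj]; omega⟩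
      · obtain ⟨h0, h1, j, hj⟩ := ih (2 * m - (2 * v + 1)) (by omega) (v := 2 * v + 1) (by omega)
          (by omega) (e ▸ hn.symm) rfl
        exact ⟨h0, h1, j + 1, by rw [pow_succ, ← Nat.div_div_eq_div_mul, ← hj]; omega⟩

theorem le_comb {a b : ℕ} (h : (a = k + 1) ∨ (b = k + 1)) :
    ∃ k', comb f a b = k' + 1 ∧ f k ≤ f k' := by
  unfold comb
  split_ifs with hc
  · rcases h with rfl | rfl
    · rcases hc with hc | ⟨hb, hc⟩
      · omega
      · exact ⟨b - 1, by omega, hc.le⟩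
    · exact ⟨k, rfl, le_rfl⟩
  · push Not at hc
    rcases h with rfl | rfl
    · exact ⟨k, rfl, le_rfl⟩
    · exact ⟨a - 1, by omega, hc.2 (by omega)⟩

theorem TreeOK.ascend (h : TreeOK m T f rem) (hk : k ∈ rem) (hkm : k < m) (j : ℕ)
    (hj : 1 ≤ (m + k) / 2 ^ j) : ∃ k', T ((m + k) / 2 ^ j) = k' + 1 ∧ f k ≤ f k' := by
  induction j with
  | zero => exact ⟨k, by simp [h.leaf k hkm, hk], le_rfl⟩
  | succ j ih =>
    rw [pow_succ, ← Nat.div_div_eq_div_mul] at hj ⊢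
    obtain ⟨k', h1, h2⟩ := ih (by omega)
    set u := (m + k) / 2 ^ j with hu
    have hum : u ≤ m + k := Nat.div_le_self _ _
    have hn := h.node (u / 2) hj (by omega)
    rw [NodeOK] at hn
    rw [hn]
    obtain ⟨k'', h3, h4⟩ := le_comb (f := f) (k := k') (a := T (2 * (u / 2)))
      (b := T (2 * (u / 2) + 1)) (by
        rcases Nat.mod_two_eq_zero_or_one u with e | e
        · left
          rw [show 2 * (u / 2) = u by omega, h1]
        · right
          rw [show 2 * (u / 2) + 1 = u by omega, h1])
    exact ⟨k'', h3, h2.trans h4⟩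

/-- By `ascend`, the entry at the root is at least as good as each remaining leaf; by `descend`, it
is itself a remaining block. -/
theorem TreeOK.root (h : TreeOK m T f rem) (hrem : rem ⊆ Finset.range m) (hne : rem.Nonempty) :
    ∃ b ∈ rem, T 1 = b + 1 ∧ ∀ k ∈ rem, f k ≤ f b := by
  have key : ∀ k ∈ rem, ∃ b, T 1 = b + 1 ∧ f k ≤ f b := by
    intro k hk
    have hkm := Finset.mem_range.1 (hrem hk)
    -- Halving a leaf number often enough ends at the root `1`, although the leaves may have
    -- different depths.
    have e : (m + k) / 2 ^ Nat.log 2 (m + k) = 1 := by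
      have h1 := Nat.pow_log_le_self 2 (x := m + k) (by omega)
      have h2 := Nat.lt_pow_succ_log_self (b := 2) (by norm_num) (m + k)
      have hp : 0 < 2 ^ Nat.log 2 (m + k) := by positivity
      rw [Nat.pow_succ] at h2
      apply Nat.div_eq_of_lt_le <;> omega
    have := h.ascend hk hkm (Nat.log 2 (m + k)) (by omega)
    rwa [e] at this
  obtain ⟨k, hk⟩ := hne
  have hm := Finset.mem_range.1 (hrem hk)
  obtain ⟨b, hb, -⟩ := key k hk
  refine ⟨b, (h.descend le_rfl (by omega) hb).2.1, hb, ?_⟩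
  intro k' hk'
  obtain ⟨b', hb', hle⟩ := key k' hk'
  obtain rfl : b = b' := by omega
  exact hle

/-- After a change at the leaf of `k`, only the nodes above this leaf may be wrong. -/
theorem TreeOK.change (h : TreeOK m T f rem) {T' : ℕ → ℕ} {f' : ℕ → ℝ}
    (hT : ∀ u, u ≠ m + k → T' u = T u) (hf : ∀ k', k' ≠ k → f' k' = f k') :
    ∀ u, 1 ≤ u → u < m → (∀ j, u ≠ (m + k) / 2 ^ (j + 1)) → NodeOK T' f' u := by
  intro u hu hum hj
  have hne : ∀ c, c = 2 * u ∨ c = 2 * u + 1 → c ≠ m + k ∧ T c ≠ k + 1 := by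
    intro c hc
    constructor
    · rintro rfl
      refine hj 0 ?_
      rw [zero_add, pow_one]
      omega
    · intro e
      obtain ⟨-, -, j, hj'⟩ := h.descend (by omega) (by omega) e
      refine hj j ?_
      rw [pow_succ, ← Nat.div_div_eq_div_mul, ← hj']
      omega
  obtain ⟨h1, h2⟩ := hne _ (Or.inl rfl)
  obtain ⟨h3, h4⟩ := hne _ (Or.inr rfl)
  have hn := h.node u hu hum
  rw [NodeOK] at hn ⊢
  rw [hT u (by omega), hT _ h1, hT _ h3, hn]
  unfold comb
  by_cases h0 : T (2 * u) = 0
  · simp [h0]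
  · by_cases h0' : T (2 * u + 1) = 0
    · simp [h0, h0']
    · rw [hf _ (by omega), hf _ (by omega)]

end Tree

/-! ## Repairing a path of the tournament tree -/

/-- Word register. -/
abbrev R (x : ℕ) : Expr := .reg x

/-- Recompute the nodes strictly above the node in register `20`. -/
def fixPath : Prog :=
  .loop (.lt (.const 1) (R 20)) (.seq
    (block [.set 20 (.half (R 20)), .set 21 (.load 5 (.add (R 20) (R 20))),
      .set 22 (.load 5 (.add (.add (R 20) (R 20)) (.const 1))),
      .rscore 10 (.sub (R 21) (.const 1)), .rscore 11 (.sub (R 22) (.const 1))])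
    (.ite (.and (.not (.eq (R 21) (.const 0)))
        (.not (.and (.not (.eq (R 22) (.const 0))) (.rlt 10 11))))
      (.cmd (.store 5 (R 20) (R 21))) (.cmd (.store 5 (R 20) (R 22)))))

section FixPath

variable {n : ℕ} {σ : Type*} {E : Env n σ}

/-- The score in the record cell of block number `k`. -/
noncomputable def cellScore (E : Env n σ) (s : Mem σ) (k : ℕ) : ℝ :=
  (s.record k).elim 0 E.scoring.score

/-- `s'` differs from `s` only in scratch registers and in array `5`. -/
structure FixFrame (s s' : Mem σ) : Prop where
  reg : ∀ x, x ≠ 20 → x ≠ 21 → x ≠ 22 → s'.reg x = s.reg x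
  arr : ∀ a, a ≠ 5 → s'.arr a = s.arr a
  real : ∀ x < 10, s'.real x = s.real x
  record : s'.record = s.record

/-- The loop climbs from the leaf and keeps all nodes correct except the strict ancestors of the
current node. An empty child makes the program read the score of block `0`, as `0 - 1 = 0`; this
value does not matter, because both the test and `comb` ask for emptiness first. -/
theorem fixPath_spec {m : ℕ} (hw : 4 * m + 4 ≤ 2 ^ E.w) {s : Mem σ} (h1 : 1 ≤ s.reg 20)
    (h2 : s.reg 20 < 2 * m)
    (hn : ∀ u, 1 ≤ u → u < m → (∀ j, u ≠ s.reg 20 / 2 ^ (j + 1)) →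
      NodeOK (s.arr 5) (cellScore E s) u) :
    WP E fixPath s fun c s' => c ≤ 100 * (Nat.log 2 (s.reg 20) + 1) ∧ FixFrame s s' ∧
      (∀ u, m ≤ u → s'.arr 5 u = s.arr 5 u) ∧
      ∀ u, 1 ≤ u → u < m → NodeOK (s'.arr 5) (cellScore E s) u := by
  refine WP.mono (WP.loop (γ := ℕ) (fun v s' => s'.reg 20 = v ∧ 1 ≤ v ∧ v < 2 * m ∧
    FixFrame s s' ∧ (∀ u, m ≤ u → s'.arr 5 u = s.arr 5 u) ∧
    ∀ u, 1 ≤ u → u < m → (∀ j, u ≠ v / 2 ^ (j + 1)) →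
      NodeOK (s'.arr 5) (cellScore E s) u) (fun v => 100 * Nat.log 2 v) ?_
    (g := s.reg 20) ⟨rfl, h1, h2, ⟨fun _ _ _ _ => rfl, fun _ _ => rfl, fun _ _ => rfl, rfl⟩,
      fun _ _ => rfl, hn⟩) ?_
  · rintro v s1 ⟨rfl, hv1, hv2, hF, hl, hno⟩ ht
    simp only [Test.holds, Expr.eval] at ht
    rw [Nat.mod_eq_of_lt (by omega)] at ht
    have hlog : Nat.log 2 (s1.reg 20) = Nat.log 2 (s1.reg 20 / 2) + 1 :=
      Nat.log_of_one_lt_of_le (by norm_num) (by omega)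
    set v := s1.reg 20 with hv
    set l := s1.arr 5 (2 * (v / 2)) with hl'
    set r := s1.arr 5 (2 * (v / 2) + 1) with hr'
    have m1 : (v / 2 + v / 2) % 2 ^ E.w = 2 * (v / 2) := by
      rw [Nat.mod_eq_of_lt (by omega)]; omega
    have m2 : (2 * (v / 2) + 1) % 2 ^ E.w = 2 * (v / 2) + 1 := Nat.mod_eq_of_lt (by omega)
    have m3 : 1 % 2 ^ E.w = 1 := Nat.mod_eq_of_lt (by omega)
    -- The part of the invariant common to both branches. A write to `v / 2` affects only this node
    -- and its parent, and the parent is still exempt.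
    have hfin : ∀ s2 : Mem σ, s2.reg 20 = v / 2 → FixFrame s s2 →
        s2.arr 5 = Function.update (s1.arr 5) (v / 2) (comb (cellScore E s) l r) →
        ∀ c, c ≤ 99 → ∃ g', (s2.reg 20 = g' ∧ 1 ≤ g' ∧ g' < 2 * m ∧
          FixFrame s s2 ∧ (∀ u, m ≤ u → s2.arr 5 u = s.arr 5 u) ∧
          ∀ u, 1 ≤ u → u < m → (∀ j, u ≠ g' / 2 ^ (j + 1)) →
            NodeOK (s2.arr 5) (cellScore E s) u) ∧
          c + 100 * Nat.log 2 g' ≤ 100 * Nat.log 2 v := by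
      intro s2 e1 e2 e3 c hc
      refine ⟨v / 2, ⟨e1, by omega, by omega, e2, ?_, ?_⟩, by omega⟩
      · intro u hu
        rw [e3, Function.update_of_ne (by omega), hl u hu]
      · intro u hu hum hj
        rw [NodeOK, e3]
        rw [Function.update_of_ne (a := 2 * u), Function.update_of_ne (a := 2 * u + 1)]
        · by_cases huv : u = v / 2
          · subst huv
            rw [Function.update_self]
          · rw [Function.update_of_ne huv]
            refine hno u hu hum ?_
            intro j
            cases j with
            | zero => simpa using huv
            | succ j =>
              have := hj j
              rwa [Nat.div_div_eq_div_mul, ← pow_succ'] at this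
        · intro e
          exact hj 0 (by rw [zero_add, pow_one]; omega)
        · intro e
          exact hj 0 (by rw [zero_add, pow_one]; omega)
    refine WP.seq (WP.block ?_)
    have hsc : ∀ k, (s1.record k).elim 0 E.scoring.score = cellScore E s k := by
      intro k
      rw [cellScore, hF.record]
    simp only [List.foldl, Cmd.run, Expr.eval, Mem.setReg, Mem.setReal, Function.update_self,
      Function.update_of_ne (show (20 : ℕ) ≠ 21 by decide),
      Function.update_of_ne (show (21 : ℕ) ≠ 22 by decide), ← hv, m1, m2, m3, ← hl', ← hr', hsc]
    refine WP.ite ?_ ?_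
    · intro ht'
      refine WP.cmd ?_
      rw [← add_assoc, ← add_assoc]
      refine hfin _ ?_ ?_ ?_ _ (by decide)
      · simp [Cmd.run, Mem.setArr]
      · refine ⟨?_, ?_, ?_, ?_⟩
        · intro x hx1 hx2 hx3
          simp [Cmd.run, Mem.setArr, hx1, hx2, hx3, hF.reg]
        · intro a ha
          simp [Cmd.run, Mem.setArr, ha, hF.arr]
        · intro x hx
          simp [Cmd.run, Mem.setArr, hx.ne,
            show x ≠ 11 by omega, hF.real x hx]
        · simp [Cmd.run, Mem.setArr, hF.record]
      · simp [Test.holds, Expr.eval] at ht'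
        have : comb (cellScore E s) l r = l := by
          unfold comb
          rw [if_neg]
          rintro (h | ⟨h, h'⟩)
          · exact ht'.1 h
          · exact absurd h' (not_lt.2 (ht'.2 h))
        simp [Cmd.run, Mem.setArr, Expr.eval, this]
    · intro ht'
      refine WP.cmd ?_
      rw [← add_assoc, ← add_assoc]
      refine hfin _ ?_ ?_ ?_ _ (by decide)
      · simp [Cmd.run, Mem.setArr]
      · refine ⟨?_, ?_, ?_, ?_⟩
        · intro x hx1 hx2 hx3
          simp [Cmd.run, Mem.setArr, hx1, hx2, hx3, hF.reg]
        · intro a ha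
          simp [Cmd.run, Mem.setArr, ha, hF.arr]
        · intro x hx
          simp [Cmd.run, Mem.setArr, hx.ne,
            show x ≠ 11 by omega, hF.real x hx]
        · simp [Cmd.run, Mem.setArr, hF.record]
      · simp [Test.holds, Expr.eval] at ht'
        have : comb (cellScore E s) l r = r := by
          unfold comb
          rw [if_pos]
          by_cases h : l = 0
          · exact Or.inl h
          · exact Or.inr (ht' h)
        simp [Cmd.run, Mem.setArr, Expr.eval, this]
  · rintro c s' ⟨v, ⟨rfl, hv1, hv2, hF, hl, hno⟩, ht, hc⟩
    simp only [Test.holds, Expr.eval] at ht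
    rw [Nat.mod_eq_of_lt (by omega)] at ht
    have hv : s'.reg 20 = 1 := by omega
    have hcost : (Test.lt (.const 1) (R 20)).cost ≤ 100 := by decide
    refine ⟨by omega, hF, hl, ?_⟩
    intro u hu hum
    refine hno u hu hum ?_
    intro j
    rw [hv, Nat.div_eq_of_lt (Nat.one_lt_two_pow (by omega))]
    omega

/-- Recompute the nodes above the leaf of the block in register `23`. -/
def fixLeaf : Prog := .seq (.cmd (.set 20 (.add (R 1) (R 23)))) fixPath

/-- Here `T`, `f` and `rem` describe the last correct tree, and `s` is the memory after a change of
the leaf or of the record of `k`. This form serves removal of a block, change of a score, and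
insertion of a block alike. -/
theorem fixLeaf_spec {m k : ℕ} (hw : 4 * m + 4 ≤ 2 ^ E.w) {s : Mem σ} (h1 : s.reg 1 = m)
    (h23 : s.reg 23 = k) (hk : k < m) {T : ℕ → ℕ} {f : ℕ → ℝ} {rem rem' : Finset ℕ}
    (hT : TreeOK m T f rem) (hs : ∀ u, u ≠ m + k → s.arr 5 u = T u)
    (hf : ∀ k', k' ≠ k → cellScore E s k' = f k')
    (hk5 : s.arr 5 (m + k) = if k ∈ rem' then k + 1 else 0)
    (hr : ∀ k', k' ≠ k → (k' ∈ rem' ↔ k' ∈ rem)) :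
    WP E fixLeaf s fun c s' => c ≤ 100 * (Nat.log 2 m + 3) ∧ FixFrame s s' ∧
      TreeOK m (s'.arr 5) (cellScore E s') rem' := by
  refine WP.seq (WP.cmd ?_)
  have hset : (Cmd.set 20 (.add (R 1) (R 23))).run E s = s.setReg 20 (m + k) := by
    simp only [Cmd.run, Expr.eval, h1, h23]
    rw [Nat.mod_eq_of_lt (by omega)]
  rw [hset]
  have h20 : (s.setReg 20 (m + k)).reg 20 = m + k := by simp [Mem.setReg]
  have hsc : cellScore E (s.setReg 20 (m + k)) = cellScore E s := rfl
  have h5 : (s.setReg 20 (m + k)).arr = s.arr := rfl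
  have hlog : Nat.log 2 (m + k) ≤ Nat.log 2 m + 1 := by
    rw [← Nat.log_mul_base (by norm_num) (by omega)]
    exact Nat.log_mono_right (by omega)
  refine WP.mono (fixPath_spec (m := m) hw (by omega) (by omega) ?_) ?_
  · rw [h20, hsc, h5]
    exact hT.change hs hf
  · rintro c s' ⟨hc, hF, hl, hno⟩
    rw [h20] at hc
    have hF' : FixFrame s s' := by
      refine ⟨?_, hF.arr, hF.real, hF.record⟩
      intro x hx1 hx2 hx3
      rw [hF.reg x hx1 hx2 hx3]
      simp [Mem.setReg, hx1]
    refine ⟨?_, hF', ?_, ?_⟩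
    · have : (Cmd.set 20 (.add (R 1) (R 23))).cost = 4 := by decide
      omega
    · intro k' hk'
      rw [hl _ (by omega), h5]
      by_cases e : k' = k
      · rw [e, hk5]
      · rw [hs _ (by omega), hT.leaf k' hk']
        simp only [hr k' e]
    · have : cellScore E s' = cellScore E s := by
        funext k
        rw [cellScore, cellScore, hF'.record]
      rw [this]
      exact hno

end FixPath

/-! ## Processing the collisions of a chosen block -/

/-- Unless this was done before in this pass, run the update `c` of the record of the block in
register `23`, and repair the tournament tree. -/
def touch (c : Cmd) : Prog :=
  .ite (.eq (.load 12 (R 23)) (R 3)) (.cmd .skip)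
    (.seq (block [.store 12 (R 23) (R 3), c]) fixLeaf)

section Step

variable {n : ℕ} {σ : Type*} {E : Env n σ}

/-- During the pass number `t`, which started in memory `s₁`, the slots in `K` have been cleared,
and the records of the blocks in `M` have been replaced by `new`. -/
structure InStep (E : Env n σ) (m : ℕ) (rem : Finset ℕ) (b t : ℕ) (s₁ : Mem σ)
    (new : ℕ → Option σ) (K M : Set ℕ) (s : Mem σ) : Prop where
  reg : ∀ x < 12, s.reg x = s₁.reg x
  arr : ∀ a, a ≠ 5 → a ≠ 8 → a ≠ 12 → a ≠ 13 → s.arr a = s₁.arr a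
  real : ∀ x < 10, s.real x = s₁.real x
  killed : ∀ v ∈ K, s.arr 8 v = 0
  kept : ∀ v, v ∉ K → s.arr 8 v = s₁.arr 8 v
  marked : ∀ k ∈ M, s.arr 12 k = t
  unmarked : ∀ k, k ∉ M → s.arr 12 k = s₁.arr 12 k
  updated : ∀ k ∈ M, s.record k = new k
  unchanged : ∀ k, k ∉ M → s.record k = s₁.record k
  tree : TreeOK m (s.arr 5) (cellScore E s) rem
  not_mem : b ∉ M

/-- What the memory `s₁` has to satisfy. -/
structure StepBase (E : Env n σ) (m b t : ℕ) (s₁ : Mem σ) : Prop where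
  word : 4 * m + 4 ≤ 2 ^ E.w
  r1 : s₁.reg 1 = m
  r3 : s₁.reg 3 = t
  r10 : s₁.reg 10 = b
  mark : ∀ k, s₁.arr 12 k < t

variable {m b t : ℕ} {rem : Finset ℕ} {s₁ s : Mem σ} {new : ℕ → Option σ} {K M : Set ℕ}

/-- The command `c` replaces the record of block `k` by `new k`. -/
def Replaces (E : Env n σ) (b : ℕ) (s₁ : Mem σ) (new : ℕ → Option σ) (c : Cmd) (k : ℕ) : Prop :=
  ∀ s : Mem σ, s.reg 10 = b → s.reg 23 = k → s.record b = s₁.record b →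
    s.record k = s₁.record k → c.run E s = s.setRecord k (new k)

/-- A block may collide with `b` in several columns, but its record is to be updated once per pass.
The pass number is the mark, so marks need no resetting: older ones are smaller than `t`. Since `b`
itself is never marked, each update sees the records from the beginning of the pass. -/
theorem touch_spec (hB : StepBase E m b t s₁) (h : InStep E m rem b t s₁ new K M s) {k : ℕ}
    (h23 : s.reg 23 = k) (hk : k < m) (hkb : k ≠ b) {c : Cmd} (hc : c.cost ≤ 10)
    (hrun : Replaces E b s₁ new c k) :
    WP E (touch c) s fun c s' => c ≤ 100 * (Nat.log 2 m + 4) ∧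
      InStep E m rem b t s₁ new K (insert k M) s' ∧
      (∀ x, x ≠ 20 → x ≠ 21 → x ≠ 22 → s'.reg x = s.reg x) ∧ s'.arr 13 = s.arr 13 := by
  have h1 := (h.reg 1 (by norm_num)).trans hB.r1
  have h3 := (h.reg 3 (by norm_num)).trans hB.r3
  have h10 := (h.reg 10 (by norm_num)).trans hB.r10
  refine WP.ite ?_ ?_
  · intro ht
    refine WP.cmd ?_
    simp only [Test.holds, Expr.eval, h23, h3] at ht
    have hkM : k ∈ M := by
      by_contra hkM
      rw [h.unmarked k hkM] at ht
      exact absurd ht (hB.mark k).ne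
    rw [Set.insert_eq_of_mem hkM]
    refine ⟨?_, h, fun _ _ _ _ => rfl, rfl⟩
    simp only [Test.cost, Expr.cost, Cmd.cost]
    omega
  · intro ht
    simp only [Test.holds, Expr.eval, h23, h3] at ht
    have hkM : k ∉ M := fun hkM => ht (h.marked k hkM)
    refine WP.seq (WP.block ?_)
    simp only [List.foldl]
    have e1 : (Cmd.store 12 (R 23) (R 3)).run E s = s.setArr 12 k t := by
      simp only [Cmd.run, Expr.eval, h23, h3]
    rw [e1, hrun (s.setArr 12 k t) h10 h23 (h.unchanged b h.not_mem) (h.unchanged k hkM)]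
    set s2 := (s.setArr 12 k t).setRecord k (new k) with hs2
    have a5 : s2.arr 5 = s.arr 5 := by simp [hs2, Mem.setArr, Mem.setRecord]
    have a12 : s2.arr 12 = Function.update (s.arr 12) k t := by
      simp [hs2, Mem.setArr, Mem.setRecord]
    have aa : ∀ a, a ≠ 12 → s2.arr a = s.arr a := by
      intro a ha
      simp [hs2, Mem.setArr, Mem.setRecord, ha]
    have arec : s2.record = Function.update s.record k (new k) := rfl
    refine WP.mono (fixLeaf_spec (s := s2) (m := m) (k := k) (rem := rem) (rem' := rem) hB.word h1 h23 hk
      h.tree ?_ ?_ ?_ ?_) ?_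
    · intro u _
      rw [a5]
    · intro k' hk'
      rw [cellScore, cellScore, arec, Function.update_of_ne hk']
    · rw [a5, h.tree.leaf k hk]
    · simp
    · rintro c' s' ⟨hc', hF, hT⟩
      refine ⟨?_, ?_, hF.reg, (hF.arr 13 (by norm_num)).trans (aa 13 (by norm_num))⟩
      · have hb : blockCost [Cmd.store 12 (R 23) (R 3), c] = 3 + (c.cost + 0) + 1 := rfl
        have ht : (Test.eq (.load 12 (R 23)) (R 3)).cost = 4 := rfl
        omega
      · refine ⟨?_, ?_, ?_, ?_, ?_, ?_, ?_, ?_, ?_, hT, ?_⟩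
        · intro x hx
          rw [hF.reg x (by omega) (by omega) (by omega)]
          exact h.reg x hx
        · intro a h5 h8 h12 h13
          rw [hF.arr a h5, aa a h12, h.arr a h5 h8 h12 h13]
        · intro x hx
          rw [hF.real x hx]
          exact h.real x hx
        · intro v hv
          rw [hF.arr 8 (by norm_num), aa 8 (by norm_num), h.killed v hv]
        · intro v hv
          rw [hF.arr 8 (by norm_num), aa 8 (by norm_num), h.kept v hv]
        · intro k' hk'
          rw [hF.arr 12 (by norm_num), a12]
          by_cases e : k' = k
          · rw [e, Function.update_self]
          · rw [Function.update_of_ne e, h.marked k' (hk'.resolve_left e)]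
        · intro k' hk'
          rw [Set.mem_insert_iff, not_or] at hk'
          rw [hF.arr 12 (by norm_num), a12, Function.update_of_ne hk'.1, h.unmarked k' hk'.2]
        · intro k' hk'
          rw [hF.record, arec]
          by_cases e : k' = k
          · rw [e, Function.update_self]
          · rw [Function.update_of_ne e, h.updated k' (hk'.resolve_left e)]
        · intro k' hk'
          rw [Set.mem_insert_iff, not_or] at hk'
          rw [hF.record, arec, Function.update_of_ne hk'.1, h.unchanged k' hk'.2]
        · rw [Set.mem_insert_iff, not_or]
          exact ⟨hkb.symm, h.not_mem⟩

/-- Changes of registers from `12` on, of array `13` and of slots do not matter. -/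
theorem InStep.kill (h : InStep E m rem b t s₁ new K M s) {s' : Mem σ} {K' : Set ℕ}
    (hreg : ∀ x < 12, s'.reg x = s.reg x) (harr : ∀ a, a ≠ 8 → a ≠ 13 → s'.arr a = s.arr a)
    (hreal : s'.real = s.real) (hrec : s'.record = s.record)
    (h1 : ∀ v ∈ K', s'.arr 8 v = 0) (h2 : ∀ v, v ∉ K' → s'.arr 8 v = s₁.arr 8 v) :
    InStep E m rem b t s₁ new K' M s' := by
  have hsc : cellScore E s' = cellScore E s := by
    funext k
    rw [cellScore, cellScore, hrec]
  refine ⟨fun x hx => (hreg x hx).trans (h.reg x hx), ?_, ?_, h1, h2, ?_, ?_, ?_, ?_, ?_,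
    h.not_mem⟩
  · intro a h5 h8 h12 h13
    rw [harr a h8 h13, h.arr a h5 h8 h12 h13]
  · intro x hx
    rw [hreal, h.real x hx]
  · rw [harr 12 (by norm_num) (by norm_num)]
    exact h.marked
  · rw [harr 12 (by norm_num) (by norm_num)]
    exact h.unmarked
  · rw [hrec]
    exact h.updated
  · rw [hrec]
    exact h.unchanged
  · rw [harr 5 (by norm_num) (by norm_num), hsc]
    exact h.tree

/-- The linked list starting with the entry `e` (`0` for the end, `a + 1` for the item `a`). -/
def Chain (nxt : ℕ → ℕ) : ℕ → List ℕ → Prop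
  | e, [] => e = 0
  | e, a :: l => e = a + 1 ∧ Chain nxt (nxt a) l

/-- Go through the outer colliding blocks of the block in register `10`; their slots are collected
in array `13`. -/
def outerLoop : Prog :=
  .loop (.lt (.const 0) (R 12)) (.seq (block [.set 14 (.sub (R 12) (.const 1))])
    (.seq (.ite (.lt (.const 0) (.load 8 (R 14)))
      (.seq (block [.store 13 (R 13) (R 14), .set 13 (.add (R 13) (.const 1)),
          .store 8 (R 14) (.const 0), .set 23 (.load 9 (R 14))])
        (touch (.updOuter (R 10) (R 23))))
      (.cmd .skip)) (.cmd (.set 12 (.load 11 (R 14))))))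

/-- The slots of `l` which are not cleared. -/
def liveSlots (s₁ : Mem σ) (l : List ℕ) : List ℕ := l.filter fun v => s₁.arr 8 v ≠ 0

/-- Array `13` holds the list `outs`, register `13` its length. -/
def Collected (s : Mem σ) (outs : List ℕ) : Prop :=
  s.reg 13 = outs.length ∧ ∀ i < outs.length, outs[i]? = some (s.arr 13 i)

/-- Slots without a present collision stay in the linked list and are skipped, so the full length of
the list is paid; this is affordable since all lists together have at most one entry per slot. The
live slots are copied because they are needed, after being cleared, to find the collisions between
outer and inner blocks. -/
theorem outerLoop_spec (hB : StepBase E m b t s₁) {l : List ℕ} (hl : l.Nodup)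
    (hlen : l.length < 2 ^ E.w) (hchain : Chain (s₁.arr 11) (s₁.reg 12) l)
    (hown : ∀ v ∈ l, s₁.arr 8 v ≠ 0 → s₁.arr 9 v < m ∧ s₁.arr 9 v ≠ b ∧
      Replaces E b s₁ new (.updOuter (R 10) (R 23)) (s₁.arr 9 v))
    (h0 : InStep E m rem b t s₁ new ∅ ∅ s₁) (h13 : s₁.reg 13 = 0) :
    WP E outerLoop s₁ fun c s' => c ≤ 100 * (Nat.log 2 m + 6) * l.length + 10 ∧
      InStep E m rem b t s₁ new {v | v ∈ liveSlots s₁ l} {k | ∃ v ∈ liveSlots s₁ l, k = s₁.arr 9 v}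
        s' ∧ Collected s' (liveSlots s₁ l) := by
  refine WP.mono (WP.loop (γ := List ℕ × List ℕ) (fun g s => l = g.1 ++ g.2 ∧
    Chain (s₁.arr 11) (s.reg 12) g.2 ∧
    InStep E m rem b t s₁ new {v | v ∈ liveSlots s₁ g.1}
      {k | ∃ v ∈ liveSlots s₁ g.1, k = s₁.arr 9 v} s ∧ Collected s (liveSlots s₁ g.1))
    (fun g => 100 * (Nat.log 2 m + 6) * g.2.length) ?_ (g := ([], l)) ?_) ?_
  · rintro ⟨pre, suf⟩ s ⟨hsplit, hch, hI, h13, hcol⟩ ht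
    simp only at hsplit hch hI h13 hcol
    simp only [Test.holds, Expr.eval, Nat.zero_mod] at ht
    obtain _ | ⟨a, suf⟩ := suf
    · exact absurd hch ht.ne'
    obtain ⟨he, hch⟩ := hch
    have hw1 : 1 % 2 ^ E.w = 1 := Nat.mod_eq_of_lt (by have := hB.word; omega)
    have hal : a ∈ l := by simp [hsplit]
    have hapre : a ∉ pre := by
      intro h
      rw [hsplit, List.nodup_append] at hl
      exact hl.2.2 a h a (by simp) rfl
    -- The list has no repetitions, so the slot has not been cleared earlier in this loop.
    have ha8 : s.arr 8 a = s₁.arr 8 a := hI.kept a fun h => hapre (List.mem_filter.1 h).1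
    refine WP.seq (WP.block ?_)
    have e14 : List.foldl (fun s c => Cmd.run E s c) s [Cmd.set 14 ((R 12).sub (Expr.const 1))]
        = s.setReg 14 a := by
      simp [Cmd.run, Expr.eval, he, hw1]
    rw [e14]
    have hfin : ∀ s2 : Mem σ, s2.reg 14 = a →
        InStep E m rem b t s₁ new {v | v ∈ liveSlots s₁ (pre ++ [a])}
          {k | ∃ v ∈ liveSlots s₁ (pre ++ [a]), k = s₁.arr 9 v} s2 →
        Collected s2 (liveSlots s₁ (pre ++ [a])) → ∀ c, c + 3 ≤ 100 * (Nat.log 2 m + 6) →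
        WP E (.cmd (.set 12 (.load 11 (R 14)))) s2 fun c' s3 =>
          ∃ g' : List ℕ × List ℕ, (l = g'.1 ++ g'.2 ∧ Chain (s₁.arr 11) (s3.reg 12) g'.2 ∧
            InStep E m rem b t s₁ new {v | v ∈ liveSlots s₁ g'.1}
              {k | ∃ v ∈ liveSlots s₁ g'.1, k = s₁.arr 9 v} s3 ∧
            Collected s3 (liveSlots s₁ g'.1)) ∧
          c + c' + 100 * (Nat.log 2 m + 6) * g'.2.length ≤
            100 * (Nat.log 2 m + 6) * (suf.length + 1) := by
      intro s2 h14 hI2 hc2 c hc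
      refine WP.cmd ⟨(pre ++ [a], suf), ⟨by simp [hsplit], ?_, ?_, ?_⟩, ?_⟩
      · have e11 := hI2.arr 11 (by norm_num) (by norm_num) (by norm_num) (by norm_num)
        simpa [Cmd.run, Expr.eval, Mem.setReg, h14, e11] using hch
      · refine hI2.kill ?_ (fun _ _ _ => rfl) rfl rfl hI2.killed hI2.kept
        intro x hx
        simp [Cmd.run, Mem.setReg, show x ≠ 12 by omega]
      · exact hc2
      · have : (Cmd.set 12 (.load 11 (R 14))).cost = 3 := by decide
        rw [this]
        simp only [mul_add]
        omega
    refine WP.seq (WP.ite ?_ ?_)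
    · intro ht'
      simp only [Test.holds, Expr.eval, Nat.zero_mod, Mem.setReg, Function.update_self, ha8] at ht'
      have hlive : liveSlots s₁ (pre ++ [a]) = liveSlots s₁ pre ++ [a] := by
        simp [liveSlots, ht'.ne']
      obtain ⟨o1, o2, o3⟩ := hown a hal ht'.ne'
      have hple : (liveSlots s₁ pre).length ≤ pre.length := List.length_filter_le _ _
      have hpl : pre.length + 1 ≤ l.length := by simp [hsplit]
      have e9 := hI.arr 9 (by norm_num) (by norm_num) (by norm_num) (by norm_num)
      have hmod : (s.reg 13 + 1) % 2 ^ E.w = s.reg 13 + 1 := Nat.mod_eq_of_lt (by omega)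
      refine WP.seq (WP.block ?_)
      generalize hs2 : List.foldl (fun s c => Cmd.run E s c) (s.setReg 14 a) _ = s2
      have r2 : s2.reg = Function.update (Function.update (Function.update s.reg 14 a) 13
          (s.reg 13 + 1)) 23 (s₁.arr 9 a) := by
        subst hs2
        simp [Cmd.run, Expr.eval, Mem.setReg, Mem.setArr, hw1, hmod, e9]
      have a2 : s2.arr = Function.update (Function.update s.arr 13
          (Function.update (s.arr 13) (s.reg 13) a)) 8 (Function.update (s.arr 8) a 0) := by
        subst hs2
        simp [Cmd.run, Expr.eval, Mem.setReg, Mem.setArr]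
      have hI2 : InStep E m rem b t s₁ new {v | v ∈ liveSlots s₁ (pre ++ [a])}
          {k | ∃ v ∈ liveSlots s₁ pre, k = s₁.arr 9 v} s2 := by
        refine hI.kill ?_ ?_ (by subst hs2; rfl) (by subst hs2; rfl) ?_ ?_
        · intro x hx
          rw [r2]
          simp [show x ≠ 23 by omega, show x ≠ 13 by omega,
            show x ≠ 14 by omega]
        · intro x hx hx'
          rw [a2]
          simp [hx, hx']
        · intro v hv
          rw [hlive] at hv
          rw [a2, Function.update_self]
          by_cases e : v = a
          · rw [e, Function.update_self]
          · rw [Function.update_of_ne e]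
            refine hI.killed v ?_
            simpa [e] using hv
        · intro v hv
          simp only [hlive, Set.mem_ofPred_eq, List.mem_append, List.mem_singleton, not_or] at hv
          rw [a2, Function.update_self, Function.update_of_ne hv.2]
          exact hI.kept v hv.1
      refine WP.mono (touch_spec hB hI2 (by rw [r2]; simp) o1 o2 (by decide) o3) ?_
      rintro c1 s3 ⟨hc1, hI3, hr3, h3⟩
      refine WP.mono (hfin s3 ?_ ?_ ?_ (c1 + 50) (by omega)) ?_
      · rw [hr3 14 (by norm_num) (by norm_num) (by norm_num), r2]
        simp
      · convert hI3 using 1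
        ext k
        simp [hlive, or_and_right, exists_or, or_comm]
      · rw [Collected, hlive, hr3 13 (by norm_num) (by norm_num) (by norm_num), h3, r2, a2]
        refine ⟨by simp [h13], ?_⟩
        intro i hi
        rw [List.length_append, List.length_singleton] at hi
        rw [Function.update_of_ne (by norm_num), Function.update_self]
        by_cases e : i = (liveSlots s₁ pre).length
        · simp [e, h13]
        · rw [Function.update_of_ne (by omega), List.getElem?_append_left (by omega)]
          exact hcol i (by omega)
      · rintro c2 s4 ⟨g', hg', hcc⟩
        refine ⟨g', hg', ?_⟩
        simp only [blockCost, List.map, List.sum_cons, List.sum_nil, Test.cost, Expr.cost,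
          Cmd.cost, List.length_cons] at *
        omega
    · intro ht'
      simp only [Test.holds, Expr.eval, Nat.zero_mod, Mem.setReg, Function.update_self, ha8,
        not_lt, Nat.le_zero] at ht'
      have hlive : liveSlots s₁ (pre ++ [a]) = liveSlots s₁ pre := by
        simp [liveSlots, ht']
      refine WP.cmd ?_
      refine WP.mono (hfin (s.setReg 14 a) (by simp [Mem.setReg]) ?_ ?_ 50 (by omega)) ?_
      · rw [hlive]
        refine hI.kill ?_ (fun _ _ _ => rfl) rfl rfl hI.killed hI.kept
        intro x hx
        simp [Mem.setReg, show x ≠ 14 by omega]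
      · rw [hlive]
        exact ⟨by simpa [Mem.setReg] using h13, hcol⟩
      · rintro c2 s4 ⟨g', hg', hcc⟩
        refine ⟨g', hg', ?_⟩
        simp only [blockCost, List.map, List.sum_cons, List.sum_nil, Test.cost, Expr.cost,
          Cmd.cost, List.length_cons] at *
        omega
  · refine ⟨rfl, hchain, ?_, h13, by simp [liveSlots]⟩
    simpa [liveSlots] using h0
  · rintro c s' ⟨⟨pre, suf⟩, ⟨hsplit, hch, hI, hcol⟩, ht, hc⟩
    simp only [Test.holds, Expr.eval, Nat.zero_mod, not_lt, Nat.le_zero] at ht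
    obtain _ | ⟨a, suf⟩ := suf
    · simp only [List.append_nil] at hsplit
      subst hsplit
      refine ⟨?_, hI, hcol⟩
      have : (Test.lt (.const 0) (R 12)).cost = 3 := by decide
      simp only [List.length_nil] at hc
      omega
    · have := hch.1
      omega

end Step

/-! ### Inner collisions of the chosen block and the slots removed with them -/

section Inner

variable {n : ℕ} {σ : Type*} {E : Env n σ}
variable {m b t : ℕ} {rem : Finset ℕ} {s₁ s : Mem σ} {new : ℕ → Option σ} {K M : Set ℕ}

/-- Clear the slots which lie `x` columns behind those collected in array `13`, where register `14`
holds `x`. -/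
def killLoop : Prog :=
  .loop (.lt (R 16) (R 13)) (block [.store 8 (.add (.load 13 (R 16)) (R 14)) (.const 0),
    .set 16 (.add (R 16) (.const 1))])

theorem killLoop_spec (hB : StepBase E m b t s₁) (h : InStep E m rem b t s₁ new K M s)
    {outs : List ℕ} (hlen : outs.length < 2 ^ E.w) (hcol : Collected s outs) {x : ℕ}
    (h14 : s.reg 14 = x) (hword : ∀ v ∈ outs, v + x < 2 ^ E.w) (h16 : s.reg 16 = 0) :
    WP E killLoop s fun c s' => c ≤ 20 * outs.length + 3 ∧
      InStep E m rem b t s₁ new (K ∪ {u | ∃ v ∈ outs, u = v + x}) M s' ∧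
      Collected s' outs ∧ s'.reg 14 = x := by
  have hw1 : 1 % 2 ^ E.w = 1 := Nat.mod_eq_of_lt (by have := hB.word; omega)
  refine WP.mono (WP.loop (γ := ℕ) (fun i s' => i ≤ outs.length ∧ s'.reg 16 = i ∧
    s'.reg 14 = x ∧ Collected s' outs ∧
    InStep E m rem b t s₁ new (K ∪ {u | ∃ v ∈ outs.take i, u = v + x}) M s')
    (fun i => 20 * (outs.length - i)) ?_ (g := 0) ⟨Nat.zero_le _, h16, h14, hcol, by simpa using h⟩)
    ?_
  · rintro i s1 ⟨hi, e16, e14, hc, hI⟩ ht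
    simp only [Test.holds, Expr.eval, e16, hc.1] at ht
    have hm1 : (i + 1) % 2 ^ E.w = i + 1 := Nat.mod_eq_of_lt (by omega)
    have hg := hc.2 i ht
    have hmem : s1.arr 13 i ∈ outs := List.mem_of_getElem? hg
    have hm2 := Nat.mod_eq_of_lt (hword _ hmem)
    refine WP.block ?_
    generalize hs2 : List.foldl (fun s c => Cmd.run E s c) s1 _ = s2
    have r2 : s2.reg = Function.update s1.reg 16 (i + 1) := by
      subst hs2
      simp [Cmd.run, Expr.eval, Mem.setReg, Mem.setArr, hw1, hm1, e16]
    have a2 : s2.arr = Function.update s1.arr 8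
        (Function.update (s1.arr 8) (s1.arr 13 i + x) 0) := by
      subst hs2
      simp [Cmd.run, Expr.eval, Mem.setReg, Mem.setArr, e16, e14, hm2]
    have htk : outs.take (i + 1) = outs.take i ++ [s1.arr 13 i] := by
      rw [List.take_add_one, hg]
      rfl
    refine ⟨i + 1, ⟨ht, by simp [r2], by simp [r2, e14], ?_, ?_⟩, ?_⟩
    · refine ⟨by simp [r2, hc.1], ?_⟩
      rw [a2]
      simpa using hc.2
    · refine hI.kill ?_ ?_ (by subst hs2; rfl) (by subst hs2; rfl) ?_ ?_
      · intro y hy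
        simp [r2, show y ≠ 16 by omega]
      · intro a ha _
        simp [a2, ha]
      · intro v hv
        rw [a2, Function.update_self]
        by_cases e : v = s1.arr 13 i + x
        · rw [e, Function.update_self]
        · rw [Function.update_of_ne e]
          refine hI.killed v ?_
          rcases hv with hv | ⟨u, hu, rfl⟩
          · exact Or.inl hv
          · rw [htk, List.mem_append, List.mem_singleton] at hu
            rcases hu with hu | rfl
            · exact Or.inr ⟨u, hu, rfl⟩
            · exact absurd rfl e
      · intro v hv
        rw [a2, Function.update_self, Function.update_of_ne]
        · refine hI.kept v fun h => hv ?_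
          rcases h with h | ⟨u, hu, rfl⟩
          · exact Or.inl h
          · exact Or.inr ⟨u, by rw [htk]; exact List.mem_append_left _ hu, rfl⟩
        · rintro rfl
          exact hv (Or.inr ⟨_, by rw [htk]; simp, rfl⟩)
    · simp only [blockCost, List.map, List.sum_cons, List.sum_nil, Test.cost, Expr.cost, Cmd.cost]
      omega
  · rintro c s' ⟨i, ⟨hi, e16, e14, hc, hI⟩, ht, hcc⟩
    simp only [Test.holds, Expr.eval, e16, hc.1] at ht
    obtain rfl : i = outs.length := by omega
    rw [List.take_length] at hI
    simp only [Test.cost, Expr.cost] at hcc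
    exact ⟨by omega, hI, hc, e14⟩

/-- Go through the inner colliding blocks of the block in register `10`. -/
def innerLoop : Prog :=
  .loop (.not (.lt (.load 1 (R 10)) (R 14))) (.seq (block [.set 15 (.load 8 (.add (R 11) (R 14)))])
    (.seq (.ite (.lt (.const 0) (R 15))
      (.seq (block [.store 8 (.add (R 11) (R 14)) (.const 0), .set 23 (.sub (R 15) (.const 1)),
          .set 16 (.const 0)])
        (.seq (touch (.updInner (R 10) (R 23))) killLoop))
      (.cmd .skip)) (.cmd (.set 14 (.add (R 14) (.const 1))))))

/-- The slots cleared after going through the first `x` columns of the block whose slots start at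
`o`, if `outs` are the slots of the outer collisions. -/
def killedUpTo (s₁ : Mem σ) (o : ℕ) (outs : List ℕ) (x : ℕ) : Set ℕ :=
  {u | u ∈ outs ∨ ∃ y < x, s₁.arr 8 (o + y) ≠ 0 ∧ (u = o + y ∨ ∃ v ∈ outs, u = v + y)}

/-- The blocks whose collisions with these columns are present. -/
def innerUpTo (s₁ : Mem σ) (o x : ℕ) : Set ℕ :=
  {k | ∃ y < x, s₁.arr 8 (o + y) = k + 1}

/-- Slots of one block are consecutive, so moving `x` columns to the right is adding `x`. Each
column pays for a tree repair, and each present one also for a walk through `outs`; the resulting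
product is covered by `card_aliveSlots_erase`. -/
theorem innerLoop_spec (hB : StepBase E m b t s₁) {outs : List ℕ} {M₀ : Set ℕ} {d o : ℕ}
    (h : InStep E m rem b t s₁ new {v | v ∈ outs} M₀ s) (hlen : outs.length < 2 ^ E.w)
    (hcol : Collected s outs) (h14 : s.reg 14 = 0) (hd : s₁.arr 1 b = d) (ho : s₁.reg 11 = o)
    (hword : ∀ v ∈ outs, ∀ x ≤ d, v + x < 2 ^ E.w) (hword' : o + d + 2 < 2 ^ E.w)
    (hdis : ∀ v ∈ outs, ∀ y ≤ d, ∀ x ≤ d, v + y ≠ o + x)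
    (hin : ∀ y ≤ d, ∀ k, s₁.arr 8 (o + y) = k + 1 → k < m ∧ k ≠ b ∧
      Replaces E b s₁ new (.updInner (R 10) (R 23)) k) :
    WP E innerLoop s fun c s' => c ≤ 100 * (Nat.log 2 m + 6) * (d + 1) + 10 +
        20 * (outs.length * ((Finset.range (d + 1)).filter fun y => s₁.arr 8 (o + y) ≠ 0).card) ∧
      InStep E m rem b t s₁ new (killedUpTo s₁ o outs (d + 1)) (M₀ ∪ innerUpTo s₁ o (d + 1)) s' := by
  have hw1 : 1 % 2 ^ E.w = 1 := Nat.mod_eq_of_lt (by have := hB.word; omega)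
  refine WP.mono (WP.loop (γ := ℕ) (fun x s' => x ≤ d + 1 ∧ s'.reg 14 = x ∧ Collected s' outs ∧
    InStep E m rem b t s₁ new (killedUpTo s₁ o outs x) (M₀ ∪ innerUpTo s₁ o x) s')
    -- The potential charges the remaining columns individually, as only those with a present
    -- collision run the clearing loop.
    (fun x => ∑ y ∈ Finset.Ico x (d + 1), (100 * (Nat.log 2 m + 6) +
      if s₁.arr 8 (o + y) ≠ 0 then 20 * outs.length else 0)) ?_ (g := 0) ?_) ?_
  · rintro x s1 ⟨hx, e14, hc, hI⟩ ht
    have e10 := (hI.reg 10 (by norm_num)).trans hB.r10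
    have e11 := (hI.reg 11 (by norm_num)).trans ho
    have e1 := hI.arr 1 (by norm_num) (by norm_num) (by norm_num) (by norm_num)
    simp only [Test.holds, Expr.eval, e14, e10, e1, hd, not_lt] at ht
    have hm1 : (x + 1) % 2 ^ E.w = x + 1 := Nat.mod_eq_of_lt (by omega)
    have hm2 : (o + x) % 2 ^ E.w = o + x := Nat.mod_eq_of_lt (by omega)
    rw [Finset.sum_eq_sum_Ico_succ_bot (by omega)]
    refine WP.seq (WP.block ?_)
    have e15 : List.foldl (fun s c => Cmd.run E s c) s1
        [Cmd.set 15 (.load 8 (.add (R 11) (R 14)))] = s1.setReg 15 (s1.arr 8 (o + x)) := by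
      simp [Cmd.run, Expr.eval, e11, e14, hm2]
    rw [e15]
    have hfin : ∀ s2 : Mem σ, s2.reg 14 = x → Collected s2 outs →
        InStep E m rem b t s₁ new (killedUpTo s₁ o outs (x + 1))
          (M₀ ∪ innerUpTo s₁ o (x + 1)) s2 →
        ∀ B c, c + 4 ≤ B → WP E (.cmd (.set 14 (.add (R 14) (.const 1)))) s2 fun c' s3 =>
          ∃ g', (g' ≤ d + 1 ∧ s3.reg 14 = g' ∧ Collected s3 outs ∧
            InStep E m rem b t s₁ new (killedUpTo s₁ o outs g') (M₀ ∪ innerUpTo s₁ o g') s3) ∧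
          c + c' + ∑ y ∈ Finset.Ico g' (d + 1), (100 * (Nat.log 2 m + 6) +
            if s₁.arr 8 (o + y) ≠ 0 then 20 * outs.length else 0) ≤
          B + ∑ y ∈ Finset.Ico (x + 1) (d + 1), (100 * (Nat.log 2 m + 6) +
            if s₁.arr 8 (o + y) ≠ 0 then 20 * outs.length else 0) := by
      intro s2 e14' hc' hI' B c hcB
      refine WP.cmd ⟨x + 1, ⟨by omega, ?_, ?_, ?_⟩, ?_⟩
      · simp [Cmd.run, Expr.eval, Mem.setReg, e14', hw1, hm1]
      · simpa [Cmd.run, Mem.setReg, Collected] using hc'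
      · refine hI'.kill ?_ (fun _ _ _ => rfl) rfl rfl hI'.killed hI'.kept
        intro y hy
        simp [Cmd.run, Mem.setReg, show y ≠ 14 by omega]
      · have : (Cmd.set 14 (.add (R 14) (.const 1))).cost = 4 := by decide
        omega
    refine WP.seq (WP.ite ?_ ?_)
    · intro ht'
      simp only [Test.holds, Expr.eval, Nat.zero_mod, Mem.setReg, Function.update_self] at ht'
      have hnk : o + x ∉ killedUpTo s₁ o outs x := fun hk => ht'.ne' (hI.killed _ hk)
      have hkept := hI.kept _ hnk
      obtain ⟨k, hk⟩ : ∃ k, s₁.arr 8 (o + x) = k + 1 := ⟨s₁.arr 8 (o + x) - 1, by omega⟩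
      obtain ⟨k1, k2, k3⟩ := hin x ht k hk
      rw [hkept, hk]
      refine WP.seq (WP.block ?_)
      generalize hs2 : List.foldl (fun s c => Cmd.run E s c) (s1.setReg 15 (k + 1)) _ = s2
      have r2 : s2.reg = Function.update (Function.update (Function.update s1.reg 15 (k + 1)) 23 k)
          16 0 := by
        subst hs2
        simp [Cmd.run, Expr.eval, Mem.setReg, Mem.setArr, hw1]
      have a2 : s2.arr = Function.update s1.arr 8 (Function.update (s1.arr 8) (o + x) 0) := by
        subst hs2
        simp [Cmd.run, Expr.eval, Mem.setReg, Mem.setArr, e11, e14, hm2]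
      have hI2 : InStep E m rem b t s₁ new (insert (o + x) (killedUpTo s₁ o outs x))
          (M₀ ∪ innerUpTo s₁ o x) s2 := by
        refine hI.kill ?_ ?_ (by subst hs2; rfl) (by subst hs2; rfl) ?_ ?_
        · intro y hy
          simp [r2, show y ≠ 16 by omega, show y ≠ 23 by omega, show y ≠ 15 by omega]
        · intro a ha _
          simp [a2, ha]
        · intro v hv
          rw [a2, Function.update_self]
          by_cases e : v = o + x
          · rw [e, Function.update_self]
          · rw [Function.update_of_ne e]
            exact hI.killed v (hv.resolve_left e)
        · intro v hv
          rw [Set.mem_insert_iff, not_or] at hv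
          rw [a2, Function.update_self, Function.update_of_ne hv.1]
          exact hI.kept v hv.2
      refine WP.seq (WP.mono (touch_spec hB hI2 (by simp [r2]) k1 k2 (by decide) k3) ?_)
      rintro c1 s3 ⟨hc1, hI3, hr3, h3⟩
      have hc3 : Collected s3 outs := by
        rw [Collected, hr3 13 (by norm_num) (by norm_num) (by norm_num), h3, r2, a2]
        simpa [Collected] using hc
      refine WP.mono (killLoop_spec hB hI3 hlen hc3 (x := x)
        (by rw [hr3 14 (by norm_num) (by norm_num) (by norm_num), r2]; simpa using e14)
        (fun v hv => hword v hv x ht)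
        (by rw [hr3 16 (by norm_num) (by norm_num) (by norm_num), r2]; simp)) ?_
      rintro c2 s4 ⟨hc2, hI4, hc4, e14'⟩
      refine WP.mono (hfin s4 e14' hc4 ?_ (100 * (Nat.log 2 m + 6) + 20 * outs.length)
        (c1 + c2 + 50) (by omega)) ?_
      · have eK : killedUpTo s₁ o outs (x + 1) = insert (o + x) (killedUpTo s₁ o outs x) ∪
            {u | ∃ v ∈ outs, u = v + x} := by
          ext u
          simp only [killedUpTo, Set.mem_ofPred_eq, Set.mem_union, Set.mem_insert_iff]
          constructor
          · rintro (h | ⟨y, hy, h1, h2⟩)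
            · exact Or.inl (Or.inr (Or.inl h))
            · by_cases e : y = x
              · subst e
                rcases h2 with h2 | h2
                · exact Or.inl (Or.inl h2)
                · exact Or.inr h2
              · exact Or.inl (Or.inr (Or.inr ⟨y, by omega, h1, h2⟩))
          · rintro ((h | h | ⟨y, hy, h1, h2⟩) | h)
            · exact Or.inr ⟨x, by omega, by omega, Or.inl h⟩
            · exact Or.inl h
            · exact Or.inr ⟨y, by omega, h1, h2⟩
            · exact Or.inr ⟨x, by omega, by omega, Or.inr h⟩
        have eM : M₀ ∪ innerUpTo s₁ o (x + 1) = insert k (M₀ ∪ innerUpTo s₁ o x) := by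
          ext u
          simp only [innerUpTo, Set.mem_ofPred_eq, Set.mem_union, Set.mem_insert_iff]
          constructor
          · rintro (h | ⟨y, hy, h1⟩)
            · exact Or.inr (Or.inl h)
            · by_cases e : y = x
              · subst e
                exact Or.inl (by omega)
              · exact Or.inr (Or.inr ⟨y, by omega, h1⟩)
          · rintro (rfl | h | ⟨y, hy, h1⟩)
            · exact Or.inr ⟨x, by omega, hk⟩
            · exact Or.inl h
            · exact Or.inr ⟨y, by omega, h1⟩
        rw [eK, eM]
        exact hI4
      · rintro c3 s5 ⟨g', hg', hcc⟩
        refine ⟨g', hg', ?_⟩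
        rw [if_pos (show k + 1 ≠ 0 by omega)]
        simp only [blockCost, List.map, List.sum_cons, List.sum_nil, Test.cost, Expr.cost,
          Cmd.cost]
        omega
    · intro ht'
      simp only [Test.holds, Expr.eval, Nat.zero_mod, Mem.setReg, Function.update_self, not_lt,
        Nat.le_zero] at ht'
      -- The zero was there from the start: a slot of `b` is cleared only at its own turn, since the
      -- shifted outer slots belong to other blocks (`hdis`).
      have hz : s₁.arr 8 (o + x) = 0 := by
        by_cases hk : o + x ∈ killedUpTo s₁ o outs x
        · rcases hk with hk | ⟨y, hy, h1, h2 | ⟨v, hv, h2⟩⟩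
          · exact absurd rfl (hdis _ hk 0 (by omega) x ht)
          · omega
          · exact absurd h2.symm (hdis v hv y (by omega) x ht)
        · rw [← hI.kept _ hk, ht']
      refine WP.cmd ?_
      refine WP.mono (hfin (s1.setReg 15 (s1.arr 8 (o + x))) (by simpa [Mem.setReg] using e14)
        (by simpa [Mem.setReg, Collected] using hc) ?_ (100 * (Nat.log 2 m + 6)) 50 (by omega)) ?_
      · have eK : killedUpTo s₁ o outs (x + 1) = killedUpTo s₁ o outs x := by
          ext u
          simp only [killedUpTo, Set.mem_ofPred_eq]
          constructor
          · rintro (h | ⟨y, hy, h1, h2⟩)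
            · exact Or.inl h
            · refine Or.inr ⟨y, lt_of_le_of_ne (by omega) ?_, h1, h2⟩
              rintro rfl
              exact h1 hz
          · rintro (h | ⟨y, hy, h1, h2⟩)
            · exact Or.inl h
            · exact Or.inr ⟨y, by omega, h1, h2⟩
        have eM : innerUpTo s₁ o (x + 1) = innerUpTo s₁ o x := by
          ext u
          simp only [innerUpTo, Set.mem_ofPred_eq]
          constructor
          · rintro ⟨y, hy, h1⟩
            refine ⟨y, lt_of_le_of_ne (by omega) ?_, h1⟩
            rintro rfl
            omega
          · rintro ⟨y, hy, h1⟩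
            exact ⟨y, by omega, h1⟩
        rw [eK, eM]
        refine hI.kill ?_ (fun _ _ _ => rfl) rfl rfl hI.killed hI.kept
        intro y hy
        simp [Mem.setReg, show y ≠ 15 by omega]
      · rintro c3 s5 ⟨g', hg', hcc⟩
        refine ⟨g', hg', ?_⟩
        rw [if_neg (by simpa using hz)]
        simp only [blockCost, List.map, List.sum_cons, List.sum_nil, Test.cost, Expr.cost,
          Cmd.cost]
        omega
  · refine ⟨by omega, h14, hcol, ?_⟩
    have eK : killedUpTo s₁ o outs 0 = {v | v ∈ outs} := by
      ext u
      simp [killedUpTo]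
    have eM : innerUpTo s₁ o 0 = ∅ := by
      ext u
      simp [innerUpTo]
    rw [eK, eM, Set.union_empty]
    exact h
  · rintro c s' ⟨x, ⟨hx, e14, hc, hI⟩, ht, hcc⟩
    have e10 := (hI.reg 10 (by norm_num)).trans hB.r10
    have e1 := hI.arr 1 (by norm_num) (by norm_num) (by norm_num) (by norm_num)
    simp only [Test.holds, Expr.eval, e14, e10, e1, hd, not_not] at ht
    obtain rfl : x = d + 1 := by omega
    refine ⟨?_, hI⟩
    rw [Finset.Ico_self, Finset.sum_empty, Nat.Ico_zero_eq_range, Finset.sum_add_distrib,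
      Finset.sum_const, Finset.card_range, ← Finset.sum_filter, Finset.sum_const] at hcc
    simp only [Test.cost, Expr.cost, smul_eq_mul] at hcc
    calc c ≤ _ := hcc
      _ ≤ _ := by
        rw [mul_comm (d + 1), Nat.add_assoc _ 10, Nat.add_assoc]
        refine Nat.add_le_add_left ?_ _
        rw [show ∀ a b : ℕ, a * (20 * b) = 20 * (b * a) by intros; ring]
        omega

end Inner

/-! ## One pass of the greedy block choice -/

/-- The number of the slot of column `0` of block `k`. -/
def slotOffset {n : ℕ} (blk : ℕ → Block n) (k : ℕ) : ℕ := ∑ j ∈ Finset.range k, ((blk j).d + 1)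

theorem slotOffset_succ {n : ℕ} (blk : ℕ → Block n) (k : ℕ) :
    slotOffset blk (k + 1) = slotOffset blk k + ((blk k).d + 1) := Finset.sum_range_succ _ _

theorem slotOffset_mono {n : ℕ} (blk : ℕ → Block n) : Monotone (slotOffset blk) := by
  apply monotone_nat_of_le_succ
  intro k
  rw [slotOffset_succ]
  omega

theorem slot_lt {n : ℕ} {blk : ℕ → Block n} {m o x : ℕ} (ho : o < m) (hx : x ≤ (blk o).d) :
    slotOffset blk o + x < slotOffset blk m := by
  have := slotOffset_mono blk (show o + 1 ≤ m from ho)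
  rw [slotOffset_succ] at this
  omega

theorem slot_inj {n : ℕ} {blk : ℕ → Block n} {o x o' x' : ℕ} (hx : x ≤ (blk o).d)
    (hx' : x' ≤ (blk o').d) (h : slotOffset blk o + x = slotOffset blk o' + x') :
    o = o' ∧ x = x' := by
  rcases lt_trichotomy o o' with hlt | rfl | hlt
  · have := slot_lt hlt hx
    omega
  · exact ⟨rfl, by omega⟩
  · have := slot_lt hlt hx'
    omega

theorem slotOffset_eq_card {n : ℕ} (blk : ℕ → Block n) (m : ℕ) :
    slotOffset blk m = (slots m fun k => (blk k).d).card := by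
  simp [slots, slotOffset]

section Pass

variable {α : Type*} [LinearOrder α] {n : ℕ} {σ : Type*}

/-- `lst k` lists the slots where block `k` starts. -/
structure SlotLists (L : Fin n → α) (m : ℕ) (blk : ℕ → Block n) (lst : ℕ → List ℕ) : Prop where
  nodup : ∀ k < m, (lst k).Nodup
  mem : ∀ k < m, ∀ v, v ∈ lst k ↔ ∃ o x, starter L m blk o x = k + 1 ∧ v = slotOffset blk o + x

/-- The part of the memory which is prepared at the beginning and never changed. -/
structure Prepared (m : ℕ) (blk : ℕ → Block n) (lst : ℕ → List ℕ) (s : Mem σ) : Prop where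
  r1 : s.reg 1 = m
  d : ∀ k < m, s.arr 1 k = (blk k).d
  off : ∀ k < m, s.arr 7 k = slotOffset blk k
  owner : ∀ k < m, ∀ x ≤ (blk k).d, s.arr 9 (slotOffset blk k + x) = k
  chain : ∀ k < m, Chain (s.arr 11) (s.arr 10 k) (lst k)

/-- The slots hold the present collisions. -/
structure SlotsOK (L : Fin n → α) (m : ℕ) (blk : ℕ → Block n) (rem : Finset ℕ) (A : ℕ → ℕ) :
    Prop where
  alive : ∀ o x, Alive m (starter L m blk) rem o x → A (slotOffset blk o + x) = starter L m blk o x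
  dead : ∀ o < m, ∀ x ≤ (blk o).d, ¬ Alive m (starter L m blk) rem o x →
    A (slotOffset blk o + x) = 0

/-- The memory `s` represents the state `g` reached from `g₀`. -/
structure Represents (L : Fin n → α) (E : Env n σ) (m : ℕ) (blk : ℕ → Block n) (g₀ g : GState n σ)
    (rem : Finset ℕ) (s : Mem σ) : Prop where
  sub : rem ⊆ Finset.range m
  tracks : Tracks L m blk g rem
  steps : Relation.ReflTransGen (GState.Step E.scoring) g₀ g
  slots : SlotsOK L m blk rem (s.arr 8)
  mark : ∀ k, s.arr 12 k ≤ s.reg 3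
  record : ∀ k < m, s.record k = some (g.record (blk k))
  tree : TreeOK m (s.arr 5) (cellScore E s) rem
  tc : s.real 0 = g.tc
  bBest : s.real 1 = g.bBest
  tBest : s.reg 2 = g.tBest
  count : s.reg 3 = g.BS.length
  card : g.BS.length + rem.card = m
  out : ∀ i < g.BS.length, s.arr 4 i < m ∧ g.BS[i]? = some (blk (s.arr 4 i))

variable {L : Fin n → α} {E : Env n σ} {m : ℕ} {blk : ℕ → Block n} {g₀ g : GState n σ}
  {rem : Finset ℕ} {s s₁ : Mem σ} {lst : ℕ → List ℕ} {b o x k : ℕ}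

theorem SlotsOK.ne_zero_iff (h : SlotsOK L m blk rem (s₁.arr 8)) (ho : o < m)
    (hx : x ≤ (blk o).d) : s₁.arr 8 (slotOffset blk o + x) ≠ 0 ↔
      Alive m (starter L m blk) rem o x := by
  constructor
  · intro h0
    by_contra hA
    exact h0 (h.dead o ho x hx hA)
  · intro hA
    rw [h.alive o x hA]
    obtain ⟨-, ⟨i, -, hi⟩, -⟩ := hA
    omega

theorem alive_range (F : Family L m blk) (hA : Alive m (starter L m blk) rem o x) :
    o < m ∧ x ≤ (blk o).d := by
  obtain ⟨-, ⟨i, -, hi⟩, -⟩ := hA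
  have h := F.starter_eq_iff.1 hi
  exact ⟨h.1, h.2.1⟩

theorem mem_liveSlots_iff (F : Family L m blk) (hL : SlotLists L m blk lst)
    (h : SlotsOK L m blk rem (s₁.arr 8)) (hb : b < m) {v : ℕ} : v ∈ liveSlots s₁ (lst b) ↔
      ∃ o x, Alive m (starter L m blk) rem o x ∧ starter L m blk o x = b + 1 ∧
        v = slotOffset blk o + x := by
  simp only [liveSlots, List.mem_filter, hL.mem b hb, decide_eq_true_eq]
  constructor
  · rintro ⟨⟨o, x, h1, rfl⟩, h2⟩
    have hs := F.starter_eq_iff.1 h1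
    exact ⟨o, x, (h.ne_zero_iff hs.1 hs.2.1).1 h2, h1, rfl⟩
  · rintro ⟨o, x, h1, h2, rfl⟩
    have hs := F.starter_eq_iff.1 h2
    exact ⟨⟨o, x, h2, rfl⟩, (h.ne_zero_iff hs.1 hs.2.1).2 h1⟩

theorem length_liveSlots_le (F : Family L m blk) (hL : SlotLists L m blk lst)
    (h : SlotsOK L m blk rem (s₁.arr 8)) (hb : b < m) : (liveSlots s₁ (lst b)).length ≤
      (outerSlots m (fun k => (blk k).d) (starter L m blk) rem b).card := by
  classical
  have hnd : (liveSlots s₁ (lst b)).Nodup := (hL.nodup b hb).filter _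
  rw [← List.toFinset_card_of_nodup hnd]
  refine (Finset.card_le_card (t := (outerSlots m (fun k => (blk k).d) (starter L m blk) rem
    b).image fun p => slotOffset blk p.1 + p.2) ?_).trans Finset.card_image_le
  intro v hv
  rw [List.mem_toFinset, mem_liveSlots_iff F hL h hb] at hv
  obtain ⟨o, x, h1, h2, rfl⟩ := hv
  refine Finset.mem_image.2 ⟨⟨o, x⟩, ?_, rfl⟩
  simp only [outerSlots, aliveSlots, Finset.mem_filter, mem_slots]
  exact ⟨⟨alive_range F h1, h1⟩, h2⟩

/-- The three kinds of cleared slots match the three ways in `alive_erase_iff` of losing a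
collision: collected slots have `b` as inner block, slots of `b` have it as outer block, and shifted
slots have it in between. -/
theorem mem_killed_iff (F : Family L m blk) (hL : SlotLists L m blk lst)
    (h : SlotsOK L m blk rem (s₁.arr 8)) (hb : b ∈ rem) (hbm : b < m) (ho : o < m)
    (hx : x ≤ (blk o).d) :
    slotOffset blk o + x ∈ killedUpTo s₁ (slotOffset blk b) (liveSlots s₁ (lst b)) ((blk b).d + 1) ↔
      Alive m (starter L m blk) rem o x ∧ ¬ Alive m (starter L m blk) (rem.erase b) o x := by
  have G := F.collisionTable
  rw [alive_erase_iff hb hbm]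
  simp only [killedUpTo, Set.mem_ofPred_eq, mem_liveSlots_iff F hL h hbm]
  constructor
  · rintro (⟨o', x', h1, h2, e⟩ | ⟨y, hy, h1, h2⟩)
    · have hr := alive_range F h1
      obtain ⟨rfl, rfl⟩ := slot_inj hx hr.2 e
      exact ⟨h1, fun hn => hn.2.2.1 h2⟩
    · have hA := (h.ne_zero_iff hbm (by omega)).1 h1
      rcases h2 with e | ⟨v, ⟨o', x', h3, h4, rfl⟩, e⟩
      · obtain ⟨rfl, rfl⟩ := slot_inj hx (show y ≤ (blk b).d by omega) e
        exact ⟨hA, fun hn => hn.2.1 rfl⟩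
      · have hf := (F.starter_eq_iff.1 h4).fit F
        obtain ⟨rfl, rfl⟩ := slot_inj (o' := o') (x' := x' + y) hx (by omega) (by omega)
        obtain ⟨h5, h6⟩ := h3.trans G h4 hA
        exact ⟨h5, fun hn => hn.2.2.2 x' y rfl h4 h6.symm⟩
  · rintro ⟨hA, hn⟩
    by_cases h1 : o = b
    · subst h1
      exact Or.inr ⟨x, by omega, (h.ne_zero_iff ho hx).2 hA, Or.inl rfl⟩
    · by_cases h2 : starter L m blk o x = b + 1
      · exact Or.inl ⟨o, x, hA, h2, rfl⟩
      · have h3 : ∃ x' y', x' + y' = x ∧ starter L m blk o x' = b + 1 ∧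
            starter L m blk b y' = starter L m blk o x := by
          by_contra hc
          exact hn ⟨hA, h1, h2, fun x' y' e1 e2 e3 => hc ⟨x', y', e1, e2, e3⟩⟩
        obtain ⟨x', y, rfl, e2, e3⟩ := h3
        obtain ⟨A1, A2⟩ := hA.split G e2 e3 hb
        have hr := alive_range F A2
        exact Or.inr ⟨y, by omega, (h.ne_zero_iff hbm hr.2).2 A2, Or.inr
          ⟨_, ⟨o, x', A1, e2, rfl⟩, by omega⟩⟩

/-- The record of block `k` after the choice of the colliding block `b`. -/
def newRecord (E : Env n σ) (blk : ℕ → Block n) (g : GState n σ) (b k : ℕ) : Option σ :=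
  some (if (blk b).height < (blk k).height
    then E.scoring.updInner (blk b) (g.record (blk b)) (blk k) (g.record (blk k))
    else E.scoring.updOuter (blk b) (g.record (blk b)) (blk k) (g.record (blk k)))

theorem replaces_inner (hE : ∀ k < m, E.blocks[k]? = some (blk k))
    (hr : ∀ k < m, s₁.record k = some (g.record (blk k))) (hb : b < m) (hk : k < m)
    (hh : (blk b).height < (blk k).height) :
    Replaces E b s₁ (newRecord E blk g b) (.updInner (R 10) (R 23)) k := by
  intro s h10 h23 h1 h2
  simp only [Cmd.run, Expr.eval, h10, h23, Mem.updRecord, hE b hb, hE k hk, h1, h2, hr b hb,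
    hr k hk, newRecord, if_pos hh]

theorem replaces_outer (hE : ∀ k < m, E.blocks[k]? = some (blk k))
    (hr : ∀ k < m, s₁.record k = some (g.record (blk k))) (hb : b < m) (hk : k < m)
    (hh : (blk k).height < (blk b).height) :
    Replaces E b s₁ (newRecord E blk g b) (.updOuter (R 10) (R 23)) k := by
  intro s h10 h23 h1 h2
  simp only [Cmd.run, Expr.eval, h10, h23, Mem.updRecord, hE b hb, hE k hk, h1, h2, hr b hb,
    hr k hk, newRecord, if_neg (not_lt.2 hh.le)]

/-- Move a best block from the tree to the result, and compare the outcome with the best one. -/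
def select : Prog :=
  .seq (block [.set 10 (.sub (.load 5 (.const 1)) (.const 1)), .set 11 (.load 7 (R 10)),
      .set 12 (.load 10 (R 10)), .set 13 (.const 0), .store 4 (R 3) (R 10),
      .set 3 (.add (R 3) (.const 1)), .store 5 (.add (R 1) (R 10)) (.const 0), .set 23 (R 10),
      .rscore 2 (R 10), .radd 0 0 2, .rgross 3 0, .rtax 4 (R 3), .rsub 3 3 4])
    (.seq (.ite (.rlt 1 3) (block [.set 2 (R 3), .rzero 1, .radd 1 1 3]) (.cmd .skip)) fixLeaf)

theorem select_spec (hw : 4 * m + 4 ≤ 2 ^ E.w)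
    (P : Prepared m blk lst s) (I : Represents L E m blk g₀ g rem s) (hne : rem.Nonempty) :
    WP E select s fun c s' => c ≤ 100 * (Nat.log 2 m + 4) ∧
      ∃ b ∈ rem, (∀ k ∈ rem, E.scoring.score (g.record (blk k)) ≤
          E.scoring.score (g.record (blk b))) ∧
        s'.reg 1 = m ∧ s'.reg 2 = (g.choose E.scoring (blk b)).tBest ∧
        s'.reg 3 = g.BS.length + 1 ∧ s'.reg 10 = b ∧ s'.reg 11 = s.arr 7 b ∧
        s'.reg 12 = s.arr 10 b ∧ s'.reg 13 = 0 ∧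
        (∀ a, a ≠ 4 → a ≠ 5 → s'.arr a = s.arr a) ∧
        s'.arr 4 = Function.update (s.arr 4) g.BS.length b ∧
        s'.real 0 = (g.choose E.scoring (blk b)).tc ∧
        s'.real 1 = (g.choose E.scoring (blk b)).bBest ∧
        s'.record = s.record ∧ TreeOK m (s'.arr 5) (cellScore E s') (rem.erase b) := by
  obtain ⟨b, hb, hroot, hmax⟩ := I.tree.root I.sub hne
  have hbm := Finset.mem_range.1 (I.sub hb)
  have hsc : ∀ k < m, cellScore E s k = E.scoring.score (g.record (blk k)) := by
    intro k hk
    rw [cellScore, I.record k hk]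
    rfl
  have hcard := I.card
  have hpos : 0 < rem.card := Finset.card_pos.2 ⟨b, hb⟩
  have hw1 : 1 % 2 ^ E.w = 1 := Nat.mod_eq_of_lt (by omega)
  have hm1 : (g.BS.length + 1) % 2 ^ E.w = g.BS.length + 1 := Nat.mod_eq_of_lt (by omega)
  have hm2 : (m + b) % 2 ^ E.w = m + b := Nat.mod_eq_of_lt (by omega)
  refine WP.seq (WP.block ?_)
  generalize hs2 : List.foldl (fun s c => Cmd.run E s c) s _ = s2
  have r2 : s2.reg = Function.update (Function.update (Function.update (Function.update
      (Function.update (Function.update s.reg 10 b) 11 (s.arr 7 b)) 12 (s.arr 10 b)) 13 0) 3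
      (g.BS.length + 1)) 23 b := by
    subst hs2
    simp [Cmd.run, Expr.eval, Mem.setReg, Mem.setArr, Mem.setReal, hw1, hroot, I.count, hm1]
  have a2 : s2.arr = Function.update (Function.update s.arr 4
      (Function.update (s.arr 4) g.BS.length b)) 5 (Function.update (s.arr 5) (m + b) 0) := by
    subst hs2
    simp [Cmd.run, Expr.eval, Mem.setReg, Mem.setArr, Mem.setReal, hw1, hroot, I.count, hm1, P.r1,
      hm2]
  have c2 : s2.record = s.record := by
    subst hs2
    rfl
  have hel : (s.record b).elim 0 E.scoring.score = E.scoring.score (g.record (blk b)) := hsc b hbm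
  have v0 : s2.real 0 = g.tc + E.scoring.score (g.record (blk b)) := by
    subst hs2
    simp [Cmd.run, Expr.eval, Mem.setReg, Mem.setArr, Mem.setReal, hw1, hroot, I.tc, hel]
  have v1 : s2.real 1 = g.bBest := by
    subst hs2
    simp [Cmd.run, Expr.eval, Mem.setReg, Mem.setArr, Mem.setReal, hw1, hroot, I.bBest]
  -- Register `3` has been increased before the tax is evaluated, so the tunnel of `b` is already
  -- counted.
  have v3 : s2.real 3 = E.scoring.grossBenefit (g.tc + E.scoring.score (g.record (blk b)))
      - E.scoring.tax (g.BS.length + 1) := by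
    subst hs2
    simp [Cmd.run, Expr.eval, Mem.setReg, Mem.setArr, Mem.setReal, hw1, hroot, I.tc, hel, I.count,
      hm1]
  clear hs2
  -- A common postcondition of both branches, so that the repair of the tree is treated only once.
  refine WP.seq (WP.mono (Q := fun c s3 => c ≤ 20 ∧ (∀ x, x ≠ 2 → s3.reg x = s2.reg x) ∧
    s3.arr = s2.arr ∧ s3.record = s2.record ∧ s3.real 0 = s2.real 0 ∧
    s3.reg 2 = (g.choose E.scoring (blk b)).tBest ∧
    s3.real 1 = (g.choose E.scoring (blk b)).bBest) (WP.ite ?_ ?_) ?_)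
  · intro ht
    simp only [Test.holds, v1, v3] at ht
    refine WP.block ⟨by decide, ?_, rfl, rfl, ?_, ?_, ?_⟩
    · intro x hx
      simp [Cmd.run, Mem.setReg, Mem.setReal, hx]
    · simp [Cmd.run, Mem.setReg, Mem.setReal]
    · simp [Cmd.run, Mem.setReg, Mem.setReal, Expr.eval, GState.choose, if_pos ht, r2]
    · simp [Cmd.run, Mem.setReg, Mem.setReal, GState.choose, if_pos ht, v3]
  · intro ht
    simp only [Test.holds, v1, v3] at ht
    refine WP.cmd ⟨by decide, fun _ _ => rfl, rfl, rfl, rfl, ?_, ?_⟩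
    · simp [Cmd.run, GState.choose, if_neg ht, r2, I.tBest]
    · simp [Cmd.run, GState.choose, if_neg ht, v1]
  · rintro c s3 ⟨hc, hr3, ha3, hc3, hv0, ht3, hb3⟩
    refine WP.mono (fixLeaf_spec (s := s3) (m := m) (k := b) (rem' := rem.erase b) hw ?_ ?_ hbm
      I.tree ?_ ?_ ?_ ?_) ?_
    · rw [hr3 1 (by norm_num), r2]
      simpa using P.r1
    · rw [hr3 23 (by norm_num), r2]
      simp
    · intro u hu
      rw [ha3, a2]
      simp [hu]
    · intro k' _
      rw [cellScore, cellScore, hc3, c2]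
    · rw [ha3, a2]
      simp
    · intro k' hk'
      simp [hk']
    · rintro c' s4 ⟨hc', hF, hT⟩
      refine ⟨?_, b, hb, ?_, ?_, ?_, ?_, ?_, ?_, ?_, ?_, ?_, ?_, ?_, ?_, ?_, hT⟩
      · have : blockCost [.set 10 (.sub (.load 5 (.const 1)) (.const 1)), .set 11 (.load 7 (R 10)),
          .set 12 (.load 10 (R 10)), .set 13 (.const 0), .store 4 (R 3) (R 10),
          .set 3 (.add (R 3) (.const 1)), .store 5 (.add (R 1) (R 10)) (.const 0), .set 23 (R 10),
          .rscore 2 (R 10), .radd 0 0 2, .rgross 3 0, .rtax 4 (R 3), .rsub 3 3 4] ≤ 80 := by decide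
        omega
      · intro k hk
        rw [← hsc k (Finset.mem_range.1 (I.sub hk)), ← hsc b hbm]
        exact hmax k hk
      · rw [hF.reg 1 (by norm_num) (by norm_num) (by norm_num), hr3 1 (by norm_num), r2]
        simpa using P.r1
      · rw [hF.reg 2 (by norm_num) (by norm_num) (by norm_num), ht3]
      · rw [hF.reg 3 (by norm_num) (by norm_num) (by norm_num), hr3 3 (by norm_num), r2]
        simp
      · rw [hF.reg 10 (by norm_num) (by norm_num) (by norm_num), hr3 10 (by norm_num), r2]
        simp
      · rw [hF.reg 11 (by norm_num) (by norm_num) (by norm_num), hr3 11 (by norm_num), r2]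
        simp
      · rw [hF.reg 12 (by norm_num) (by norm_num) (by norm_num), hr3 12 (by norm_num), r2]
        simp
      · rw [hF.reg 13 (by norm_num) (by norm_num) (by norm_num), hr3 13 (by norm_num), r2]
        simp
      · intro a h4 h5
        rw [hF.arr a h5, ha3, a2]
        simp [h4, h5]
      · rw [hF.arr 4 (by norm_num), ha3, a2]
        simp
      · rw [hF.real 0 (by norm_num), hv0, v0]
        rfl
      · rw [hF.real 1 (by norm_num), hb3]
      · rw [hF.record, hc3, c2]

/-- One pass of the greedy block choice. -/
def pass : Prog :=
  .seq select (.seq outerLoop (.seq (.cmd (.set 14 (.const 0))) innerLoop))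

/-- The cleared slots are the collisions that disappear, and the marked blocks are those colliding
with `b`; with these two identifications the memory represents `choose`. The time is left in terms
of `b`, to be summed over all passes. -/
theorem pass_spec (F : Family L m blk) (hL : SlotLists L m blk lst)
    (hE : ∀ k < m, E.blocks[k]? = some (blk k)) (hw : 4 * m + 4 ≤ 2 ^ E.w)
    (hw' : slotOffset blk m + 3 ≤ 2 ^ E.w)
    (P : Prepared m blk lst s) (I : Represents L E m blk g₀ g rem s) (hne : rem.Nonempty) :
    WP E pass s fun c s' => ∃ b ∈ rem, Prepared m blk lst s' ∧
      Represents L E m blk g₀ (g.choose E.scoring (blk b)) (rem.erase b) s' ∧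
      c ≤ 100 * (Nat.log 2 m + 6) * ((lst b).length + (blk b).d + 3) +
        20 * ((outerSlots m (fun k => (blk k).d) (starter L m blk) rem b).card *
          (innerCols m (fun k => (blk k).d) (starter L m blk) rem b).card) := by
  refine WP.seq (WP.mono (select_spec hw P I hne) ?_)
  rintro c1 s1 ⟨hc1, b, hb, hmax, e1, e2, e3, e10, e11, e12, e13, ea, ea4, ev0, ev1, erec, hT⟩
  have hbm := Finset.mem_range.1 (I.sub hb)
  have hslots : SlotsOK L m blk rem (s1.arr 8) := by
    rw [ea 8 (by norm_num) (by norm_num)]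
    exact I.slots
  have hrec : ∀ k < m, s1.record k = some (g.record (blk k)) := by
    rw [erec]
    exact I.record
  have hB : StepBase E m b (g.BS.length + 1) s1 := by
    refine ⟨hw, e1, e3, e10, ?_⟩
    intro k
    have := I.mark k
    rw [I.count] at this
    rw [ea 12 (by norm_num) (by norm_num)]
    omega
  have hlt : ∀ v ∈ lst b, ∃ o x, o < m ∧ x + (blk b).d ≤ (blk o).d ∧ o ≠ b ∧
      starter L m blk o x = b + 1 ∧ v = slotOffset blk o + x := by
    intro v hv
    obtain ⟨o, x, h1, h2⟩ := (hL.mem b hbm v).1 hv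
    have hs := F.starter_eq_iff.1 h1
    exact ⟨o, x, hs.1, hs.fit F, hs.2.2.2.1.symm, h1, h2⟩
  have hlen : (lst b).length ≤ slotOffset blk m := by
    rw [← List.toFinset_card_of_nodup (hL.nodup b hbm), ← Finset.card_range (slotOffset blk m)]
    apply Finset.card_le_card
    intro v hv
    obtain ⟨o, x, ho, hx, -, -, rfl⟩ := hlt v (List.mem_toFinset.1 hv)
    exact Finset.mem_range.2 (slot_lt ho (by omega))
  have hown : ∀ o < m, ∀ x ≤ (blk o).d, s1.arr 9 (slotOffset blk o + x) = o := by
    rw [ea 9 (by norm_num) (by norm_num)]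
    exact P.owner
  have h0 : InStep E m (rem.erase b) b (g.BS.length + 1) s1 (newRecord E blk g b) ∅ ∅ s1 :=
    ⟨fun _ _ => rfl, fun _ _ _ _ _ => rfl, fun _ _ => rfl, fun _ h => h.elim, fun _ _ => rfl,
      fun _ h => h.elim, fun _ _ => rfl, fun _ h => h.elim, fun _ _ => rfl, hT, fun h => h.elim⟩
  have hlive : (liveSlots s1 (lst b)).length ≤ (lst b).length := List.length_filter_le _ _
  refine WP.seq (WP.mono (outerLoop_spec hB (l := lst b) (new := newRecord E blk g b)
    (hL.nodup b hbm) (by omega) ?_ ?_ h0 e13) ?_)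
  · rw [e12, ea 11 (by norm_num) (by norm_num)]
    exact P.chain b hbm
  · intro v hv _
    obtain ⟨o, x, ho, hx, hob, hst, rfl⟩ := hlt v hv
    rw [hown o ho x (by omega)]
    exact ⟨ho, hob, replaces_outer hE hrec hbm ho ((F.starter_eq_iff.1 hst).height_lt F)⟩
  rintro c2 s2 ⟨hc2, hI2, hcol2⟩
  refine WP.seq (WP.cmd ?_)
  have hin : ∀ y ≤ (blk b).d, ∀ k, s1.arr 8 (slotOffset blk b + y) = k + 1 →
      Alive m (starter L m blk) rem b y ∧ starter L m blk b y = k + 1 := by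
    intro y hy k hk
    have hA := (hslots.ne_zero_iff hbm hy).1 (by omega)
    rw [hslots.alive b y hA] at hk
    exact ⟨hA, hk⟩
  refine WP.mono (innerLoop_spec hB (new := newRecord E blk g b) (outs := liveSlots s1 (lst b))
    (d := (blk b).d) (o := slotOffset blk b) (rem := rem.erase b)
    (M₀ := {k | ∃ v ∈ liveSlots s1 (lst b), k = s1.arr 9 v}) ?_ (by omega) ?_ ?_ ?_ ?_ ?_ ?_ ?_ ?_) ?_
  · refine hI2.kill ?_ (fun _ _ _ => rfl) rfl rfl hI2.killed hI2.kept
    intro x hx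
    simp [Cmd.run, Mem.setReg, show x ≠ 14 by omega]
  · simpa [Cmd.run, Mem.setReg, Collected] using hcol2
  · simp [Cmd.run, Mem.setReg, Expr.eval]
  · rw [ea 1 (by norm_num) (by norm_num)]
    exact P.d b hbm
  · rw [e11]
    exact P.off b hbm
  · intro v hv x hx
    obtain ⟨o, x', ho, hx', -, -, rfl⟩ := hlt v (List.mem_filter.1 hv).1
    have := slot_lt (blk := blk) (x := x' + x) ho (by omega)
    omega
  · have := slot_lt (blk := blk) hbm le_rfl
    omega
  · intro v hv y hy x hx e
    obtain ⟨o, x', ho, hx', hob, -, rfl⟩ := hlt v (List.mem_filter.1 hv).1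
    exact hob (slot_inj (x := x' + y) (by omega) hx (by omega)).1
  · intro y hy k hk
    have hs := F.starter_eq_iff.1 (hin y hy k hk).2
    exact ⟨hs.2.2.1, hs.2.2.2.1, replaces_inner hE hrec hbm hs.2.2.1 (hs.height_lt F)⟩
  rintro c3 s3 ⟨hc3, hI3⟩
  have kill : ∀ o < m, ∀ x ≤ (blk o).d, _ := fun o ho x hx =>
    mem_killed_iff (o := o) (x := x) F hL hslots hb hbm ho hx
  -- Marks are per block, the abstract update is per existing collision position; `exists_link_iff`
  -- translates between a position and a present slot.
  have hMi : ∀ k < m, (k ∈ innerUpTo s1 (slotOffset blk b) ((blk b).d + 1) ↔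
      ∃ p, g.InnerAt (blk b) (blk k) p) := by
    intro k hk
    simp only [I.tracks.innerAt_iff F hbm hk, exists_link_iff F]
    constructor
    · rintro ⟨y, hy, h⟩
      exact ⟨y, hin y (by omega) k h⟩
    · rintro ⟨y, h1, h2⟩
      have hr := alive_range F h1
      exact ⟨y, by omega, (hslots.alive b y h1).trans h2⟩
  have hMo : ∀ k < m, (k ∈ {k | ∃ v ∈ liveSlots s1 (lst b), k = s1.arr 9 v} ↔
      ∃ p, g.OuterAt (blk b) (blk k) p) := by
    intro k hk
    simp only [I.tracks.outerAt_iff F hbm hk, exists_link_iff F, Set.mem_ofPred_eq,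
      mem_liveSlots_iff F hL hslots hbm]
    constructor
    · rintro ⟨v, ⟨o, x, h1, h2, rfl⟩, e⟩
      have hr := alive_range F h1
      rw [hown o hr.1 x hr.2] at e
      exact ⟨x, e ▸ h1, e ▸ h2⟩
    · rintro ⟨x, h1, h2⟩
      have hr := alive_range F h1
      exact ⟨_, ⟨k, x, h1, h2, rfl⟩, (hown k hk x hr.2).symm⟩
  have arr3 : ∀ a, a ≠ 4 → a ≠ 5 → a ≠ 8 → a ≠ 12 → a ≠ 13 → s3.arr a = s.arr a := by
    intro a h4 h5 h8 h12 h13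
    rw [hI3.arr a h5 h8 h12 h13, ea a h4 h5]
  refine ⟨b, hb, ⟨?_, ?_, ?_, ?_, ?_⟩, ⟨?_, ?_, ?_, ⟨?_, ?_⟩, ?_, ?_, hI3.tree, ?_, ?_, ?_, ?_, ?_,
    ?_⟩, ?_⟩
  · rw [hI3.reg 1 (by norm_num), e1]
  · rw [arr3 1 (by norm_num) (by norm_num) (by norm_num) (by norm_num) (by norm_num)]
    exact P.d
  · rw [arr3 7 (by norm_num) (by norm_num) (by norm_num) (by norm_num) (by norm_num)]
    exact P.off
  · rw [arr3 9 (by norm_num) (by norm_num) (by norm_num) (by norm_num) (by norm_num)]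
    exact P.owner
  · rw [arr3 10 (by norm_num) (by norm_num) (by norm_num) (by norm_num) (by norm_num),
      arr3 11 (by norm_num) (by norm_num) (by norm_num) (by norm_num) (by norm_num)]
    exact P.chain
  · exact (Finset.erase_subset _ _).trans I.sub
  · exact I.tracks.choose F E.scoring I.sub hb
  · refine I.steps.tail ⟨blk b, (I.tracks.remaining _).2 ⟨b, hb, rfl⟩, ?_, rfl⟩
    intro B' hB'
    obtain ⟨k, hk, rfl⟩ := (I.tracks.remaining _).1 hB'
    exact hmax k hk
  · intro o x hA
    have hr := alive_range F hA
    rw [hI3.kept, hslots.alive o x hA.of_erase]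
    intro hk
    exact ((kill o hr.1 x hr.2).1 hk).2 hA
  · intro o ho x hx hA
    by_cases hk : slotOffset blk o + x ∈ killedUpTo s1 (slotOffset blk b) (liveSlots s1 (lst b))
        ((blk b).d + 1)
    · exact hI3.killed _ hk
    · rw [hI3.kept _ hk]
      refine hslots.dead o ho x hx fun hA' => hk ?_
      exact (kill o ho x hx).2 ⟨hA', hA⟩
  · intro k
    rw [hI3.reg 3 (by norm_num), e3]
    by_cases hk : k ∈ {k | ∃ v ∈ liveSlots s1 (lst b), k = s1.arr 9 v} ∪
        innerUpTo s1 (slotOffset blk b) ((blk b).d + 1)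
    · rw [hI3.marked k hk]
    · rw [hI3.unmarked k hk]
      exact (hB.mark k).le
  · intro k hk
    -- Inner blocks are higher and outer blocks lower than `b`, so the comparison of heights in
    -- `newRecord` selects the branch of `choose`.
    have hlt1 : ∀ p, g.InnerAt (blk b) (blk k) p → (blk b).height < (blk k).height := fun p h => h.2
    have hlt2 : ∀ p, g.OuterAt (blk b) (blk k) p → (blk k).height < (blk b).height := fun p h => h.2
    simp only [GState.choose]
    by_cases h1 : ∃ p, g.InnerAt (blk b) (blk k) p
    · rw [if_pos h1, hI3.updated k (Or.inr ((hMi k hk).2 h1)), newRecord,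
        if_pos (hlt1 _ h1.choose_spec)]
    · rw [if_neg h1]
      by_cases h2 : ∃ p, g.OuterAt (blk b) (blk k) p
      · rw [if_pos h2, hI3.updated k (Or.inl ((hMo k hk).2 h2)), newRecord,
          if_neg (not_lt.2 (hlt2 _ h2.choose_spec).le)]
      · rw [if_neg h2, hI3.unchanged k, hrec k hk]
        rintro (h | h)
        · exact h2 ((hMo k hk).1 h)
        · exact h1 ((hMi k hk).1 h)
  · rw [hI3.real 0 (by norm_num), ev0]
  · rw [hI3.real 1 (by norm_num), ev1]
  · rw [hI3.reg 2 (by norm_num), e2]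
  · rw [hI3.reg 3 (by norm_num), e3]
    simp [GState.choose]
  · have := I.card
    have := Finset.card_pos.2 ⟨b, hb⟩
    simp only [GState.choose, List.length_append, List.length_singleton,
      Finset.card_erase_of_mem hb]
    omega
  · intro i hi
    simp only [GState.choose, List.length_append, List.length_singleton] at hi ⊢
    rw [hI3.arr 4 (by norm_num) (by norm_num) (by norm_num) (by norm_num), ea4]
    by_cases h : i = g.BS.length
    · subst h
      simp [hbm]
    · rw [Function.update_of_ne h, List.getElem?_append_left (by omega)]
      exact I.out i (by omega)
  · have hli := length_liveSlots_le F hL hslots hbm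
    have hic : ((Finset.range ((blk b).d + 1)).filter
        fun y => s1.arr 8 (slotOffset blk b + y) ≠ 0).card ≤
        (innerCols m (fun k => (blk k).d) (starter L m blk) rem b).card := by
      apply Finset.card_le_card
      intro y hy
      rw [Finset.mem_filter, Finset.mem_range] at hy
      simp only [innerCols, Finset.mem_filter, Finset.mem_range]
      exact ⟨hy.1, (hslots.ne_zero_iff hbm (by omega)).1 hy.2⟩
    have hprod := Nat.mul_le_mul hli hic
    have h14 : (Cmd.set 14 (.const 0)).cost = 2 := by decide
    rw [h14]
    simp only [mul_add] at *
    omega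

end Pass

/-! ## Preparing the memory -/

section Prepare

variable {α : Type*} [LinearOrder α] {n : ℕ} {σ : Type*} {L : Fin n → α} {E : Env n σ} {m : ℕ}
  {blk : ℕ → Block n} {s₀ s : Mem σ}

/-- The memory `s` holds the input. -/
structure HoldsInput (L : Fin n → α) (m : ℕ) (blk : ℕ → Block n) (s : Mem σ) : Prop where
  r1 : s.reg 1 = m
  lf : ∀ p : Fin n, s.arr 0 p = lf L p
  d : ∀ k < m, s.arr 1 k = (blk k).d
  i : ∀ k < m, s.arr 2 k = (blk k).i
  j : ∀ k < m, s.arr 3 k = (blk k).j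

/-- `s'` differs from `s` only in registers from `10` on and in the arrays from `A`. -/
structure Frame (A : Set ℕ) (s s' : Mem σ) : Prop where
  reg : ∀ x < 10, s'.reg x = s.reg x
  arr : ∀ a, a ∉ A → s'.arr a = s.arr a
  real : s'.real = s.real
  record : s'.record = s.record

theorem Frame.refl (A : Set ℕ) (s : Mem σ) : Frame A s s :=
  ⟨fun _ _ => rfl, fun _ _ => rfl, rfl, rfl⟩

theorem Frame.trans {A : Set ℕ} {s s' s'' : Mem σ} (h : Frame A s s') (h' : Frame A s' s'') :
    Frame A s s'' :=
  ⟨fun x hx => (h'.reg x hx).trans (h.reg x hx), fun a ha => (h'.arr a ha).trans (h.arr a ha),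
    h'.real.trans h.real, h'.record.trans h.record⟩

theorem HoldsInput.frame {A : Set ℕ} {s' : Mem σ} (h : HoldsInput L m blk s) (hF : Frame A s s')
    (hA : ∀ a < 4, a ∉ A) : HoldsInput L m blk s' := by
  refine ⟨?_, ?_, ?_, ?_, ?_⟩
  · rw [hF.reg 1 (by norm_num), h.r1]
  · rw [hF.arr 0 (hA 0 (by norm_num))]
    exact h.lf
  · rw [hF.arr 1 (hA 1 (by norm_num))]
    exact h.d
  · rw [hF.arr 2 (hA 2 (by norm_num))]
    exact h.i
  · rw [hF.arr 3 (hA 3 (by norm_num))]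
    exact h.j

/-- Mark the positions of the start interval of the block in register `10`. -/
def fillInterval : Prog :=
  .loop (.not (.lt (.load 3 (R 10)) (R 11)))
    (block [.store 6 (R 11) (.add (R 10) (.const 1)), .set 11 (.add (R 11) (.const 1))])

/-- Array `6` is filled with the numbers (plus one) of the blocks starting at the positions. -/
def fillStarts : Prog :=
  .seq (.cmd (.set 10 (.const 0))) (.loop (.lt (R 10) (R 1)) (.seq (.cmd (.set 11 (.load 2 (R 10))))
    (.seq fillInterval (.cmd (.set 10 (.add (R 10) (.const 1)))))))

theorem fillInterval_spec (hw : 4 * m + 4 ≤ 2 ^ E.w) (hw' : n + 1 < 2 ^ E.w)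
    (h : HoldsInput L m blk s) {k : ℕ} (hk : k < m) (h10 : s.reg 10 = k)
    (h11 : s.reg 11 = (blk k).i) (hij : (blk k).i ≤ (blk k).j) :
    WP E fillInterval s fun c s' => c ≤ 20 * (blk k).height + 10 ∧ Frame {6} s s' ∧
      s'.reg 10 = k ∧ ∀ p, s'.arr 6 p =
        if ((blk k).i : ℕ) ≤ p ∧ p ≤ (blk k).j then k + 1 else s.arr 6 p := by
  have hw1 : 1 % 2 ^ E.w = 1 := Nat.mod_eq_of_lt (by omega)
  have hm1 : (k + 1) % 2 ^ E.w = k + 1 := Nat.mod_eq_of_lt (by omega)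
  rw [Fin.le_def] at hij
  refine WP.mono (WP.loop (γ := ℕ) (fun q s' => s'.reg 11 = q ∧ (blk k).i ≤ q ∧
    q ≤ (blk k).j + 1 ∧ Frame {6} s s' ∧ s'.reg 10 = k ∧
    ∀ p, s'.arr 6 p = if ((blk k).i : ℕ) ≤ p ∧ p < q then k + 1 else s.arr 6 p)
    (fun q => 20 * ((blk k).j + 1 - q)) ?_ (g := ((blk k).i : ℕ)) ?_) ?_
  · rintro q s1 ⟨e11, hq1, hq2, hF, e10, h6⟩ ht
    have h1 := h.frame hF (by intro a ha; simp; omega)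
    simp only [Test.holds, Expr.eval, e10, e11, h1.j k hk, not_lt] at ht
    have hjn := (blk k).j.isLt
    have hm2 : (q + 1) % 2 ^ E.w = q + 1 := Nat.mod_eq_of_lt (by omega)
    refine WP.block ?_
    generalize hs2 : List.foldl (fun s c => Cmd.run E s c) s1 _ = s2
    have r2 : s2.reg = Function.update s1.reg 11 (q + 1) := by
      subst hs2
      simp [Cmd.run, Expr.eval, Mem.setReg, Mem.setArr, hw1, hm2, e11]
    have a2 : s2.arr = Function.update s1.arr 6 (Function.update (s1.arr 6) q (k + 1)) := by
      subst hs2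
      simp [Cmd.run, Expr.eval, Mem.setReg, Mem.setArr, hw1, hm1, e10, e11]
    refine ⟨q + 1, ⟨by simp [r2], by omega, by omega, hF.trans ⟨?_, ?_, ?_, ?_⟩, ?_, ?_⟩, ?_⟩
    · intro x hx
      simp [r2, show x ≠ 11 by omega]
    · intro a ha
      rw [Set.mem_singleton_iff] at ha
      simp [a2, ha]
    · subst hs2; rfl
    · subst hs2; rfl
    · simp [r2, e10]
    · intro p
      rw [a2, Function.update_self, Function.update_apply, h6 p]
      split_ifs <;> first | rfl | omega
    · simp only [blockCost, List.map, List.sum_cons, List.sum_nil, Test.cost, Expr.cost, Cmd.cost]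
      omega
  · refine ⟨h11, le_rfl, by omega, Frame.refl _ _, h10, ?_⟩
    intro p
    rw [if_neg (by omega)]
  · rintro c s' ⟨q, ⟨e11, hq1, hq2, hF, e10, h6⟩, ht, hc⟩
    have h1 := h.frame hF (by intro a ha; simp; omega)
    simp only [Test.holds, Expr.eval, e10, e11, h1.j k hk, not_not] at ht
    obtain rfl : q = (blk k).j + 1 := by omega
    refine ⟨?_, hF, e10, ?_⟩
    · simp only [Test.cost, Expr.cost] at hc
      rw [Block.height]
      omega
    · intro p
      rw [h6 p]
      simp only [Nat.lt_succ_iff]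

/-- The start intervals are disjoint, so no mark is overwritten, and their total length is at most
`n`. -/
theorem fillStarts_spec (F : Family L m blk) (hw : 4 * m + 4 ≤ 2 ^ E.w) (hw' : n + 1 < 2 ^ E.w)
    (h : HoldsInput L m blk s) (h6 : ∀ p, s.arr 6 p = 0) :
    WP E fillStarts s fun c s' => c ≤ 40 * m + 20 * n + 10 ∧ Frame {6} s s' ∧
      ∀ p k, s'.arr 6 p = k + 1 ↔ k < m ∧ ((blk k).i : ℕ) ≤ p ∧ p ≤ (blk k).j := by
  have hw1 : 1 % 2 ^ E.w = 1 := Nat.mod_eq_of_lt (by omega)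
  have hdis : ∀ k < m, ∀ k' < m, ∀ p : ℕ, (blk k).i ≤ p → p ≤ (blk k).j → (blk k').i ≤ p →
      p ≤ (blk k').j → k = k' := by
    intro k hk k' hk' p h1 h2 h3 h4
    have hp : p < n := by have := (blk k).j.isLt; omega
    exact F.start_unique (p := ⟨p, hp⟩) hk hk' ⟨h1, h2⟩ ⟨h3, h4⟩
  refine WP.seq (WP.cmd ?_)
  have e0 : (Cmd.set 10 (.const 0)).run E s = s.setReg 10 0 := by simp [Cmd.run, Expr.eval]
  rw [e0]
  refine WP.mono (WP.loop (γ := ℕ) (fun k s' => s'.reg 10 = k ∧ k ≤ m ∧ Frame {6} s s' ∧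
    ∀ p k', s'.arr 6 p = k' + 1 ↔ k' < k ∧ ((blk k').i : ℕ) ≤ p ∧ p ≤ (blk k').j)
    (fun k => ∑ k' ∈ Finset.Ico k m, (40 + 20 * (blk k').height)) ?_ (g := 0) ?_) ?_
  · rintro k s1 ⟨e10, hk, hF, hs6⟩ ht
    have h1 := h.frame hF (by intro a ha; simp; omega)
    simp only [Test.holds, Expr.eval, e10, h1.r1] at ht
    have hm1 : (k + 1) % 2 ^ E.w = k + 1 := Nat.mod_eq_of_lt (by omega)
    rw [Finset.sum_eq_sum_Ico_succ_bot ht]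
    refine WP.seq (WP.cmd ?_)
    have e11 : (Cmd.set 11 (.load 2 (R 10))).run E s1 = s1.setReg 11 (blk k).i := by
      simp [Cmd.run, Expr.eval, e10, h1.i k ht]
    rw [e11]
    have hF1 : Frame {6} s1 (s1.setReg 11 (blk k).i) := by
      refine ⟨?_, fun _ _ => rfl, rfl, rfl⟩
      intro x hx
      simp [Mem.setReg, show x ≠ 11 by omega]
    refine WP.seq (WP.mono (fillInterval_spec hw hw' (h1.frame hF1 (by intro a ha; simp; omega)) ht
      (by simpa [Mem.setReg] using e10) (by simp [Mem.setReg]) (F.bl ht).1) ?_)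
    rintro c s2 ⟨hc, hF2, r10, h26⟩
    refine WP.cmd ⟨k + 1, ⟨?_, ht, (hF.trans hF1).trans (hF2.trans ⟨?_, ?_, ?_, ?_⟩), ?_⟩, ?_⟩
    · simp [Cmd.run, Expr.eval, Mem.setReg, r10, hw1, hm1]
    · intro x hx
      simp [Cmd.run, Mem.setReg, show x ≠ 10 by omega]
    · intro _ _; rfl
    · rfl
    · rfl
    · intro p k'
      have : ((Cmd.set 10 (.add (R 10) (.const 1))).run E s2).arr = s2.arr := rfl
      rw [this, h26 p]
      have e6 : (s1.setReg 11 (blk k).i).arr = s1.arr := rfl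
      rw [e6]
      split_ifs with hp
      · constructor
        · intro e
          obtain rfl : k = k' := by omega
          exact ⟨by omega, hp⟩
        · rintro ⟨h2, h3, h4⟩
          rw [hdis k ht k' (by omega) p hp.1 hp.2 h3 h4]
      · rw [hs6]
        constructor
        · rintro ⟨h2, h3⟩
          exact ⟨by omega, h3⟩
        · rintro ⟨h2, h3⟩
          refine ⟨lt_of_le_of_ne (by omega) ?_, h3⟩
          rintro rfl
          exact hp h3
    · simp only [Test.cost, Expr.cost, Cmd.cost]
      omega
  · refine ⟨by simp [Mem.setReg], Nat.zero_le _, ⟨?_, fun _ _ => rfl, rfl, rfl⟩, ?_⟩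
    · intro x hx
      simp [Mem.setReg, show x ≠ 10 by omega]
    · intro p k
      simp [Mem.setReg, h6]
  · rintro c s' ⟨k, ⟨e10, hk, hF, hs6⟩, ht, hc⟩
    have h1 := h.frame hF (by intro a ha; simp; omega)
    simp only [Test.holds, Expr.eval, e10, h1.r1] at ht
    obtain rfl : k = m := by omega
    refine ⟨?_, hF, hs6⟩
    have hh := F.sum_height_le
    rw [Finset.Ico_self, Finset.sum_empty, Nat.Ico_zero_eq_range, Finset.sum_add_distrib,
      Finset.sum_const, Finset.card_range, ← Finset.mul_sum] at hc
    simp only [Test.cost, Expr.cost, Cmd.cost, smul_eq_mul] at hc ⊢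
    omega

/-! ### Filling the slots and linking those with the same inner block -/

theorem Chain.congr {nxt nxt' : ℕ → ℕ} {l : List ℕ} {e : ℕ} (h : Chain nxt e l)
    (heq : ∀ a ∈ l, nxt' a = nxt a) : Chain nxt' e l := by
  induction l generalizing e with
  | nil => exact h
  | cons a l ih =>
    refine ⟨h.1, ?_⟩
    rw [heq a (by simp)]
    exact ih h.2 fun a' ha' => heq a' (by simp [ha'])

theorem exists_slot {N v : ℕ} (hv : v < slotOffset blk N) :
    ∃ o < N, ∃ x ≤ (blk o).d, v = slotOffset blk o + x := by
  induction N with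
  | zero => simp [slotOffset] at hv
  | succ N ih =>
    rw [slotOffset_succ] at hv
    by_cases h : v < slotOffset blk N
    · obtain ⟨o, ho, h⟩ := ih h
      exact ⟨o, by omega, h⟩
    · exact ⟨N, by omega, v - slotOffset blk N, by omega, by omega⟩

/-- The slots below `c` with value `k + 1`, in decreasing order. -/
def slotList (A : ℕ → ℕ) (c k : ℕ) : List ℕ := ((List.range c).filter fun v => A v = k + 1).reverse

/-- Fill the slots of the block in register `10`. -/
def buildRow : Prog :=
  .loop (.not (.lt (.load 1 (R 10)) (R 13)))
    (.seq (block [.store 9 (R 12) (R 10), .set 14 (.load 6 (R 11))])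
      (.seq (.ite (.and (.lt (.const 0) (R 14)) (.not (.eq (R 14) (.add (R 10) (.const 1)))))
          (block [.store 8 (R 12) (R 14), .store 11 (R 12) (.load 10 (.sub (R 14) (.const 1))),
            .store 10 (.sub (R 14) (.const 1)) (.add (R 12) (.const 1))])
          (.cmd .skip))
        (block [.set 12 (.add (R 12) (.const 1)), .set 13 (.add (R 13) (.const 1)),
          .set 11 (.load 0 (R 11))])))

/-- Fill the slots of all blocks. -/
def buildSlots : Prog :=
  .seq (block [.set 10 (.const 0), .set 12 (.const 0)]) (.loop (.lt (R 10) (R 1))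
    (.seq (block [.store 7 (R 10) (R 12), .set 11 (.load 2 (R 10)), .set 13 (.const 0)])
      (.seq buildRow (.cmd (.set 10 (.add (R 10) (.const 1)))))))

/-- The first `c` slots are filled, and the first `k` offsets. -/
structure Built (L : Fin n → α) (m : ℕ) (blk : ℕ → Block n) (s₀ : Mem σ) (k c : ℕ) (s : Mem σ) :
    Prop where
  frame : Frame {7, 8, 9, 10, 11} s₀ s
  r12 : s.reg 12 = c
  off : ∀ k' < k, s.arr 7 k' = slotOffset blk k'
  owner : ∀ o < m, ∀ x ≤ (blk o).d, slotOffset blk o + x < c → s.arr 9 (slotOffset blk o + x) = o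
  slot : ∀ o < m, ∀ x ≤ (blk o).d, slotOffset blk o + x < c →
    s.arr 8 (slotOffset blk o + x) = starter L m blk o x
  empty : ∀ v, c ≤ v → s.arr 8 v = 0
  chain : ∀ k < m, Chain (s.arr 11) (s.arr 10 k) (slotList (s.arr 8) c k)

theorem slotList_congr {A A' : ℕ → ℕ} {c k : ℕ} (h : ∀ v < c, A' v = A v) :
    slotList A' c k = slotList A c k := by
  unfold slotList
  congr 1
  apply List.filter_congr
  intro v hv
  rw [h v (List.mem_range.1 hv)]

theorem slotList_succ {A : ℕ → ℕ} {c k : ℕ} : slotList A (c + 1) k =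
    if A c = k + 1 then c :: slotList A c k else slotList A c k := by
  unfold slotList
  rw [List.range_succ, List.filter_append, List.reverse_append]
  split_ifs with h <;> simp [h]

/-- It suffices to follow LF from the first row: a start column containing the first position of a
column of `o` contains that whole column. A new slot is pushed to the front of its list, whence the
decreasing order in `slotList`. -/
theorem buildRow_spec (F : Family L m blk) (hw : 4 * m + 4 ≤ 2 ^ E.w)
    (hw' : slotOffset blk m + 3 ≤ 2 ^ E.w) (h : HoldsInput L m blk s₀)
    (h6 : ∀ p k, s₀.arr 6 p = k + 1 ↔ k < m ∧ ((blk k).i : ℕ) ≤ p ∧ p ≤ (blk k).j)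
    {k : ℕ} (hk : k < m) (hB : Built L m blk s₀ (k + 1) (slotOffset blk k) s) (h10 : s.reg 10 = k)
    (h11 : s.reg 11 = (blk k).i) (h13 : s.reg 13 = 0) :
    WP E buildRow s fun c s' => c ≤ 100 * ((blk k).d + 1) + 10 ∧
      Built L m blk s₀ (k + 1) (slotOffset blk (k + 1)) s' ∧ s'.reg 10 = k := by
  have hw1 : 1 % 2 ^ E.w = 1 := Nat.mod_eq_of_lt (by omega)
  have hA : ∀ a < 4, a ∉ ({7, 8, 9, 10, 11} : Set ℕ) := by
    intro a ha
    simp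
    omega
  refine WP.mono (WP.loop (γ := ℕ) (fun x s' => s'.reg 13 = x ∧ x ≤ (blk k).d + 1 ∧
    s'.reg 10 = k ∧ s'.reg 11 = (lf L)^[x] (blk k).i ∧
    Built L m blk s₀ (k + 1) (slotOffset blk k + x) s')
    (fun x => 100 * ((blk k).d + 1 - x)) ?_ (g := 0) ⟨h13, by omega, h10, h11, hB⟩) ?_
  · rintro x s1 ⟨e13, hx, e10, e11, hB1⟩ ht
    have h1 := h.frame hB1.frame hA
    simp only [Test.holds, Expr.eval, e10, e13, h1.d k hk, not_lt] at ht
    set c := slotOffset blk k + x with hc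
    have hcN : c < slotOffset blk m := slot_lt hk ht
    have hxc : x ≤ c := by omega
    have hm1 : (k + 1) % 2 ^ E.w = k + 1 := Nat.mod_eq_of_lt (by omega)
    have hm2 : (c + 1) % 2 ^ E.w = c + 1 := Nat.mod_eq_of_lt (by omega)
    have hm3 : (x + 1) % 2 ^ E.w = x + 1 := Nat.mod_eq_of_lt (by omega)
    have e6 : s1.arr 6 = s₀.arr 6 := hB1.frame.arr 6 (by simp)
    set J := s1.arr 6 ((lf L)^[x] (blk k).i) with hJ
    refine WP.seq (WP.block ?_)
    generalize hs2 : List.foldl (fun s c => Cmd.run E s c) s1 _ = s2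
    have r2 : s2.reg = Function.update s1.reg 14 J := by
      subst hs2
      simp [Cmd.run, Expr.eval, Mem.setReg, Mem.setArr, e11, hJ]
    have a2 : s2.arr = Function.update s1.arr 9 (Function.update (s1.arr 9) c k) := by
      subst hs2
      simp [Cmd.run, Expr.eval, Mem.setReg, Mem.setArr, e10, hB1.r12]
    have f2 : s2.real = s1.real ∧ s2.record = s1.record := by
      subst hs2
      exact ⟨rfl, rfl⟩
    clear hs2
    have hfin : ∀ s3 : Mem σ, s3.reg = s2.reg → s3.real = s2.real → s3.record = s2.record →
        (∀ a, a ≠ 8 → a ≠ 10 → a ≠ 11 → s3.arr a = s2.arr a) →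
        s3.arr 8 = Function.update (s1.arr 8) c (starter L m blk k x) →
        (∀ k < m, Chain (s3.arr 11) (s3.arr 10 k) (slotList (s3.arr 8) (c + 1) k)) →
        ∀ cc, cc ≤ 80 → WP E (block [.set 12 (.add (R 12) (.const 1)),
          .set 13 (.add (R 13) (.const 1)), .set 11 (.load 0 (R 11))]) s3 fun c' s4 =>
          ∃ g', (s4.reg 13 = g' ∧ g' ≤ (blk k).d + 1 ∧ s4.reg 10 = k ∧
            s4.reg 11 = (lf L)^[g'] (blk k).i ∧
            Built L m blk s₀ (k + 1) (slotOffset blk k + g') s4) ∧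
            cc + c' + 100 * ((blk k).d + 1 - g') ≤ 100 * ((blk k).d + 1 - x) := by
      intro s3 hr3 hl3 hc3 ha3 ha8 hch cc hcc
      have a0 : s3.arr 0 = s1.arr 0 := by
        rw [ha3 0 (by norm_num) (by norm_num) (by norm_num), a2]
        simp
      refine WP.block ?_
      generalize hs4 : List.foldl (fun s c => Cmd.run E s c) s3 _ = s4
      have r4 : s4.reg = Function.update (Function.update (Function.update s2.reg 12 (c + 1)) 13
          (x + 1)) 11 (lf L ((lf L)^[x] (blk k).i)) := by
        subst hs4
        simp [Cmd.run, Expr.eval, Mem.setReg, hr3, r2, e11, e13, hB1.r12, hw1, hm2, hm3, a0, h1.lf]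
      have a4 : s4.arr = s3.arr := by
        subst hs4
        rfl
      have f4 : s4.real = s3.real ∧ s4.record = s3.record := by
        subst hs4
        exact ⟨rfl, rfl⟩
      have a9 : s3.arr 9 = Function.update (s1.arr 9) c k := by
        rw [ha3 9 (by norm_num) (by norm_num) (by norm_num), a2]
        simp
      refine ⟨x + 1, ⟨by simp [r4], by omega, by simp [r4, r2, e10], ?_, ?_⟩, ?_⟩
      · rw [Function.iterate_succ_apply']
        simp [r4]
      · refine ⟨hB1.frame.trans ⟨?_, ?_, ?_, ?_⟩, ?_, ?_, ?_, ?_, ?_, ?_⟩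
        · intro y hy
          simp [r4, r2, show y ≠ 11 by omega, show y ≠ 12 by omega, show y ≠ 13 by omega,
            show y ≠ 14 by omega]
        · intro a ha
          simp only [Set.mem_insert_iff, Set.mem_singleton_iff, not_or] at ha
          rw [a4, ha3 a ha.2.1 ha.2.2.2.1 ha.2.2.2.2, a2, Function.update_of_ne ha.2.2.1]
        · rw [f4.1, hl3, f2.1]
        · rw [f4.2, hc3, f2.2]
        · simp [r4, hc, add_assoc]
        · rw [a4, ha3 7 (by norm_num) (by norm_num) (by norm_num), a2,
            Function.update_of_ne (by norm_num)]
          exact hB1.off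
        · intro o ho y hy hlt
          rw [a4, a9]
          by_cases e : slotOffset blk o + y = c
          · rw [e, Function.update_self]
            exact (slot_inj hy ht e).1.symm
          · rw [Function.update_of_ne e]
            exact hB1.owner o ho y hy (by omega)
        · intro o ho y hy hlt
          rw [a4, ha8]
          by_cases e : slotOffset blk o + y = c
          · rw [e, Function.update_self]
            obtain ⟨rfl, rfl⟩ := slot_inj hy ht e
            rfl
          · rw [Function.update_of_ne e]
            exact hB1.slot o ho y hy (by omega)
        · intro v hv
          rw [a4, ha8, Function.update_of_ne (by omega)]
          exact hB1.empty v (by omega)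
        · rw [a4, ← add_assoc, ← hc]
          exact hch
      · simp only [blockCost, List.map, List.sum_cons, List.sum_nil, Expr.cost, Cmd.cost]
        omega
    have hlow : ∀ v < c, Function.update (s1.arr 8) c (starter L m blk k x) v = s1.arr 8 v :=
      fun v hv => Function.update_of_ne (by omega) _ _
    refine WP.seq (WP.ite ?_ ?_)
    · intro ht'
      simp only [Test.holds, Expr.eval, Nat.zero_mod, r2, Function.update_self,
        Function.update_of_ne (show (10 : ℕ) ≠ 14 by decide), e10, hw1, hm1] at ht'
      obtain ⟨j, hj⟩ : ∃ j, J = j + 1 := ⟨J - 1, by omega⟩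
      have hst : starter L m blk k x = j + 1 := by
        have hj' := hj
        rw [hJ, e6, h6] at hj'
        refine F.starter_eq_iff.2 ⟨hk, ht, hj'.1, ?_, hj'.2⟩
        -- The table of start positions also reports the block itself, at its column `0`; the second
        -- half of the test excludes this.
        rintro rfl
        exact ht'.2 hj
      have hjm := (F.starter_eq_iff.1 hst).2.2.1
      refine WP.block ?_
      generalize hs3 : List.foldl (fun s c => Cmd.run E s c) s2 _ = s3
      have a3 : s3.arr = Function.update (Function.update (Function.update s2.arr 8
          (Function.update (s1.arr 8) c (j + 1))) 11 (Function.update (s1.arr 11) c (s1.arr 10 j)))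
          10 (Function.update (s1.arr 10) j (c + 1)) := by
        subst hs3
        simp [Cmd.run, Expr.eval, Mem.setArr, r2, a2, hB1.r12, hw1, hm2, hj]
      have f3 : s3.reg = s2.reg ∧ s3.real = s2.real ∧ s3.record = s2.record := by
        subst hs3
        exact ⟨rfl, rfl, rfl⟩
      clear hs3
      refine WP.mono (hfin s3 f3.1 f3.2.1 f3.2.2 ?_ ?_ ?_ 70 (by omega)) ?_
      · intro a h8 h10 h11
        simp [a3, h8, h10, h11]
      · simp [a3, hst]
      · intro k' hk'
        have b8 : s3.arr 8 = Function.update (s1.arr 8) c (starter L m blk k x) := by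
          simp [a3, hst]
        have b10 : s3.arr 10 = Function.update (s1.arr 10) j (c + 1) := by simp [a3]
        have b11 : s3.arr 11 = Function.update (s1.arr 11) c (s1.arr 10 j) := by simp [a3]
        have hold : Chain (s3.arr 11) (s1.arr 10 k') (slotList (s1.arr 8) c k') := by
          refine (hB1.chain k' hk').congr ?_
          intro a ha
          simp only [slotList, List.mem_reverse, List.mem_filter, List.mem_range] at ha
          rw [b11, Function.update_of_ne (by omega)]
        rw [slotList_succ, b8, Function.update_self, slotList_congr hlow, hst, b10]
        by_cases e : k' = j
        · subst e
          rw [if_pos rfl, Function.update_self]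
          refine ⟨rfl, ?_⟩
          have : s3.arr 11 c = s1.arr 10 k' := by rw [b11, Function.update_self]
          rw [this]
          exact hold
        · rw [if_neg (by omega), Function.update_of_ne e]
          exact hold
      · rintro c2 s4 ⟨g', hg', hcc⟩
        refine ⟨g', hg', ?_⟩
        simp only [blockCost, List.map, List.sum_cons, List.sum_nil, Test.cost, Expr.cost, Cmd.cost]
        omega
    · intro ht'
      simp only [Test.holds, Expr.eval, Nat.zero_mod, r2, Function.update_self,
        Function.update_of_ne (show (10 : ℕ) ≠ 14 by decide), e10, hw1, hm1] at ht'
      have hst : starter L m blk k x = 0 := by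
        unfold starter
        rw [dif_neg]
        rintro ⟨j, hs⟩
        have hj : J = j + 1 := by
          rw [hJ, e6, h6]
          exact ⟨hs.2.2.1, hs.2.2.2.2⟩
        exact ht' ⟨by omega, by have := hs.2.2.2.1; omega⟩
      refine WP.cmd ?_
      refine WP.mono (hfin s2 rfl rfl rfl (fun _ _ _ _ => rfl) ?_ ?_ 70 (by omega)) ?_
      · rw [a2, hst, ← hB1.empty c le_rfl, Function.update_eq_self]
        simp
      · intro k' hk'
        have b : s2.arr 8 = s1.arr 8 ∧ s2.arr 10 = s1.arr 10 ∧ s2.arr 11 = s1.arr 11 := by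
          simp [a2]
        rw [slotList_succ, b.1, b.2.1, b.2.2, hB1.empty c le_rfl, if_neg (by omega)]
        exact hB1.chain k' hk'
      · rintro c2 s4 ⟨g', hg', hcc⟩
        refine ⟨g', hg', ?_⟩
        simp only [blockCost, List.map, List.sum_cons, List.sum_nil, Test.cost, Expr.cost, Cmd.cost]
        omega
  · rintro c s' ⟨x, ⟨e13, hx, e10, e11, hB1⟩, ht, hc⟩
    have h1 := h.frame hB1.frame hA
    simp only [Test.holds, Expr.eval, e10, e13, h1.d k hk, not_not] at ht
    obtain rfl : x = (blk k).d + 1 := by omega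
    rw [slotOffset_succ]
    simp only [Test.cost, Expr.cost] at hc
    exact ⟨by omega, hB1, e10⟩

theorem buildSlots_spec (F : Family L m blk) (hw : 4 * m + 4 ≤ 2 ^ E.w)
    (hw' : slotOffset blk m + 3 ≤ 2 ^ E.w) (h : HoldsInput L m blk s)
    (h6 : ∀ p k, s.arr 6 p = k + 1 ↔ k < m ∧ ((blk k).i : ℕ) ≤ p ∧ p ≤ (blk k).j)
    (h8 : ∀ v, s.arr 8 v = 0) (hh : ∀ k, s.arr 10 k = 0) :
    WP E buildSlots s fun c s' => c ≤ 100 * slotOffset blk m + 40 * m + 20 ∧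
      Built L m blk s m (slotOffset blk m) s' := by
  have hw1 : 1 % 2 ^ E.w = 1 := Nat.mod_eq_of_lt (by omega)
  have hA : ∀ a < 4, a ∉ ({7, 8, 9, 10, 11} : Set ℕ) := by
    intro a ha
    simp
    omega
  refine WP.seq (WP.block ?_)
  generalize hs1 : List.foldl (fun s c => Cmd.run E s c) s _ = s1
  have r1 : s1.reg = Function.update (Function.update s.reg 10 0) 12 0 := by
    subst hs1
    simp [Cmd.run, Expr.eval, Mem.setReg]
  have a1 : s1.arr = s.arr := by
    subst hs1
    rfl
  have f1 : s1.real = s.real ∧ s1.record = s.record := by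
    subst hs1
    exact ⟨rfl, rfl⟩
  clear hs1
  refine WP.mono (WP.loop (γ := ℕ) (fun k s' => s'.reg 10 = k ∧ k ≤ m ∧
    Built L m blk s k (slotOffset blk k) s')
    (fun k => 100 * (slotOffset blk m - slotOffset blk k) + 40 * (m - k)) ?_ (g := 0) ?_) ?_
  · rintro k s2 ⟨e10, hk, hB⟩ ht
    have h1 := h.frame hB.frame hA
    simp only [Test.holds, Expr.eval, e10, h1.r1] at ht
    have hm1 : (k + 1) % 2 ^ E.w = k + 1 := Nat.mod_eq_of_lt (by omega)
    refine WP.seq (WP.block ?_)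
    generalize hs3 : List.foldl (fun s c => Cmd.run E s c) s2 _ = s3
    have r3 : s3.reg = Function.update (Function.update s2.reg 11 (blk k).i) 13 0 := by
      subst hs3
      simp [Cmd.run, Expr.eval, Mem.setReg, Mem.setArr, e10, h1.i k ht]
    have a3 : s3.arr = Function.update s2.arr 7
        (Function.update (s2.arr 7) k (slotOffset blk k)) := by
      subst hs3
      simp [Cmd.run, Expr.eval, Mem.setReg, Mem.setArr, e10, hB.r12]
    have f3 : s3.real = s2.real ∧ s3.record = s2.record := by
      subst hs3
      exact ⟨rfl, rfl⟩
    clear hs3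
    have hB3 : Built L m blk s (k + 1) (slotOffset blk k) s3 := by
      have b : s3.arr 8 = s2.arr 8 ∧ s3.arr 9 = s2.arr 9 ∧ s3.arr 10 = s2.arr 10 ∧
          s3.arr 11 = s2.arr 11 := by simp [a3]
      refine ⟨hB.frame.trans ⟨?_, ?_, f3.1, f3.2⟩, ?_, ?_, ?_, ?_, ?_, ?_⟩
      · intro y hy
        simp [r3, show y ≠ 11 by omega, show y ≠ 13 by omega]
      · intro a ha
        simp only [Set.mem_insert_iff, Set.mem_singleton_iff, not_or] at ha
        simp [a3, ha.1]
      · simp [r3, hB.r12]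
      · intro k' hk'
        rw [a3, Function.update_self]
        by_cases e : k' = k
        · rw [e, Function.update_self]
        · rw [Function.update_of_ne e]
          exact hB.off k' (by omega)
      · rw [b.2.1]
        exact hB.owner
      · rw [b.1]
        exact hB.slot
      · rw [b.1]
        exact hB.empty
      · rw [b.1, b.2.2.1, b.2.2.2]
        exact hB.chain
    refine WP.seq (WP.mono (buildRow_spec F hw hw' h h6 ht hB3 (by simp [r3, e10]) (by simp [r3])
      (by simp [r3])) ?_)
    rintro c s4 ⟨hc, hB4, r10⟩
    refine WP.cmd ⟨k + 1, ⟨?_, ht, ?_⟩, ?_⟩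
    · simp [Cmd.run, Expr.eval, Mem.setReg, r10, hw1, hm1]
    · refine ⟨hB4.frame.trans ⟨?_, fun _ _ => rfl, rfl, rfl⟩, ?_, hB4.off, hB4.owner, hB4.slot,
        hB4.empty, hB4.chain⟩
      · intro x hx
        simp [Cmd.run, Mem.setReg, show x ≠ 10 by omega]
      · simp [Cmd.run, Mem.setReg, hB4.r12]
    · have hmono := slotOffset_mono blk (show k + 1 ≤ m from ht)
      have hs := slotOffset_succ blk k
      simp only [blockCost, List.map, List.sum_cons, List.sum_nil, Test.cost, Expr.cost, Cmd.cost]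
      omega
  · refine ⟨by simp [r1], Nat.zero_le _, ⟨⟨?_, fun _ _ => by rw [a1], f1.1, f1.2⟩, ?_, ?_, ?_, ?_,
      ?_, ?_⟩⟩
    · intro x hx
      simp [r1, show x ≠ 10 by omega, show x ≠ 12 by omega]
    · simp [r1, slotOffset]
    · intro k' hk'
      omega
    · intro o _ x _ hlt
      simp [slotOffset] at hlt
    · intro o _ x _ hlt
      simp [slotOffset] at hlt
    · intro v _
      rw [a1, h8]
    · intro k _
      rw [a1, hh]
      rfl
  · rintro c s' ⟨k, ⟨e10, hk, hB⟩, ht, hc⟩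
    have h1 := h.frame hB.frame hA
    simp only [Test.holds, Expr.eval, e10, h1.r1] at ht
    obtain rfl : k = m := by omega
    refine ⟨?_, hB⟩
    simp only [blockCost, List.map, List.sum_cons, List.sum_nil, Test.cost, Expr.cost, Cmd.cost] at *
    omega

theorem Built.slotLists (F : Family L m blk) (hB : Built L m blk s₀ m (slotOffset blk m) s) :
    SlotLists L m blk (slotList (s.arr 8) (slotOffset blk m)) where
  nodup k _ := List.nodup_reverse.2 (List.nodup_range.filter _)
  mem k hk v := by
    simp only [slotList, List.mem_reverse, List.mem_filter, List.mem_range, decide_eq_true_eq]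
    constructor
    · rintro ⟨hv, h⟩
      obtain ⟨o, ho, x, hx, rfl⟩ := exists_slot hv
      rw [hB.slot o ho x hx hv] at h
      exact ⟨o, x, h, rfl⟩
    · rintro ⟨o, x, h, rfl⟩
      have hs := F.starter_eq_iff.1 h
      have hv := slot_lt (blk := blk) hs.1 hs.2.1
      exact ⟨hv, (hB.slot o hs.1 x hs.2.1 hv).trans h⟩

/-- A slot holds a single entry and so belongs to at most one list. -/
theorem sum_length_slotList_le (A : ℕ → ℕ) (c m : ℕ) :
    ∑ k ∈ Finset.range m, (slotList A c k).length ≤ c := by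
  have h : ∀ k, (slotList A c k).length = ∑ v ∈ Finset.range c, if A v = k + 1 then 1 else 0 := by
    intro k
    induction c with
    | zero => rfl
    | succ c ih =>
      rw [slotList_succ, Finset.sum_range_succ, ← ih]
      split_ifs <;> simp
  simp only [h]
  rw [Finset.sum_comm]
  calc _ ≤ ∑ v ∈ Finset.range c, 1 := by
        refine Finset.sum_le_sum fun v _ => ?_
        rw [← Finset.card_filter, Finset.card_le_one]
        intro a ha b hb
        rw [Finset.mem_filter] at ha hb
        omega
    _ = c := by simp

/-- Initialize the records and the tournament tree. -/
def initTree : Prog :=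
  .seq (.cmd (.set 10 (.const 0))) (.loop (.lt (R 10) (R 1))
    (.seq (block [.initRecord (R 10), .store 5 (.add (R 1) (R 10)) (.add (R 10) (.const 1)),
        .set 23 (R 10)])
      (.seq fixLeaf (.cmd (.set 10 (.add (R 10) (.const 1)))))))

/-- The zero array is a correct tree for the empty set. Inserting the blocks one at a time reuses
`fixLeaf` and stays within the time bound. -/
theorem initTree_spec (hw : 4 * m + 4 ≤ 2 ^ E.w) (hE : ∀ k < m, E.blocks[k]? = some (blk k))
    (h1 : s.reg 1 = m) (h5 : ∀ v, s.arr 5 v = 0) (hreal : ∀ x, s.real x = 0) :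
    WP E initTree s fun c s' => c ≤ 100 * (Nat.log 2 m + 4) * m + 10 ∧
      (∀ x < 10, s'.reg x = s.reg x) ∧ (∀ a, a ≠ 5 → s'.arr a = s.arr a) ∧
      (∀ x < 10, s'.real x = 0) ∧
      (∀ k < m, s'.record k = some (E.scoring.init (blk k))) ∧
      TreeOK m (s'.arr 5) (cellScore E s') (Finset.range m) := by
  have hw1 : 1 % 2 ^ E.w = 1 := Nat.mod_eq_of_lt (by omega)
  refine WP.seq (WP.cmd ?_)
  have e0 : (Cmd.set 10 (.const 0)).run E s = s.setReg 10 0 := by simp [Cmd.run, Expr.eval]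
  rw [e0]
  refine WP.mono (WP.loop (γ := ℕ) (fun k s' => s'.reg 10 = k ∧ k ≤ m ∧
    (∀ x < 10, s'.reg x = s.reg x) ∧ (∀ a, a ≠ 5 → s'.arr a = s.arr a) ∧
    (∀ x < 10, s'.real x = 0) ∧ (∀ k' < k, s'.record k' = some (E.scoring.init (blk k'))) ∧
    TreeOK m (s'.arr 5) (cellScore E s') (Finset.range k))
    (fun k => 100 * (Nat.log 2 m + 4) * (m - k)) ?_ (g := 0) ?_) ?_
  · rintro k s1 ⟨e10, hk, hr, ha, hl, hc, hT⟩ ht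
    have e1 := (hr 1 (by norm_num)).trans h1
    simp only [Test.holds, Expr.eval, e10, e1] at ht
    have hm1 : (k + 1) % 2 ^ E.w = k + 1 := Nat.mod_eq_of_lt (by omega)
    have hm2 : (m + k) % 2 ^ E.w = m + k := Nat.mod_eq_of_lt (by omega)
    refine WP.seq (WP.block ?_)
    generalize hs2 : List.foldl (fun s c => Cmd.run E s c) s1 _ = s2
    have r2 : s2.reg = Function.update s1.reg 23 k := by
      subst hs2
      simp [Cmd.run, Expr.eval, Mem.setReg, Mem.setArr, Mem.setRecord, e10]
    have a2 : s2.arr = Function.update s1.arr 5 (Function.update (s1.arr 5) (m + k) (k + 1)) := by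
      subst hs2
      simp [Cmd.run, Expr.eval, Mem.setReg, Mem.setArr, Mem.setRecord, e10, e1, hw1, hm1, hm2]
    have c2 : s2.record = Function.update s1.record k (some (E.scoring.init (blk k))) := by
      subst hs2
      simp [Cmd.run, Expr.eval, Mem.setReg, Mem.setArr, Mem.setRecord, e10, hE k ht]
    have f2 : s2.real = s1.real := by
      subst hs2
      rfl
    clear hs2
    refine WP.seq (WP.mono (fixLeaf_spec (s := s2) (m := m) (k := k) (rem' := Finset.range (k + 1))
      hw ?_ ?_ ht hT ?_ ?_ ?_ ?_) ?_)
    · simp [r2, e1]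
    · simp [r2]
    · intro u hu
      simp [a2, hu]
    · intro k' hk'
      rw [cellScore, cellScore, c2, Function.update_of_ne hk']
    · simp [a2]
    · intro k' hk'
      simp only [Finset.mem_range]
      omega
    · rintro c s3 ⟨hcc, hF, hT3⟩
      refine WP.cmd ⟨k + 1, ⟨?_, ht, ?_, ?_, ?_, ?_, hT3⟩, ?_⟩
      · simp [Cmd.run, Expr.eval, Mem.setReg, hF.reg 10, r2, e10, hw1, hm1]
      · intro x hx
        simp [Cmd.run, Mem.setReg, hF.reg x (by omega) (by omega) (by omega), r2,
          show x ≠ 10 by omega, show x ≠ 23 by omega, hr x hx]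
      · intro a h5
        simp [Cmd.run, Mem.setReg, hF.arr a h5, a2, h5, ha a h5]
      · intro x hx
        simp [Cmd.run, Mem.setReg, hF.real x hx, f2, hl x hx]
      · intro k' hk'
        have : ((Cmd.set 10 (.add (R 10) (.const 1))).run E s3).record = s3.record := rfl
        rw [this, hF.record, c2]
        by_cases e : k' = k
        · rw [e, Function.update_self]
        · rw [Function.update_of_ne e, hc k' (by omega)]
      · obtain ⟨r, hr⟩ : ∃ r, m - k = r + 1 := ⟨m - k - 1, by omega⟩
        rw [hr, show m - (k + 1) = r by omega]
        simp only [blockCost, List.map, List.sum_cons, List.sum_nil, Test.cost, Expr.cost,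
          Cmd.cost, mul_add] at *
        omega
  · refine ⟨by simp [Mem.setReg], Nat.zero_le _, ?_, fun _ _ => rfl, fun x _ => hreal x, ?_, ?_, ?_⟩
    · intro x hx
      simp [Mem.setReg, show x ≠ 10 by omega]
    · intro k' hk'
      omega
    · intro k' _
      simp [Mem.setReg, h5]
    · intro v _ _
      simp [Mem.setReg, NodeOK, h5, comb]
  · rintro c s' ⟨k, ⟨e10, hk, hr, ha, hl, hc, hT⟩, ht, hcc⟩
    have e1 := (hr 1 (by norm_num)).trans h1
    simp only [Test.holds, Expr.eval, e10, e1] at ht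
    obtain rfl : k = m := by omega
    refine ⟨?_, hr, ha, hl, hc, hT⟩
    simp only [Test.cost, Expr.cost, Cmd.cost, Nat.sub_zero] at *
    omega

end Prepare

/-! ## The whole program -/

/-- The greedy block choice. -/
def greedy : Prog :=
  .seq fillStarts (.seq buildSlots (.seq initTree (.loop (.lt (R 3) (R 1)) pass)))

section Greedy

variable {α : Type*} [LinearOrder α] {n : ℕ} {σ : Type*} {L : Fin n → α} {E : Env n σ} {m : ℕ}
  {blk : ℕ → Block n} {s : Mem σ} {lst : ℕ → List ℕ} {g₀ g : GState n σ} {rem : Finset ℕ}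

theorem passes_spec (F : Family L m blk) (hL : SlotLists L m blk lst)
    (hE : ∀ k < m, E.blocks[k]? = some (blk k)) (hw : 4 * m + 4 ≤ 2 ^ E.w)
    (hw' : slotOffset blk m + 3 ≤ 2 ^ E.w)
    (P : Prepared m blk lst s) (I : Represents L E m blk g₀ g rem s) :
    WP E (.loop (.lt (R 3) (R 1)) pass) s fun c s' => ∃ g', Represents L E m blk g₀ g' ∅ s' ∧
      c ≤ 100 * (Nat.log 2 m + 6) * (∑ k ∈ rem, ((lst k).length + (blk k).d + 4)) +
        20 * (aliveSlots m (fun k => (blk k).d) (starter L m blk) rem).card + 3 := by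
  have hcost : (Test.lt (R 3) (R 1)).cost = 3 := by decide
  refine WP.mono (WP.loop (γ := GState n σ × Finset ℕ)
    (fun q s' => Prepared m blk lst s' ∧ Represents L E m blk g₀ q.1 q.2 s')
    -- Each remaining block holds a budget for its list and its columns, and each present slot one
    -- for being cleared. The summand `4`, one more than in `pass_spec`, pays for the test of the
    -- loop.
    (fun q => 100 * (Nat.log 2 m + 6) * (∑ k ∈ q.2, ((lst k).length + (blk k).d + 4)) +
        20 * (aliveSlots m (fun k => (blk k).d) (starter L m blk) q.2).card)
    ?_ (g := (g, rem)) ⟨P, I⟩) ?_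
  · rintro ⟨g, rem⟩ s1 ⟨P, I⟩ ht
    simp only at I
    simp only [Test.holds, Expr.eval, P.r1, I.count] at ht
    have hcard := I.card
    have hne : rem.Nonempty := Finset.card_pos.1 (by omega)
    refine WP.mono (pass_spec F hL hE hw hw' P I hne) ?_
    rintro c s2 ⟨b, hb, P2, I2, hc⟩
    refine ⟨(g.choose E.scoring (blk b), rem.erase b), ⟨P2, I2⟩, ?_⟩
    have hal := card_aliveSlots_erase F.collisionTable hb (Finset.mem_range.1 (I.sub hb))
    rw [hcost]
    simp only
    rw [← Finset.add_sum_erase rem _ hb]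
    simp only [mul_add] at *
    omega
  · rintro c s' ⟨⟨g', rem'⟩, ⟨P', I'⟩, ht, hc⟩
    simp only at I' hc
    simp only [Test.holds, Expr.eval, P'.r1, I'.count] at ht
    have hcard := I'.card
    have h0 : rem' = ∅ := Finset.card_eq_zero.1 (by omega)
    subst h0
    exact ⟨g', I', by omega⟩

theorem greedy_spec (F : Family L m blk) (Sc : Scoring n σ) (RB : List (Block n)) (w : ℕ)
    (hm : RB.length = m) (hblk : ∀ k < m, RB[k]? = some (blk k))
    (hRB : ∀ B, B ∈ RB ↔ ∃ k ∈ Finset.range m, B = blk k)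
    (hw : 4 * m + 4 ≤ 2 ^ w) (hw' : slotOffset blk m + 3 ≤ 2 ^ w) (hn : n + 1 < 2 ^ w) :
    WP ⟨w, RB, Sc⟩ greedy (inputMem L RB σ) fun c s' => ∃ g,
      Represents L ⟨w, RB, Sc⟩ m blk (GState.start L Sc RB) g ∅ s' ∧
      c ≤ 1000 * (Nat.log 2 m + 6) * (slotOffset blk m + m + n + 1) := by
  set E : Env n σ := ⟨w, RB, Sc⟩ with hEdef
  set s₀ := inputMem L RB σ with hs₀
  have hI : HoldsInput L m blk s₀ := by
    refine ⟨?_, ?_, ?_, ?_, ?_⟩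
    · simp [hs₀, inputMem, hm]
    · intro p
      simp [hs₀, inputMem]
    · intro k hk
      simp [hs₀, inputMem, hblk k hk]
    · intro k hk
      simp [hs₀, inputMem, hblk k hk]
    · intro k hk
      simp [hs₀, inputMem, hblk k hk]
  have hz : ∀ a, 4 ≤ a → ∀ v, s₀.arr a v = 0 := by
    intro a ha v
    simp [hs₀, inputMem, show a ≠ 0 by omega, show a ≠ 1 by omega, show a ≠ 2 by omega,
      show a ≠ 3 by omega]
  refine WP.seq (WP.mono (fillStarts_spec (E := E) F hw hn hI (hz 6 (by norm_num))) ?_)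
  rintro c1 s1 ⟨hc1, hF1, h16⟩
  have hI1 := hI.frame hF1 (by intro a ha; simp; omega)
  refine WP.seq (WP.mono (buildSlots_spec F hw hw' hI1 h16 ?_ ?_) ?_)
  · rw [hF1.arr 8 (by simp)]
    exact hz 8 (by norm_num)
  · rw [hF1.arr 10 (by simp)]
    exact hz 10 (by norm_num)
  rintro c2 s2 ⟨hc2, hB⟩
  have hI2 := hI1.frame hB.frame (by intro a ha; simp; omega)
  have harr : ∀ a, a ≠ 6 → a ≠ 7 → a ≠ 8 → a ≠ 9 → a ≠ 10 → a ≠ 11 → s2.arr a = s₀.arr a := by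
    intro a h6 h7 h8 h9 h10 h11
    rw [hB.frame.arr a (by simp [h7, h8, h9, h10, h11]), hF1.arr a (by simp [h6])]
  have hreg : ∀ x < 10, s2.reg x = s₀.reg x := by
    intro x hx
    rw [hB.frame.reg x hx, hF1.reg x hx]
  refine WP.seq (WP.mono (initTree_spec (blk := blk) hw hblk hI2.r1 ?_ ?_) ?_)
  · rw [harr 5 (by norm_num) (by norm_num) (by norm_num) (by norm_num) (by norm_num) (by norm_num)]
    exact hz 5 (by norm_num)
  · intro x
    rw [hB.frame.real, hF1.real]
    rfl
  rintro c3 s3 ⟨hc3, hr3, ha3, hl3, hrec3, hT⟩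
  have P : Prepared m blk (slotList (s2.arr 8) (slotOffset blk m)) s3 := by
    refine ⟨?_, ?_, ?_, ?_, ?_⟩
    · rw [hr3 1 (by norm_num), hI2.r1]
    · rw [ha3 1 (by norm_num)]
      exact hI2.d
    · rw [ha3 7 (by norm_num)]
      exact hB.off
    · rw [ha3 9 (by norm_num)]
      exact fun o ho x hx => hB.owner o ho x hx (slot_lt ho hx)
    · rw [ha3 10 (by norm_num), ha3 11 (by norm_num)]
      exact hB.chain
  have I : Represents L E m blk (GState.start L Sc RB) (GState.start L Sc RB) (Finset.range m)
      s3 := by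
    refine ⟨subset_rfl, tracks_start F Sc RB hRB, Relation.ReflTransGen.refl, ⟨?_, ?_⟩, ?_, hrec3,
      hT, ?_, ?_, ?_, ?_, ?_, ?_⟩
    · intro o x hA
      have hr := alive_range F hA
      rw [ha3 8 (by norm_num), hB.slot o hr.1 x hr.2 (slot_lt hr.1 hr.2)]
    · intro o ho x hx hA
      rw [ha3 8 (by norm_num), hB.slot o ho x hx (slot_lt ho hx)]
      by_contra h0
      obtain ⟨i, hi⟩ := Nat.exists_eq_succ_of_ne_zero h0
      refine hA ⟨Finset.mem_range.2 ho, ⟨i, ?_, hi⟩, ?_⟩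
      · exact Finset.mem_range.2 (F.starter_eq_iff.1 hi).2.2.1
      · intro z hz hz'
        exact absurd (Finset.mem_range.2 hz) hz'
    · intro k
      rw [ha3 12 (by norm_num), harr 12 (by norm_num) (by norm_num) (by norm_num) (by norm_num)
        (by norm_num) (by norm_num), hz 12 (by norm_num)]
      exact Nat.zero_le _
    · rw [hl3 0 (by norm_num)]
      rfl
    · rw [hl3 1 (by norm_num)]
      rfl
    · rw [hr3 2 (by norm_num), hreg 2 (by norm_num)]
      rfl
    · rw [hr3 3 (by norm_num), hreg 3 (by norm_num)]
      rfl
    · simp [GState.start]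
    · intro i hi
      simp [GState.start] at hi
  refine WP.mono (passes_spec F (hB.slotLists F) hblk hw hw' P I) ?_
  rintro c4 s4 ⟨g, hg, hc4⟩
  refine ⟨g, hg, ?_⟩
  have hal : (aliveSlots m (fun k => (blk k).d) (starter L m blk) (Finset.range m)).card ≤
      slotOffset blk m := by
    classical
    rw [slotOffset_eq_card, aliveSlots]
    exact Finset.card_le_card (Finset.filter_subset _ _)
  -- Lists and columns each contribute at most one visit per slot; the number of columns of a block
  -- already contains one of the four extra units.
  have hsum : ∑ k ∈ Finset.range m, ((slotList (s2.arr 8) (slotOffset blk m) k).length +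
      (blk k).d + 4) ≤ 2 * slotOffset blk m + 3 * m := by
    have h1 := sum_length_slotList_le (s2.arr 8) (slotOffset blk m) m
    have h2 : slotOffset blk m = ∑ k ∈ Finset.range m, (blk k).d + m := by
      simp [slotOffset, Finset.sum_add_distrib]
    rw [Finset.sum_add_distrib, Finset.sum_add_distrib, Finset.sum_const, Finset.card_range,
      smul_eq_mul]
    omega
  have hc4' := hc4.trans (Nat.add_le_add_right (Nat.add_le_add
    (Nat.mul_le_mul_left (100 * (Nat.log 2 m + 6)) hsum) (Nat.mul_le_mul_left 20 hal)) 3)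
  nlinarith [Nat.zero_le (Nat.log 2 m * slotOffset blk m), Nat.zero_le (Nat.log 2 m * m),
    Nat.zero_le (Nat.log 2 m * n), Nat.zero_le (Nat.log 2 m)]

end Greedy

theorem exists_family {α : Type*} [LinearOrder α] {n : ℕ} {L : Fin n → α} (hn : 0 < n)
    {RB : List (Block n)} (hnd : RB.Nodup) (hwm : ∀ B ∈ RB, IsWidthMaximal L B) :
    ∃ blk : ℕ → Block n, Family L RB.length blk ∧ (∀ k < RB.length, RB[k]? = some (blk k)) ∧
      ∀ B, B ∈ RB ↔ ∃ k ∈ Finset.range RB.length, B = blk k := by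
  have hget : ∀ k < RB.length, RB[k]? = some (RB.getD k ⟨0, ⟨0, hn⟩, ⟨0, hn⟩⟩) := by
    intro k hk
    rw [List.getD_eq_getElem _ _ hk, List.getElem?_eq_getElem hk]
  refine ⟨fun k => RB.getD k ⟨0, ⟨0, hn⟩, ⟨0, hn⟩⟩, ⟨?_, ?_⟩, hget, ?_⟩
  · intro k hk
    exact hwm _ (List.mem_of_getElem? (hget k hk))
  · intro k hk k' hk' h
    rw [List.getD_eq_getElem _ _ hk, List.getD_eq_getElem _ _ hk'] at h
    exact (List.Nodup.getElem_inj_iff hnd).1 h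
  · intro B
    constructor
    · intro hB
      obtain ⟨k, hk, rfl⟩ := List.getElem_of_mem hB
      exact ⟨k, Finset.mem_range.2 hk, (List.getD_eq_getElem _ _ hk).symm⟩
    · rintro ⟨k, hk, rfl⟩
      exact List.mem_of_getElem? (hget k (Finset.mem_range.1 hk))

end BWTTunnel

theorem theorem3 :
    ∃ (P : Prog) (C : ℕ), ∀ (α : Type*) [LinearOrder α] (n : ℕ) (S : Fin n → α)
      (SA : Equiv.Perm (Fin n)), NullTerminated S → IsSuffixArray S SA →
      ∀ RB : List (Block n), RB.Nodup → (∀ B ∈ RB, IsWidthMaximal (bwt S SA) B) →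
      ∀ (σ : Type*) (Sc : Scoring n σ) (w : ℕ), C * n ≤ 2 ^ w →
        ∃ (c : ℕ) (s : Mem σ) (BS : List (Block n)) (tBest : ℕ),
          Exec ⟨w, RB, Sc⟩ P (inputMem (bwt S SA) RB σ) c s ∧
          IsOutput RB s BS tBest ∧
          IsGreedyChoice (bwt S SA) Sc RB BS tBest ∧
          (c : ℝ) ≤ C * (n * max 1 (Real.logb 2 RB.length)) := by
  -- With at most `2 * n` slots and at most `2 * n` blocks the time is at most `1000 * (7 * M) * (6
  -- * n)`, that is `42000 * n * M`. The same constant makes the words long enough for all indices.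
  refine ⟨greedy, 50000, ?_⟩
  intro α _ n S SA hS _ RB hnd hwm σ Sc w hw
  have hn : 0 < n := by
    obtain ⟨e, -⟩ := hS
    exact e.pos
  obtain ⟨blk, F, hblk, hRB⟩ := exists_family hn hnd hwm
  have hN : slotOffset blk RB.length ≤ 2 * n := by
    rw [slotOffset_eq_card]
    exact F.card_slots_le
  have hmN : RB.length ≤ slotOffset blk RB.length := by
    have : ∑ _ ∈ Finset.range RB.length, 1 ≤ slotOffset blk RB.length :=
      Finset.sum_le_sum fun _ _ => Nat.le_add_left _ _
    simpa using this
  obtain ⟨c, s, hex, g, hg, hc⟩ := greedy_spec F Sc RB w rfl hblk hRB (by omega) (by omega)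
    (by omega)
  have hlen : g.BS.length = RB.length := by simpa using hg.card
  refine ⟨c, s, g.BS, g.tBest, hex, ⟨hlen, ?_, hg.tBest⟩, ⟨g, hg.steps, ?_, rfl, rfl⟩, ?_⟩
  · intro k hk
    obtain ⟨h1, h2⟩ := hg.out k (by omega)
    rw [hblk _ h1, h2]
  · ext B
    simp [hg.tracks.remaining]
  · have hlog : (Nat.log 2 RB.length : ℝ) ≤ Real.logb 2 RB.length := by
      -- Without blocks both logarithms are `0` by convention.
      rcases Nat.eq_zero_or_pos RB.length with h | h
      · simp [h]
      · rw [Real.le_logb_iff_rpow_le (by norm_num) (by exact_mod_cast h), Real.rpow_natCast]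
        exact_mod_cast Nat.pow_log_le_self 2 h.ne'
    set M := max 1 (Real.logb 2 RB.length) with hM
    have hM1 : 1 ≤ M := le_max_left _ _
    have hM2 : Real.logb 2 RB.length ≤ M := le_max_right _ _
    have hc' : (c : ℝ) ≤ 1000 * (Nat.log 2 RB.length + 6) * (6 * n) := by
      have : c ≤ 1000 * (Nat.log 2 RB.length + 6) * (6 * n) :=
        hc.trans (Nat.mul_le_mul_left _ (by omega))
      exact_mod_cast this
    have hn' : (0 : ℝ) ≤ n := Nat.cast_nonneg n
    calc (c : ℝ) ≤ 1000 * (Nat.log 2 RB.length + 6) * (6 * n) := hc'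
      _ ≤ 1000 * (7 * M) * (6 * n) := by
        gcongr
        linarith
      _ ≤ (50000 : ℕ) * (n * M) := by
        push_cast
        nlinarith [mul_nonneg hn' (le_trans zero_le_one hM1)]
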